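/- Let $n\ge 1$ and let $N$ be a positive divisor of $n$. Put $k=N/n$ and $\mathfrak g=\mathfrak{sl}_N(\mathbb C)$. For $k\in\mathbb C$, the rational Cherednik algebra $H_n(k)$ of type $A_{n-1}$ is the $\mathbb C$-algebra generated by the group algebra $\mathbb C[S_n]$ and elements $\mathrm x_1,\dots,\mathrm x_n,\mathrm y_1,\dots,\mathrm y_n$ with relations $\sigma \mathrm x_i\sigma^{-1}=\mathrm x_{\sigma(i)}$, $\sigma \mathrm y_i\sigma^{-1}=\mathrm y_{\sigma(i)}$ for $\sigma\in S_n$, $\sum_i \mathrm x_i=\sum_i \mathrm y_i=0$, $[\mathrm x_i,\mathrm x_j]=[\mathrm y_i,\mathrm y_j]=0$, and $[\mathrm x_i,\mathrm y_j]=\frac1n-k s_{ij}$ for $i\ne j$, where $s_{ij}$ is the transposition of $i$ and $j$. For an irreducible finite-dimensional representation $\pi$ of $S_n$, $L(\pi)$ denotes the irreducible lowest weight $H_n(k)$-module with lowest weight $\pi$, i.e. the quotient by its largest proper submodule of the standard module, which is the $H_n(k)$-module induced from $\pi$ with all $\mathrm y_i$ acting on $\pi$ by zero. Let $\Delta(n,N)$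 be the irreducible representation of $S_n$ corresponding to the partition $(\frac nN,\dots,\frac nN)$ with $N$ parts (where the partition $(n)$ corresponds to the trivial representation). Let $V_N=(\mathbb C[\mathfrak g]\otimes(\mathbb C^N)^{\otimes n})^{\mathfrak g}$ be the space of $\mathfrak g$-invariant polynomial functions on $\mathfrak g$ with values in $(\mathbb C^N)^{\otimes n}$ ($\mathfrak g$ acting on $\mathfrak g$ by the adjoint representation). For a matrix $B$ let $B_i$ denote $B$ acting on the $i$-th tensor factor, and let $\{b_p\}$ be a basis of $\mathfrak g$ that is orthonormal for the trace form $(A,B)\mapsto \operatorname{tr}(AB)$. **Theorem.** There is an algebra homomorphism $\zeta_N: H_n(N/n)\to\operatorname{End}_{\mathbb C}(V_N)$ such that for $f\in V_N$, $A\in\mathfrak g$, $\sigma\in S_n$ and $1\le i\le n$ $$(\zeta_N(\sigma)f)(A)=\sigma\, (f(A)),\qquad (\zeta_N(\mathrm x_i)f)(A)=A_i f(A),\qquad (\zeta_N(\mathrm y_i)f)(A)=\frac Nn\sum_p (b_p)_i\frac{\partial f}{\partial b_p}(A),$$ where $S_n$ acts on $(\mathbb C^N)^{\otimes n}$ by permuting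 the factors. With this structure, the $H_n(N/n)$-module $V_N$ is irreducible and is isomorphic to $L(\Delta(n,N))$. -/

import Mathlib

open scoped TensorProduct

noncomputable section

namespace KZB

/-! ### The rational Cherednik algebra of type `A` -/

/-- Generators of the rational Cherednik algebra: `x i`, `y i` and the group elements `s σ`. -/
inductive CherednikGen (n : ℕ) : Type
  | x (i : Fin n) : CherednikGen n
  | y (i : Fin n) : CherednikGen n
  | s (σ : Equiv.Perm (Fin n)) : CherednikGen n

namespace CherednikGen

/-- `x i` in the free algebra. -/
abbrev fx {n : ℕ} (i : Fin n) : FreeAlgebra ℂ (CherednikGen n) := FreeAlgebra.ι ℂ (x i)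

/-- `y i` in the free algebra. -/
abbrev fy {n : ℕ} (i : Fin n) : FreeAlgebra ℂ (CherednikGen n) := FreeAlgebra.ι ℂ (y i)

/-- `s σ` in the free algebra. -/
abbrev fs {n : ℕ} (σ : Equiv.Perm (Fin n)) : FreeAlgebra ℂ (CherednikGen n) :=
  FreeAlgebra.ι ℂ (s σ)

end CherednikGen

open CherednikGen in
/-- Defining relations: those of the smash product of `ℂ[S_n]` with the free algebra on the
`x i`, `y i`, and those of the rational Cherednik algebra. -/
inductive CherednikRel (n : ℕ) (k : ℂ) :
    FreeAlgebra ℂ (CherednikGen n) → FreeAlgebra ℂ (CherednikGen n) → Prop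
  | s_one : CherednikRel n k (fs 1) 1
  | s_mul (σ τ : Equiv.Perm (Fin n)) : CherednikRel n k (fs (σ * τ)) (fs σ * fs τ)
  | s_x (σ : Equiv.Perm (Fin n)) (i : Fin n) : CherednikRel n k (fs σ * fx i) (fx (σ i) * fs σ)
  | s_y (σ : Equiv.Perm (Fin n)) (i : Fin n) : CherednikRel n k (fs σ * fy i) (fy (σ i) * fs σ)
  | sum_x : CherednikRel n k (∑ i, fx i) 0
  | sum_y : CherednikRel n k (∑ i, fy i) 0
  | x_comm (i j : Fin n) : CherednikRel n k (fx i * fx j) (fx j * fx i)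
  | y_comm (i j : Fin n) : CherednikRel n k (fy i * fy j) (fy j * fy i)
  | x_y (i j : Fin n) (hij : i ≠ j) :
      CherednikRel n k (fx i * fy j - fy j * fx i)
        (algebraMap ℂ _ (1 / (n : ℂ)) - k • fs (Equiv.swap i j))

/-- The rational Cherednik algebra `H_n(k)` of type `A_{n-1}`. -/
def Cherednik (n : ℕ) (k : ℂ) : Type := RingQuot (CherednikRel n k)

namespace Cherednik

variable {n : ℕ} {k : ℂ}

instance : Semiring (Cherednik n k) := inferInstanceAs (Semiring (RingQuot (CherednikRel n k)))

instance : Algebra ℂ (Cherednik n k) :=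
  inferInstanceAs (Algebra ℂ (RingQuot (CherednikRel n k)))

instance : Ring (Cherednik n k) := Algebra.semiringToRing ℂ

/-- The quotient map from the free algebra onto `H_n(k)`. -/
def mk : FreeAlgebra ℂ (CherednikGen n) →ₐ[ℂ] Cherednik n k :=
  RingQuot.mkAlgHom ℂ (CherednikRel n k)

/-- The generator `x i` of `H_n(k)`. -/
def x (i : Fin n) : Cherednik n k := mk (CherednikGen.fx i)

/-- The generator `y i` of `H_n(k)`. -/
def y (i : Fin n) : Cherednik n k := mk (CherednikGen.fy i)

/-- The permutation `σ` as an element of `H_n(k)`. -/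
def s (σ : Equiv.Perm (Fin n)) : Cherednik n k := mk (CherednikGen.fs σ)

end Cherednik

/-! ### Lowest weight modules -/

section LowestWeight

variable {n : ℕ} (k : ℂ) {W : Type} [AddCommGroup W] [Module ℂ W]
  (π : Representation ℂ (Equiv.Perm (Fin n)) W)

/-- The `H_n(k)`-submodule of `H_n(k) ⊗ W` that defines the standard module. -/
def standardRel : Submodule (Cherednik n k) (Cherednik n k ⊗[ℂ] W) :=
  Submodule.span (Cherednik n k)
    ({z | ∃ h σ w, z = (h * Cherednik.s σ) ⊗ₜ[ℂ] w - h ⊗ₜ[ℂ] π σ w} ∪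
      {z | ∃ h i w, z = (h * Cherednik.y i) ⊗ₜ[ℂ] w})

/-- The standard (Verma) module with lowest weight `π`: the `H_n(k)`-module induced from `π`,
on which all `y i` are made to act by zero. -/
abbrev StandardModule : Type := (Cherednik n k ⊗[ℂ] W) ⧸ standardRel k π

/-- The sum of all proper submodules of the standard module. For irreducible `π` this is
the largest proper submodule. -/
def standardRadical : Submodule (Cherednik n k) (StandardModule k π) :=
  sSup {P | P ≠ ⊤}

/-- The irreducible lowest weight module `L(π)` of `H_n(k)`: the irreducible quotient of
the standard module. -/
abbrev LowestWeightModule : Type := StandardModule k π ⧸ standardRadical k π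

end LowestWeight

/-! ### The rectangular representation of the symmetric group -/

section Rectangular

variable (n N : ℕ)

/-- The row of `i` in the `N × (n / N)` rectangular tableau filled row by row. -/
def rectRow (i : Fin n) : ℕ := i.val / (n / N)

/-- The column of `i` in the `N × (n / N)` rectangular tableau filled row by row. -/
def rectCol (i : Fin n) : ℕ := i.val % (n / N)

open Classical in
/-- The Young symmetrizer of the rectangular tableau: the row symmetrizer times the
column antisymmetrizer. -/
def rectSymmetrizer : MonoidAlgebra ℂ (Equiv.Perm (Fin n)) :=
  (∑ σ : Equiv.Perm (Fin n) with ∀ i, rectRow n N (σ i) = rectRow n N i,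
      MonoidAlgebra.single σ (1 : ℂ)) *
    (∑ σ : Equiv.Perm (Fin n) with ∀ i, rectCol n N (σ i) = rectCol n N i,
      MonoidAlgebra.single σ (((Equiv.Perm.sign σ : ℤˣ) : ℤ) : ℂ))

/-- The irreducible representation of `S_n` attached to the partition `(n/N, …, n/N)`
(`N` parts): the left ideal of `ℂ[S_n]` generated by the Young symmetrizer. -/
abbrev RectModule : Type :=
  Submodule.span (MonoidAlgebra ℂ (Equiv.Perm (Fin n))) {rectSymmetrizer n N}

/-- `Δ(n,N)`: the action of `S_n` on `RectModule n N` by left multiplication. -/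
def rectRep : Representation ℂ (Equiv.Perm (Fin n)) (RectModule n N) :=
  Representation.ofModule' (RectModule n N)

end Rectangular

/-! ### The representation `V_N` -/

section Invariants

/-- The derivation of a symmetric algebra with prescribed values on the generators. -/
def symDerivation {M : Type} [AddCommGroup M] [Module ℂ M]
    (d : M →ₗ[ℂ] SymmetricAlgebra ℂ M) :
    Derivation ℂ (SymmetricAlgebra ℂ M) (SymmetricAlgebra ℂ M) :=
  let F : SymmetricAlgebra ℂ M →ₐ[ℂ] DualNumber (SymmetricAlgebra ℂ M) :=
    SymmetricAlgebra.lift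
      (((TrivSqZeroExt.inlAlgHom ℂ (SymmetricAlgebra ℂ M)
          (SymmetricAlgebra ℂ M)).toLinearMap ∘ₗ SymmetricAlgebra.ι ℂ M) +
        (TrivSqZeroExt.inrHom (SymmetricAlgebra ℂ M)
          (SymmetricAlgebra ℂ M)).restrictScalars ℂ ∘ₗ d)
  have hF : ∀ a, (F a).fst = a := fun a => by
    have : (TrivSqZeroExt.fstHom ℂ (SymmetricAlgebra ℂ M) (SymmetricAlgebra ℂ M)).comp F
        = AlgHom.id ℂ _ := by
      apply SymmetricAlgebra.algHom_ext
      ext m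
      simp [F]
    exact congrArg (fun G => G a) this
  Derivation.mk' ((TrivSqZeroExt.sndHom (SymmetricAlgebra ℂ M)
      (SymmetricAlgebra ℂ M)).restrictScalars ℂ ∘ₗ F.toLinearMap) fun a b => by
    simp [hF, mul_comm]

theorem symDerivation_ι {M : Type} [AddCommGroup M] [Module ℂ M]
    (d : M →ₗ[ℂ] SymmetricAlgebra ℂ M) (m : M) :
    symDerivation d (SymmetricAlgebra.ι ℂ M m) = d m := by
  simp [symDerivation]

attribute [local instance 100] LieRing.ofAssociativeRing

/-- The Lie algebra `𝔰𝔩_N(ℂ)`. -/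
abbrev sl (N : ℕ) : LieSubalgebra ℂ (Matrix (Fin N) (Fin N) ℂ) :=
  LieAlgebra.SpecialLinear.sl (Fin N) ℂ

open scoped ComplexOrder in
/-- Bases of `𝔰𝔩_N(ℂ)` orthonormal for the trace form exist. -/
theorem exists_orthonormal_basis_sl (N : ℕ) :
    ∃ b : Module.Basis (Fin (Module.finrank ℂ (sl N))) ℂ (sl N), ∀ p q,
      Matrix.trace ((b p : Matrix (Fin N) (Fin N) ℂ) * (b q : Matrix (Fin N) (Fin N) ℂ))
        = if p = q then 1 else 0 := by
  classical
  let B : LinearMap.BilinForm ℂ (sl N) := LinearMap.mk₂ ℂ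
    (fun X Y => Matrix.trace ((X : Matrix (Fin N) (Fin N) ℂ) * (Y : Matrix (Fin N) (Fin N) ℂ)))
    (by intros; simp [add_mul]) (by intros; simp)
    (by intros; simp [mul_add]) (by intros; simp)
  have hB : ∀ X Y, B X Y =
      Matrix.trace ((X : Matrix (Fin N) (Fin N) ℂ) * (Y : Matrix (Fin N) (Fin N) ℂ)) :=
    fun _ _ => rfl
  have hs : LinearMap.IsSymm B := ⟨fun X Y => by
    exact Matrix.trace_mul_comm (X : Matrix (Fin N) (Fin N) ℂ) (Y : Matrix (Fin N) (Fin N) ℂ)⟩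
  obtain ⟨v, hv⟩ := LinearMap.BilinForm.exists_orthogonal_basis (B := B) hs
  have hsep : B.SeparatingLeft := fun X hX => by
    have hmem : (X : Matrix (Fin N) (Fin N) ℂ).conjTranspose ∈ sl N := by
      have h : Matrix.trace (X : Matrix (Fin N) (Fin N) ℂ) = 0 := X.2
      change Matrix.trace (X : Matrix (Fin N) (Fin N) ℂ).conjTranspose = 0
      rw [Matrix.trace_conjTranspose, h, star_zero]
    have h := hX ⟨_, hmem⟩
    rw [hB] at h
    exact Subtype.ext (Matrix.trace_mul_conjTranspose_self_eq_zero_iff.mp h)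
  have hne := fun i => hv.not_isOrtho_basis_self_of_separatingLeft hsep i
  choose c hc using fun i => IsAlgClosed.exists_pow_nat_eq (B (v i) (v i)) (n := 2) two_pos
  have hc0 : ∀ i, c i ≠ 0 := fun i h => hne i (by rw [← hc i, h]; simp)
  refine ⟨v.isUnitSMul (w := fun i => (c i)⁻¹) (fun i => (inv_ne_zero (hc0 i)).isUnit), ?_⟩
  intro p q
  rw [← hB]
  simp only [Module.Basis.isUnitSMul_apply, map_smul, LinearMap.smul_apply, smul_eq_mul]
  split_ifs with h
  · subst h
    rw [← hc p]
    field_simp [hc0 p]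
  · have : B (v p) (v q) = 0 := hv h
    simp [this]

/-- The algebra `ℂ[𝔰𝔩_N]` of polynomial functions on `𝔰𝔩_N`, as the symmetric algebra of the
dual space. -/
abbrev PolyFun (N : ℕ) : Type := SymmetricAlgebra ℂ (Module.Dual ℂ (sl N))

/-- The value of a polynomial function at a point of `𝔰𝔩_N`. -/
def polyEval {N : ℕ} (A : sl N) : PolyFun N →ₐ[ℂ] ℂ :=
  SymmetricAlgebra.lift (Module.Dual.eval ℂ (sl N) A)

/-- The directional derivative `∂/∂B`; it sends a linear function `φ` to the constant `φ B`. -/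
def dirDeriv {N : ℕ} (B : sl N) : Derivation ℂ (PolyFun N) (PolyFun N) :=
  symDerivation (Algebra.linearMap ℂ (PolyFun N) ∘ₗ Module.Dual.eval ℂ (sl N) B)

/-- The action of `ξ ∈ 𝔰𝔩_N` on polynomial functions induced by the adjoint action: the
derivation that sends a linear function `φ` to `A ↦ - φ ⁅ξ, A⁆`. -/
def adAction {N : ℕ} (ξ : sl N) : Derivation ℂ (PolyFun N) (PolyFun N) :=
  symDerivation (-(SymmetricAlgebra.ι ℂ (Module.Dual ℂ (sl N)) ∘ₗ
    Module.Dual.transpose (LieAlgebra.ad ℂ (sl N) ξ)))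

/-- `(ℂ^N)^{⊗ n}`. -/
abbrev TensorPow (n N : ℕ) : Type := ⨂[ℂ] _ : Fin n, (Fin N → ℂ)

/-- The matrix `A` acting on the `i`-th tensor factor. -/
def atFactor {n N : ℕ} (i : Fin n) (A : Matrix (Fin N) (Fin N) ℂ) :
    Module.End ℂ (TensorPow n N) :=
  PiTensorProduct.map (Function.update (fun _ => LinearMap.id) i (Matrix.toLin' A))

/-- The permutation action on `(ℂ^N)^{⊗ n}`: `σ` moves the factor in position `i` to
position `σ i`. -/
def permFactors {n N : ℕ} (σ : Equiv.Perm (Fin n)) : Module.End ℂ (TensorPow n N) :=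
  (PiTensorProduct.reindex ℂ (fun _ : Fin n => (Fin N → ℂ)) σ).toLinearMap

/-- `ℂ[𝔰𝔩_N] ⊗ (ℂ^N)^{⊗ n}`: polynomial functions on `𝔰𝔩_N` with values in `(ℂ^N)^{⊗ n}`. -/
abbrev TensorFun (n N : ℕ) : Type := PolyFun N ⊗[ℂ] TensorPow n N

/-- The value `f(A)` of a tensor-valued polynomial function. -/
def evalAt {n N : ℕ} (A : sl N) : TensorFun n N →ₗ[ℂ] TensorPow n N :=
  (TensorProduct.lid ℂ (TensorPow n N)).toLinearMap ∘ₗ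
    LinearMap.rTensor (TensorPow n N) (polyEval A).toLinearMap

/-- The directional derivative `∂f/∂B` of a tensor-valued polynomial function. -/
def tensorDeriv {n N : ℕ} (B : sl N) : Module.End ℂ (TensorFun n N) :=
  LinearMap.rTensor (TensorPow n N) (dirDeriv B : PolyFun N →ₗ[ℂ] PolyFun N)

/-- The action of `ξ ∈ 𝔰𝔩_N` on `ℂ[𝔰𝔩_N] ⊗ (ℂ^N)^{⊗ n}`. -/
def slAction {n N : ℕ} (ξ : sl N) : Module.End ℂ (TensorFun n N) :=
  LinearMap.rTensor (TensorPow n N) (adAction ξ : PolyFun N →ₗ[ℂ] PolyFun N) +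
    LinearMap.lTensor (PolyFun N) (∑ i : Fin n, atFactor i (ξ : Matrix (Fin N) (Fin N) ℂ))

/-- `V_N = (ℂ[𝔰𝔩_N] ⊗ (ℂ^N)^{⊗ n})^{𝔰𝔩_N}`. -/
def invariants (n N : ℕ) : Submodule ℂ (TensorFun n N) :=
  ⨅ ξ : sl N, LinearMap.ker (slAction ξ)

end Invariants

end KZB

end

noncomputable section

namespace KZB

/-! In a basis orthonormal for the trace form, x_i = ∑ X_p (b_p)_i and y_i = (N/n) ∑ D_p (b_p)_i,
with X_p the coordinates and D_p the partial derivatives. The commutator [x_i, y_j] has the required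
form because the Casimir tensor ∑ b_p ⊗ b_p acts on two distinct factors as s_ij - 1/N. Only ∑ x_i =
∑ y_i = 0 needs invariance: on invariants, 𝔰𝔩_N acting on the tensors is minus its adjoint action on
functions.

The heart is `WeylSystem.IsInvariant.sum_x_y_smul`: on invariants, ∑ x_i y_i = E + (N/2n) C, with E
the Euler operator and C the Casimir operator of the tensor factor. It rests on
`TraceOrthonormal.weyl_identity`, a noncommutative form of tr((AD + DA)[A, D]) = 0. Since C is
positive semidefinite (`wordForm_casimirOp_nonneg`), ∑ x_i y_i is invertible in every degree d > 0.
So no nonzero vector of positive degree is killed by all y_i, and each f of positive degree is ∑ x_i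
(y_i g) for some g. As E differs from the grading element `eu` by a scalar, submodules are graded. A
nonzero submodule thus meets degree zero, which generates V_N, and irreducibility reduces to that of
the degree-zero part, the invariant tensors, over S_n.

Let m = n/N. An invariant tensor u satisfies ∑_{i ≠ j} s_ij u = (m - N) u for every j. This lets an
antisymmetrizer grow to some N positions without killing u. Antisymmetrizers over more than N
positions vanish on tensors over ℂ^N, so the remaining positions satisfy the same condition with m -
1. By induction every nonzero stable subspace contains a nonzero vector antisymmetric along m
disjoint columns; up to permutation and scalar that is `colVector`, a product of determinants.
Maschke's theorem then gives irreducibility (`eq_tensorInv_of_ne_bot`). Applying the left ideal of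
the Young symmetrizer to the tensor of the row word identifies it with the invariant tensors;
injectivity comes from positivity of the standard Hermitian form on the group algebra.

Finally, the standard module maps onto V_N. It is graded by `eu` too, so a proper submodule outside
the kernel would map onto V_N and, by comparing degree-zero components, contain every lowest weight
vector. The kernel is therefore the largest proper submodule. -/

/-- Square matrices of size `N`. -/
abbrev Mat (N : ℕ) : Type := Matrix (Fin N) (Fin N) ℂ

/-! ### Operators on tensor powers -/

section TensorPower

variable {n N : ℕ}

/-- The basis of `(ℂ^N)^{⊗ n}` indexed by words in the alphabet `Fin N`. -/
def wordBasis (n N : ℕ) : Module.Basis (Fin n → Fin N) ℂ (TensorPow n N) :=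
  Basis.piTensorProduct (fun _ => Pi.basisFun ℂ (Fin N))

theorem wordBasis_apply (w : Fin n → Fin N) :
    wordBasis n N w = PiTensorProduct.tprod ℂ (fun i => (Pi.single (w i) 1 : Fin N → ℂ)) := by
  simp [wordBasis, Basis.piTensorProduct_apply]

theorem wordBasis_repr_tprod (v : Fin n → Fin N → ℂ) (w : Fin n → Fin N) :
    (wordBasis n N).repr (PiTensorProduct.tprod ℂ v) w = ∏ i, v i (w i) := by
  simp [wordBasis, Basis.piTensorProduct_repr_tprod_apply]

theorem atFactor_tprod (i : Fin n) (M : Mat N) (v : Fin n → Fin N → ℂ) :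
    atFactor i M (PiTensorProduct.tprod ℂ v) =
      PiTensorProduct.tprod ℂ (Function.update v i (M.mulVec (v i))) := by
  rw [atFactor, PiTensorProduct.map_tprod]
  congr 1
  ext j : 1
  by_cases h : j = i
  · subst h; simp
  · simp [h]

theorem permFactors_tprod (σ : Equiv.Perm (Fin n)) (v : Fin n → Fin N → ℂ) :
    permFactors σ (PiTensorProduct.tprod ℂ v) = PiTensorProduct.tprod ℂ (fun i => v (σ⁻¹ i)) := by
  exact PiTensorProduct.reindex_tprod σ v

theorem permFactors_wordBasis (σ : Equiv.Perm (Fin n)) (w : Fin n → Fin N) :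
    permFactors σ (wordBasis n N w) = wordBasis n N (fun i => w (σ⁻¹ i)) := by
  simp only [wordBasis_apply, permFactors_tprod]

theorem tensorPow_hom_ext {V : Type*} [AddCommMonoid V] [Module ℂ V]
    {f g : TensorPow n N →ₗ[ℂ] V}
    (h : ∀ v : Fin n → Fin N → ℂ, f (PiTensorProduct.tprod ℂ v) = g (PiTensorProduct.tprod ℂ v)) :
    f = g :=
  PiTensorProduct.ext (MultilinearMap.ext h)

theorem permFactors_one : permFactors (n := n) (N := N) 1 = 1 :=
  tensorPow_hom_ext fun v => by simp [permFactors_tprod]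

theorem permFactors_mul (σ τ : Equiv.Perm (Fin n)) :
    permFactors (N := N) (σ * τ) = permFactors σ * permFactors τ :=
  tensorPow_hom_ext fun v => by simp [permFactors_tprod]

/-- The permutation action as a representation. -/
def permRep (n N : ℕ) : Representation ℂ (Equiv.Perm (Fin n)) (TensorPow n N) where
  toFun := permFactors
  map_one' := permFactors_one
  map_mul' := permFactors_mul

@[simp]
theorem permRep_apply (σ : Equiv.Perm (Fin n)) : permRep n N σ = permFactors σ := rfl

/-- `atFactor i` as an algebra homomorphism. -/
def atFactorHom (n N : ℕ) (i : Fin n) :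
    Mat N →ₐ[ℂ] Module.End ℂ (TensorPow n N) :=
  AlgHom.ofLinearMap
    { toFun := atFactor i
      map_add' := fun A B => by
        simp only [atFactor, map_add, PiTensorProduct.map_update_add]
      map_smul' := fun c A => by
        simp only [atFactor, map_smul, PiTensorProduct.map_update_smul, RingHom.id_apply] }
    (tensorPow_hom_ext fun v => by
      change atFactor i 1 _ = _
      simp [atFactor_tprod])
    (fun A B => tensorPow_hom_ext fun v => by
      change atFactor i (A * B) (PiTensorProduct.tprod ℂ v) =
        atFactor i A (atFactor i B (PiTensorProduct.tprod ℂ v))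
      simp [atFactor_tprod])

@[simp]
theorem atFactorHom_apply (i : Fin n) (M : Mat N) :
    atFactorHom n N i M = atFactor i M := rfl

theorem atFactor_mul (i : Fin n) (A B : Mat N) :
    atFactor i (A * B) = atFactor i A * atFactor i B := map_mul (atFactorHom n N i) A B

theorem atFactor_commute {i j : Fin n} (hij : i ≠ j) (A B : Mat N) :
    atFactor i A * atFactor j B = atFactor j B * atFactor i A :=
  tensorPow_hom_ext fun v => by
    simp [atFactor_tprod, hij, hij.symm, Function.update_comm hij]

theorem permFactors_mul_atFactor (σ : Equiv.Perm (Fin n)) (i : Fin n)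
    (A : Mat N) :
    permFactors σ * atFactor i A = atFactor (σ i) A * permFactors σ :=
  tensorPow_hom_ext fun v => by
    simp only [Module.End.mul_apply, atFactor_tprod, permFactors_tprod]
    congr 1
    ext j : 1
    by_cases h : j = σ i
    · subst h; simp
    · rw [Function.update_of_ne h, Function.update_of_ne]
      rintro rfl
      simp at h

/-- The units E_ac in slot i and E_ca in slot j produce (v_i)_c e_a and (v_j)_a e_c. By
multilinearity the two scalars may change places, and the sums over a and c then rebuild v_j in slot
i and v_i in slot j. -/
theorem sum_atFactor_single_mul {i j : Fin n} (hij : i ≠ j) :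
    ∑ a : Fin N, ∑ c : Fin N, atFactor i (Matrix.single a c (1 : ℂ)) *
      atFactor j (Matrix.single c a (1 : ℂ)) = permFactors (Equiv.swap i j) :=
  tensorPow_hom_ext fun v => by
    have key : ∀ a c : Fin N, (atFactor i (Matrix.single a c (1 : ℂ)) *
        atFactor j (Matrix.single c a (1 : ℂ))) (PiTensorProduct.tprod ℂ v) =
        PiTensorProduct.tprod ℂ (Function.update
          (Function.update v j (v i c • (Pi.single c 1 : Fin N → ℂ))) i
          (v j a • (Pi.single a 1 : Fin N → ℂ))) := by
      intro a c
      have h1 : ∀ (a c : Fin N) (u : Fin N → ℂ),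
          (Matrix.single a c (1 : ℂ)).mulVec u = u c • (Pi.single a 1 : Fin N → ℂ) := by
        intro a c u
        ext d
        simp [Matrix.mulVec, dotProduct, Matrix.single_apply, Pi.single_apply, ite_and, eq_comm]
      have h3 : ∀ (x y : ℂ) (u w : Fin N → ℂ), PiTensorProduct.tprod ℂ
          (Function.update (Function.update v j (x • u)) i (y • w)) = (y * x) •
          PiTensorProduct.tprod ℂ (Function.update (Function.update v j u) i w) := by
        intro x y u w
        rw [MultilinearMap.map_update_smul, Function.update_comm hij.symm,
          MultilinearMap.map_update_smul, smul_smul, Function.update_comm hij]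
      rw [Module.End.mul_apply, atFactor_tprod, atFactor_tprod, h1, h1,
        Function.update_of_ne hij, h3, h3, mul_comm]
    have h2 : ∀ u : Fin N → ℂ, ∑ a, u a • (Pi.single a 1 : Fin N → ℂ) = u := by
      intro u
      ext d
      simp [Finset.sum_apply, Pi.single_apply]
    simp only [LinearMap.sum_apply, key]
    rw [Finset.sum_comm]
    simp only [← MultilinearMap.map_update_sum, h2]
    simp only [Function.update_comm hij.symm]
    rw [← MultilinearMap.map_update_sum, h2, permFactors_tprod]
    congr 1
    ext l : 1
    rw [Equiv.swap_inv]
    by_cases h : l = j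
    · subst h; simp
    · by_cases h' : l = i
      · subst h'; simp [hij]
      · simp [h, h', Equiv.swap_apply_of_ne_of_ne]

/-- The matrix `A` acting diagonally: `∑ i, A_i`. -/
def diagAction (n N : ℕ) : Mat N →ₗ[ℂ] Module.End ℂ (TensorPow n N) :=
  ∑ i, (atFactorHom n N i).toLinearMap

theorem diagAction_apply (A : Mat N) :
    diagAction n N A = ∑ i, atFactor i A := by
  simp [diagAction, LinearMap.sum_apply]

theorem diagAction_one : diagAction n N 1 = (n : ℂ) • 1 := by
  have : ∀ i : Fin n, atFactor i (1 : Mat N) = 1 :=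
    fun i => map_one (atFactorHom n N i)
  simp only [diagAction_apply, this]
  simp [Algebra.smul_def]

theorem permFactors_mul_diagAction (σ : Equiv.Perm (Fin n)) (A : Mat N) :
    permFactors σ * diagAction n N A = diagAction n N A * permFactors σ := by
  rw [diagAction_apply, Finset.mul_sum, Finset.sum_mul,
    ← Equiv.sum_comp σ (fun i => atFactor i A * permFactors σ)]
  exact Finset.sum_congr rfl fun i _ => permFactors_mul_atFactor σ i A

theorem permFactors_commute_diagAction_apply (σ : Equiv.Perm (Fin n))
    (A : Mat N) (u : TensorPow n N) :
    diagAction n N A (permFactors σ u) = permFactors σ (diagAction n N A u) :=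
  (LinearMap.congr_fun (permFactors_mul_diagAction σ A) u).symm

end TensorPower

/-! ### Orthonormal bases of `𝔰𝔩_N` -/

section Orthonormal

attribute [local instance 100] LieRing.ofAssociativeRing

variable {N : ℕ} {ι : Type*} [Fintype ι] [DecidableEq ι] {b : Module.Basis ι ℂ (sl N)}

/-- The basis `b` is orthonormal for the trace form. -/
def TraceOrthonormal (b : Module.Basis ι ℂ (sl N)) : Prop :=
  ∀ p q, Matrix.trace ((b p : Mat N) * (b q : Mat N))
    = if p = q then 1 else 0

theorem sl_trace_eq_zero (A : sl N) : Matrix.trace (A : Mat N) = 0 := A.2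

theorem sl_coe_sum {κ : Type*} (s : Finset κ) (f : κ → sl N) :
    ((∑ p ∈ s, f p : sl N) : Mat N) = ∑ p ∈ s, (f p : Mat N) :=
  map_sum (sl N).toSubmodule.subtype f s

theorem TraceOrthonormal.repr_apply (hb : TraceOrthonormal b) (A : sl N) (p : ι) :
    b.repr A p = Matrix.trace ((b p : Mat N) * (A : Mat N)) := by
  conv_rhs => rw [← b.sum_repr A]
  rw [sl_coe_sum]
  simp [Finset.mul_sum, Matrix.trace_sum, hb p]

theorem TraceOrthonormal.sum_smul (hb : TraceOrthonormal b) (A : sl N) :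
    ∑ p, Matrix.trace ((b p : Mat N) * (A : Mat N)) • (b p : Mat N)
      = A := by
  simp only [← hb.repr_apply]
  conv_rhs => rw [← b.sum_repr A, sl_coe_sum]
  simp

theorem exists_sl_add_smul_one (M : Mat N) :
    ∃ A : sl N, M = A + (Matrix.trace M / N) • (1 : Mat N) := by
  rcases Nat.eq_zero_or_pos N with rfl | hN
  · exact ⟨0, Subsingleton.elim _ _⟩
  · refine ⟨⟨M - (Matrix.trace M / N) • 1, ?_⟩, by simp⟩
    have : (N : ℂ) ≠ 0 := by exact_mod_cast hN.ne'
    change Matrix.trace (M - (Matrix.trace M / N) • 1) = 0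
    simp [Matrix.trace_sub, Matrix.trace_smul, this]

/-- The b_p are traceless, so the left side sees only the traceless part of M. -/
theorem TraceOrthonormal.sum_trace_smul (hb : TraceOrthonormal b)
    (M : Mat N) :
    ∑ p, Matrix.trace ((b p : Mat N) * M) • (b p : Mat N)
      = M - (Matrix.trace M / N) • 1 := by
  obtain ⟨A, hA⟩ := exists_sl_add_smul_one M
  rw [sub_eq_of_eq_add hA, ← hb.sum_smul A]
  refine Finset.sum_congr rfl fun p _ => ?_
  rw [hA]
  simp [mul_add, sl_trace_eq_zero]

/-- The Casimir tensor in terms of matrix units. -/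
theorem TraceOrthonormal.sum_bilin (hb : TraceOrthonormal b) {V : Type*} [AddCommGroup V]
    [Module ℂ V]
    (Φ : Mat N →ₗ[ℂ] Mat N →ₗ[ℂ] V) :
    ∑ p, Φ (b p) (b p) = ∑ a, ∑ c, Φ (Matrix.single a c 1) (Matrix.single c a 1)
      - (1 / (N : ℂ)) • Φ 1 1 := by
  -- Only the first copy of b_p is expanded in matrix units. Its coefficient, the trace of b_p E_ca,
  -- is moved to the second copy, where completeness of the basis applies.
  have h1 : ∀ p, Φ (b p) (b p) = ∑ a, ∑ c, Φ (Matrix.single a c 1)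
      (Matrix.trace ((b p : Mat N) * Matrix.single c a 1) •
        (b p : Mat N)) := by
    intro p
    generalize (b p : Mat N) = B
    have h0 : Φ B B = ∑ a, ∑ c, Φ (Matrix.single a c (B a c)) B := by
      conv_lhs => enter [1]; rw [Matrix.matrix_eq_sum_single B]
      simp only [map_sum, LinearMap.sum_apply]
    rw [h0]
    refine Finset.sum_congr rfl fun a _ => Finset.sum_congr rfl fun c _ => ?_
    have : Matrix.single a c (B a c) = B a c • Matrix.single a c (1 : ℂ) := by simp
    rw [this, map_smul, LinearMap.smul_apply, map_smul]
    congr 1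
    simp [Matrix.trace_mul_single]
  simp only [h1]
  rw [Finset.sum_comm]
  have h2 : ∀ a, ∑ p, ∑ c, Φ (Matrix.single a c 1)
      (Matrix.trace ((b p : Mat N) * Matrix.single c a 1) •
        (b p : Mat N)) = ∑ c, Φ (Matrix.single a c 1) (Matrix.single c a 1)
        - (1 / (N : ℂ)) • Φ (Matrix.single a a 1) 1 := by
    intro a
    rw [Finset.sum_comm]
    simp only [← map_sum, hb.sum_trace_smul, map_sub, Finset.sum_sub_distrib]
    congr 1
    rw [Finset.sum_eq_single a]
    · simp
    · intro c _ hc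
      rw [Matrix.trace_single_eq_of_ne _ _ _ hc]
      simp
    · simp
  simp only [h2, Finset.sum_sub_distrib, ← Finset.smul_sum]
  congr 2
  rw [← LinearMap.sum_apply, ← map_sum, Matrix.sum_single_one]

end Orthonormal

end KZB
end

noncomputable section

namespace KZB

/-! ### Differential operators on `ℂ[𝔰𝔩_N]` -/

section Polynomial

theorem symmetricAlgebra_derivation_ext {M : Type} [AddCommGroup M] [Module ℂ M]
    {D₁ D₂ : Derivation ℂ (SymmetricAlgebra ℂ M) (SymmetricAlgebra ℂ M)}
    (h : ∀ m, D₁ (SymmetricAlgebra.ι ℂ M m) = D₂ (SymmetricAlgebra.ι ℂ M m)) : D₁ = D₂ := by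
  ext a
  induction a using SymmetricAlgebra.induction with
  | algebraMap r => simp
  | ι m => exact h m
  | mul a b ha hb => simp [ha, hb]
  | add a b ha hb => simp [ha, hb]

theorem derivation_sum_apply {A κ : Type*} [CommRing A] [Algebra ℂ A] (s : Finset κ)
    (D : κ → Derivation ℂ A A) (a : A) : (∑ p ∈ s, D p) a = ∑ p ∈ s, D p a := by
  classical
  induction s using Finset.induction with
  | empty => simp
  | insert p s hp ih => simp [Finset.sum_insert hp, ih]

attribute [local instance 100] LieRing.ofAssociativeRing

variable {N : ℕ} {ι : Type*} [Fintype ι] [DecidableEq ι] (b : Module.Basis ι ℂ (sl N))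

theorem dirDeriv_ι (B : sl N) (φ : Module.Dual ℂ (sl N)) :
    dirDeriv B (SymmetricAlgebra.ι ℂ _ φ) = algebraMap ℂ (PolyFun N) (φ B) := by
  simp [dirDeriv, symDerivation_ι]

theorem adAction_ι (ξ : sl N) (φ : Module.Dual ℂ (sl N)) :
    adAction ξ (SymmetricAlgebra.ι ℂ _ φ) =
      -SymmetricAlgebra.ι ℂ _ (φ ∘ₗ LieAlgebra.ad ℂ (sl N) ξ) := by
  rw [adAction, symDerivation_ι]
  rfl

theorem dirDeriv_comm (A B : sl N) (g : PolyFun N) :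
    dirDeriv A (dirDeriv B g) = dirDeriv B (dirDeriv A g) := by
  have h : ⁅dirDeriv A, dirDeriv B⁆ = 0 := symmetricAlgebra_derivation_ext fun φ => by
    simp [Derivation.commutator_apply, dirDeriv_ι]
  have := congrArg (fun D : Derivation ℂ (PolyFun N) (PolyFun N) => D g) h
  simpa [Derivation.commutator_apply, sub_eq_zero] using this

/-- The coordinate function on `𝔰𝔩_N` dual to the basis vector `b p`. -/
def coordFun (p : ι) : PolyFun N := SymmetricAlgebra.ι ℂ _ (b.coord p)

theorem dirDeriv_coordFun (p q : ι) :
    dirDeriv (b p) (coordFun b q) = if p = q then 1 else 0 := by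
  simp [coordFun, dirDeriv_ι, Finsupp.single_apply]

/-- The Euler derivation. -/
def eulerDer (N : ℕ) : Derivation ℂ (PolyFun N) (PolyFun N) :=
  symDerivation (SymmetricAlgebra.ι ℂ _)

theorem eulerDer_ι (φ : Module.Dual ℂ (sl N)) :
    eulerDer N (SymmetricAlgebra.ι ℂ _ φ) = SymmetricAlgebra.ι ℂ _ φ := symDerivation_ι _ _

theorem ι_eq_sum_coordFun (φ : Module.Dual ℂ (sl N)) :
    SymmetricAlgebra.ι ℂ _ φ = ∑ p, φ (b p) • coordFun b p := by
  have : φ = ∑ p, φ (b p) • b.coord p := by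
    refine b.ext fun q => ?_
    simp [LinearMap.sum_apply, Finsupp.single_apply]
  conv_lhs => rw [this]
  simp only [map_sum, map_smul, coordFun]

theorem eulerDer_apply (g : PolyFun N) :
    eulerDer N g = ∑ p, coordFun b p * dirDeriv (b p) g := by
  have h : eulerDer N = ∑ p, coordFun b p • dirDeriv (b p) :=
    symmetricAlgebra_derivation_ext fun φ => by
      rw [eulerDer_ι, ι_eq_sum_coordFun b]
      rw [derivation_sum_apply]
      refine Finset.sum_congr rfl fun p _ => ?_
      rw [← ι_eq_sum_coordFun, Derivation.smul_apply, dirDeriv_ι, smul_eq_mul, mul_comm,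
        Algebra.smul_def]
  rw [h]
  simp [derivation_sum_apply]

variable {b}

theorem sl_bracket_coe (ξ B : sl N) :
    ((⁅ξ, B⁆ : sl N) : Mat N) = (ξ : Mat N) * (B : Mat N) - (B : Mat N) * (ξ : Mat N) := rfl

/-- The number `tr(M[b_r, b_s])`. -/
def brCoeff (b : Module.Basis ι ℂ (sl N)) (M : Mat N) (r s : ι) : ℂ :=
  Matrix.trace (M * ((b r : Mat N) * (b s : Mat N) - (b s : Mat N) * (b r : Mat N)))

theorem brCoeff_swap (M : Mat N) (r s : ι) : brCoeff b M s r = -brCoeff b M r s := by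
  rw [brCoeff, brCoeff, ← Matrix.trace_neg, ← mul_neg, neg_sub]

theorem TraceOrthonormal.repr_bracket (hb : TraceOrthonormal b) (ξ : sl N) (p s : ι) :
    b.repr ⁅ξ, b s⁆ p = brCoeff b ξ s p := by
  rw [hb.repr_apply, sl_bracket_coe, brCoeff, mul_sub, mul_sub, Matrix.trace_sub, Matrix.trace_sub,
    Matrix.trace_mul_comm (b p : Mat N), ← mul_assoc (b p : Mat N),
    Matrix.trace_mul_comm _ (ξ : Mat N), mul_assoc]

theorem TraceOrthonormal.adAction_coordFun (hb : TraceOrthonormal b) (ξ : sl N) (p : ι) :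
    adAction ξ (coordFun b p) = ∑ s, brCoeff b ξ p s • coordFun b s := by
  rw [coordFun, adAction_ι, ι_eq_sum_coordFun b, ← Finset.sum_neg_distrib]
  refine Finset.sum_congr rfl fun s _ => ?_
  rw [← neg_smul, brCoeff_swap, LinearMap.comp_apply, LieAlgebra.ad_apply,
    Module.Basis.coord_apply, hb.repr_bracket]

theorem TraceOrthonormal.adAction_apply (hb : TraceOrthonormal b) (ξ : sl N) (g : PolyFun N) :
    adAction ξ g = ∑ r, ∑ s, brCoeff b ξ r s • (coordFun b s * dirDeriv (b r) g) := by
  have h : adAction ξ = ∑ r, ∑ s, brCoeff b ξ r s • (coordFun b s • dirDeriv (b r)) :=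
    symmetricAlgebra_derivation_ext fun φ => by
      rw [ι_eq_sum_coordFun b φ]
      simp only [map_sum, Derivation.map_smul, hb.adAction_coordFun]
      refine Finset.sum_congr rfl fun p _ => ?_
      congr 1
      simp [derivation_sum_apply, dirDeriv_coordFun]
  rw [h]
  simp [derivation_sum_apply]

end Polynomial

end KZB
end

noncomputable section

namespace KZB

/-! ### Operators on tensor-valued polynomial functions -/

/-! ### The Weyl algebra identity behind the key formula -/

section WeylIdentity

theorem sum_four_swap_first_third {ι V : Type*} [Fintype ι] [AddCommMonoid V]
    (F : ι → ι → ι → ι → V) :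
    ∑ p, ∑ q, ∑ r, ∑ s, F p q r s = ∑ p, ∑ q, ∑ r, ∑ s, F r q p s := by
  rw [Finset.sum_comm]
  conv_rhs => rw [Finset.sum_comm]
  exact Finset.sum_congr rfl fun q _ => Finset.sum_comm

theorem sum_four_swap_second_fourth {ι V : Type*} [Fintype ι] [AddCommMonoid V]
    (F : ι → ι → ι → ι → V) :
    ∑ p, ∑ q, ∑ r, ∑ s, F p q r s = ∑ p, ∑ q, ∑ r, ∑ s, F p s r q := by
  refine Finset.sum_congr rfl fun p _ => ?_
  rw [Finset.sum_comm]
  conv_rhs => rw [Finset.sum_comm]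
  exact Finset.sum_congr rfl fun r _ => Finset.sum_comm

variable {N : ℕ} {ι : Type*} [Fintype ι] [DecidableEq ι] {b : Module.Basis ι ℂ (sl N)}

theorem TraceOrthonormal.sum_mul_self (hb : TraceOrthonormal b) :
    ∑ p, (b p : Mat N) * (b p : Mat N) = ((N : ℂ) - 1 / N) • (1 : Mat N) := by
  have h := hb.sum_bilin (LinearMap.mul ℂ (Mat N))
  simp only [LinearMap.mul_apply', Matrix.single_mul_single_same, mul_one, Finset.sum_const,
    ← Finset.smul_sum, Matrix.sum_single_one] at h
  rw [h, sub_smul]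
  simp [← Nat.cast_smul_eq_nsmul ℂ]

/-- By cyclicity each summand is tr(b_p² [B, C]), and ∑ b_p² is a scalar. This disposes of the lower
order terms in `weyl_identity`. -/
theorem TraceOrthonormal.sum_trace_anticomm_comm (hb : TraceOrthonormal b) (B C : Mat N) :
    ∑ p, Matrix.trace (((b p : Mat N) * B + B * (b p : Mat N)) *
      (C * (b p : Mat N) - (b p : Mat N) * C)) = 0 := by
  have h : ∀ P : Mat N, Matrix.trace ((P * B + B * P) * (C * P - P * C)) =
      Matrix.trace (P * P * (B * C)) - Matrix.trace (P * P * (C * B)) := by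
    intro P
    have h1 : Matrix.trace (P * B * (C * P)) = Matrix.trace (P * P * (B * C)) := by
      rw [← mul_assoc, Matrix.trace_mul_comm]; simp only [mul_assoc]
    have h2 : Matrix.trace (B * P * (C * P)) = Matrix.trace (P * B * (P * C)) := by
      rw [← mul_assoc, Matrix.trace_mul_comm]; simp only [mul_assoc]
    have h3 : Matrix.trace (B * P * (P * C)) = Matrix.trace (P * P * (C * B)) := by
      rw [mul_assoc B, Matrix.trace_mul_comm]; simp only [mul_assoc]
    rw [add_mul, mul_sub, mul_sub]
    simp only [Matrix.trace_add, Matrix.trace_sub]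
    rw [h1, h2, h3]
    ring
  simp only [h, Finset.sum_sub_distrib, ← Matrix.trace_sum, ← Finset.sum_mul, hb.sum_mul_self]
  simp [Matrix.trace_mul_comm B C]

/-- Polarization, in the pairs (P, S) and (Q, T), of tr((PQ + QP)(PQ - QP)) = 0, which is cyclicity
of the trace. -/
theorem trace_anticomm_mul_comm_symmetrized (P Q S T : Mat N) :
    Matrix.trace ((P * Q + Q * P) * (S * T - T * S)) +
    Matrix.trace ((S * Q + Q * S) * (P * T - T * P)) +
    (Matrix.trace ((P * T + T * P) * (S * Q - Q * S)) +
    Matrix.trace ((S * T + T * S) * (P * Q - Q * P))) = 0 := by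
  have hK : ∀ P Q S T : Mat N, Matrix.trace ((P * Q + Q * P) * (S * T - T * S)) =
      Matrix.trace (P * Q * S * T) - Matrix.trace (P * Q * T * S) +
      (Matrix.trace (Q * P * S * T) - Matrix.trace (Q * P * T * S)) := by
    intro P Q S T
    simp only [add_mul, mul_sub, Matrix.trace_add, Matrix.trace_sub, mul_assoc]
    ring
  have rot : ∀ P Q S T : Mat N,
      Matrix.trace (P * Q * S * T) = Matrix.trace (Q * S * T * P) := by
    intro P Q S T
    rw [mul_assoc, mul_assoc, Matrix.trace_mul_comm, ← mul_assoc]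
  -- Every word is rotated until it begins with P; the sixteen terms then cancel in pairs.
  rw [hK, hK, hK, hK, rot Q P S T, rot Q P T S, rot S Q P T, rot Q P T S, rot S Q T P,
    rot Q T P S, rot T P S Q, rot Q S P T, rot S P T Q, rot Q S T P, rot S T P Q, rot T P Q S,
    rot S T Q P, rot T Q P S, rot Q P S T, rot T S P Q, rot S P Q T, rot T S Q P, rot S Q P T,
    rot Q P T S]
  ring

/-- The symmetries p ↔ r and q ↔ s of Z let the coefficient be replaced by its average over four
index exchanges, and that average is zero. -/
theorem sum_trace_anticomm_mul_comm_smul {V : Type*} [AddCommGroup V] [Module ℂ V]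
    (B : ι → Mat N) (Z : ι → ι → ι → ι → V) (h₁ : ∀ p q r s, Z r q p s = Z p q r s)
    (h₂ : ∀ p q r s, Z p s r q = Z p q r s) :
    ∑ p, ∑ q, ∑ r, ∑ s, Matrix.trace ((B p * B q + B q * B p) * (B r * B s - B s * B r)) •
      Z p q r s = 0 := by
  set K : ι → ι → ι → ι → ℂ := fun p q r s =>
    Matrix.trace ((B p * B q + B q * B p) * (B r * B s - B s * B r)) with hK
  change ∑ p, ∑ q, ∑ r, ∑ s, K p q r s • Z p q r s = 0
  have e₁ : ∑ p, ∑ q, ∑ r, ∑ s, K p q r s • Z p q r s =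
      ∑ p, ∑ q, ∑ r, ∑ s, K r q p s • Z p q r s := by
    rw [sum_four_swap_first_third]
    simp only [h₁]
  have e₂ : ∑ p, ∑ q, ∑ r, ∑ s, K p q r s • Z p q r s =
      ∑ p, ∑ q, ∑ r, ∑ s, K p s r q • Z p q r s := by
    rw [sum_four_swap_second_fourth]
    simp only [h₂]
  have e₃ : ∑ p, ∑ q, ∑ r, ∑ s, K p q r s • Z p q r s =
      ∑ p, ∑ q, ∑ r, ∑ s, K r s p q • Z p q r s := by
    rw [e₂, sum_four_swap_first_third]
    simp only [h₁]
  have hsum : ∑ p, ∑ q, ∑ r, ∑ s, (K p q r s + K r q p s + (K p s r q + K r s p q)) •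
      Z p q r s = 0 := by
    simp only [hK, trace_anticomm_mul_comm_symmetrized, zero_smul, Finset.sum_const_zero]
  simp only [add_smul, Finset.sum_add_distrib] at hsum
  rw [← e₁, ← e₂, ← e₃] at hsum
  generalize ∑ p, ∑ q, ∑ r, ∑ s, K p q r s • Z p q r s = S at hsum ⊢
  have : (4 : ℂ) • S = 0 := by rw [← hsum]; module
  simpa using this

/-- An identity in the Weyl algebra: the symbol `tr((AD + DA)[A, D])` vanishes, and so do the
lower order terms. -/
theorem TraceOrthonormal.weyl_identity (hb : TraceOrthonormal b) {R : Type*} [Ring R]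
    [Algebra ℂ R] (X D : ι → R) (hX : ∀ p q, X p * X q = X q * X p)
    (hD : ∀ p q, D p * D q = D q * D p)
    (hDX : ∀ p q, D p * X q = X q * D p + if p = q then 1 else 0) :
    ∑ p, ∑ q, ∑ r, ∑ s, Matrix.trace (((b p : Mat N) * (b q : Mat N) +
      (b q : Mat N) * (b p : Mat N)) * ((b r : Mat N) * (b s : Mat N) -
      (b s : Mat N) * (b r : Mat N))) • (X q * D p * (X s * D r)) = 0 := by
  -- Normal ordering: the leading term has the symmetries p ↔ r and q ↔ s, and the contraction of
  -- D_p with X_s leaves a first order term.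
  have hZ : ∀ p q r s, X q * D p * (X s * D r) =
      X q * X s * (D p * D r) + if p = s then X q * D r else 0 := by
    intro p q r s
    rw [mul_assoc, ← mul_assoc (D p), hDX]
    split_ifs <;> noncomm_ring
  simp only [hZ, smul_add, Finset.sum_add_distrib]
  have h2 : ∑ p, ∑ q, ∑ r, ∑ s, Matrix.trace (((b p : Mat N) * (b q : Mat N) +
      (b q : Mat N) * (b p : Mat N)) * ((b r : Mat N) * (b s : Mat N) -
      (b s : Mat N) * (b r : Mat N))) • (if p = s then X q * D r else 0) = 0 := by
    rw [Finset.sum_comm]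
    refine Finset.sum_eq_zero fun q _ => ?_
    simp only [smul_ite, smul_zero, Finset.sum_ite_eq, Finset.mem_univ, if_true]
    rw [Finset.sum_comm]
    refine Finset.sum_eq_zero fun r _ => ?_
    rw [← Finset.sum_smul, hb.sum_trace_anticomm_comm, zero_smul]
  rw [h2, add_zero]
  exact sum_trace_anticomm_mul_comm_smul (fun p => (b p : Mat N))
    (fun p q r s => X q * X s * (D p * D r)) (fun p q r s => by rw [hD])
    (fun p q r s => by rw [hX])

end WeylIdentity

/-! ### Multiplication, derivative and matrix operators on tensor-valued functions -/

section Operators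

attribute [local instance 100] LieRing.ofAssociativeRing

variable {n N : ℕ}

/-- An operator on polynomial functions, acting on tensor-valued polynomial functions. -/
def polyOp (n N : ℕ) : Module.End ℂ (PolyFun N) →ₐ[ℂ] Module.End ℂ (TensorFun n N) :=
  Module.End.rTensorAlgHom ℂ (PolyFun N) (TensorPow n N)

/-- An operator on tensors, acting on tensor-valued polynomial functions. -/
def tensOp (n N : ℕ) : Module.End ℂ (TensorPow n N) →ₐ[ℂ] Module.End ℂ (TensorFun n N) :=
  Module.End.lTensorAlgHom ℂ (TensorPow n N) (PolyFun N)

@[simp]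
theorem polyOp_tmul (f : Module.End ℂ (PolyFun N)) (g : PolyFun N) (u : TensorPow n N) :
    polyOp n N f (g ⊗ₜ u) = f g ⊗ₜ u := rfl

@[simp]
theorem tensOp_tmul (f : Module.End ℂ (TensorPow n N)) (g : PolyFun N) (u : TensorPow n N) :
    tensOp n N f (g ⊗ₜ u) = g ⊗ₜ f u := rfl

theorem tensOp_mul_polyOp (f : Module.End ℂ (PolyFun N)) (g : Module.End ℂ (TensorPow n N)) :
    tensOp n N g * polyOp n N f = polyOp n N f * tensOp n N g :=
  TensorProduct.ext' fun _ _ => rfl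

variable {ι : Type*} [Fintype ι] [DecidableEq ι] (b : Module.Basis ι ℂ (sl N))

/-- Multiplication by a coordinate function. -/
def mulCoord (n : ℕ) (p : ι) : Module.End ℂ (TensorFun n N) :=
  polyOp n N (LinearMap.mulLeft ℂ (coordFun b p))

/-- The partial derivative along a basis vector. -/
def partialDer (n : ℕ) (p : ι) : Module.End ℂ (TensorFun n N) :=
  polyOp n N (dirDeriv (b p) : PolyFun N →ₗ[ℂ] PolyFun N)

/-- The Euler operator. -/
def eulerOp (n N : ℕ) : Module.End ℂ (TensorFun n N) :=
  polyOp n N (eulerDer N : PolyFun N →ₗ[ℂ] PolyFun N)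

omit [Fintype ι] [DecidableEq ι] in
theorem mulCoord_comm (p q : ι) :
    mulCoord b n p * mulCoord b n q = mulCoord b n q * mulCoord b n p := by
  rw [mulCoord, mulCoord, ← map_mul, ← map_mul]
  congr 1
  exact LinearMap.ext fun g => mul_left_comm (coordFun b p) (coordFun b q) g

theorem partialDer_comm (p q : ι) :
    partialDer b n p * partialDer b n q = partialDer b n q * partialDer b n p := by
  rw [partialDer, partialDer, ← map_mul, ← map_mul]
  congr 1
  exact LinearMap.ext fun g => dirDeriv_comm _ _ g

theorem partialDer_mul_mulCoord (p q : ι) :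
    partialDer b n p * mulCoord b n q =
      mulCoord b n q * partialDer b n p + if p = q then 1 else 0 := by
  have : (dirDeriv (b p) : PolyFun N →ₗ[ℂ] PolyFun N) * LinearMap.mulLeft ℂ (coordFun b q) =
      LinearMap.mulLeft ℂ (coordFun b q) * (dirDeriv (b p) : PolyFun N →ₗ[ℂ] PolyFun N) +
        if p = q then 1 else 0 := by
    refine LinearMap.ext fun g => ?_
    simp [dirDeriv_coordFun]
    split_ifs <;> simp
  rw [partialDer, mulCoord, ← map_mul, this, map_add, map_mul]
  congr 1
  split_ifs <;> simp

theorem eulerOp_eq : eulerOp n N = ∑ p, mulCoord b n p * partialDer b n p := by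
  simp only [mulCoord, partialDer, ← map_mul, ← map_sum, eulerOp]
  congr 1
  refine LinearMap.ext fun g => ?_
  simp [eulerDer_apply b, LinearMap.sum_apply]

/-- The operator `∑ tr(M[b_r, b_s]) x_s ∂_r`, which is the adjoint action of `M`. -/
def adOp (n : ℕ) (M : Mat N) : Module.End ℂ (TensorFun n N) :=
  ∑ r, ∑ s, brCoeff b M r s • (mulCoord b n s * partialDer b n r)

theorem tensOp_mul_mulCoord (g : Module.End ℂ (TensorPow n N)) (p : ι) :
    tensOp n N g * mulCoord b n p = mulCoord b n p * tensOp n N g := tensOp_mul_polyOp _ _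

theorem tensOp_mul_partialDer (g : Module.End ℂ (TensorPow n N)) (p : ι) :
    tensOp n N g * partialDer b n p = partialDer b n p * tensOp n N g := tensOp_mul_polyOp _ _

variable {b}

theorem TraceOrthonormal.slAction_eq (hb : TraceOrthonormal b) (ξ : sl N) :
    slAction (n := n) ξ = adOp b n ξ + tensOp n N (diagAction n N ξ) := by
  rw [diagAction_apply]
  have : (adAction ξ : PolyFun N →ₗ[ℂ] PolyFun N) = ∑ r, ∑ s, brCoeff b ξ r s •
      (LinearMap.mulLeft ℂ (coordFun b s) * (dirDeriv (b r) : PolyFun N →ₗ[ℂ] PolyFun N)) :=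
    LinearMap.ext fun g => by
      simp [hb.adAction_apply, LinearMap.sum_apply]
  change polyOp n N (adAction ξ : PolyFun N →ₗ[ℂ] PolyFun N) +
    tensOp n N (∑ i, atFactor i (ξ : Mat N)) = _
  rw [this]
  simp only [map_sum, map_smul, map_mul]
  rfl

theorem mem_invariants {f : TensorFun n N} :
    f ∈ invariants n N ↔ ∀ ξ : sl N, slAction ξ f = 0 := by
  simp [invariants]

end Operators

end KZB
end

noncomputable section

namespace KZB

/-! ### The operators `X_i`, `Y_i` and the Casimir element, abstractly -/

attribute [local instance 100] LieRing.ofAssociativeRing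

/-- Differential operators on `𝔰𝔩_N` together with operators on an `n`-fold tensor power,
inside a ring. -/
structure WeylSystem {N : ℕ} {ι : Type*} [Fintype ι] [DecidableEq ι]
    (b : Module.Basis ι ℂ (sl N)) (n : ℕ) (R : Type*) [Ring R] [Algebra ℂ R] where
  /-- multiplication by coordinates -/
  X : ι → R
  /-- partial derivatives -/
  D : ι → R
  /-- matrices acting on a tensor factor -/
  a : Fin n → Mat N →ₐ[ℂ] R
  /-- permutations of the tensor factors -/
  s : Equiv.Perm (Fin n) →* R
  X_comm : ∀ p q, X p * X q = X q * X p
  D_comm : ∀ p q, D p * D q = D q * D p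
  D_X : ∀ p q, D p * X q = X q * D p + if p = q then 1 else 0
  a_X : ∀ i M p, a i M * X p = X p * a i M
  a_D : ∀ i M p, a i M * D p = D p * a i M
  s_X : ∀ σ p, s σ * X p = X p * s σ
  s_D : ∀ σ p, s σ * D p = D p * s σ
  s_a : ∀ σ i M, s σ * a i M = a (σ i) M * s σ
  a_comm : ∀ i j, i ≠ j → ∀ M M', a i M * a j M' = a j M' * a i M
  sum_a : ∀ i j, i ≠ j → ∑ c, ∑ d, a i (Matrix.single c d 1) * a j (Matrix.single d c 1) =
    s (Equiv.swap i j)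

theorem TraceOrthonormal.sum_brCoeff_smul {N : ℕ} {ι : Type*} [Fintype ι] [DecidableEq ι]
    {b : Module.Basis ι ℂ (sl N)} (hb : TraceOrthonormal b) (ξ : sl N) (s : ι) :
    ∑ p, brCoeff b ξ s p • (b p : Mat N) =
      (ξ : Mat N) * (b s : Mat N) - (b s : Mat N) * (ξ : Mat N) := by
  rw [← sl_bracket_coe, ← b.sum_repr ⁅ξ, b s⁆, sl_coe_sum]
  simp [hb.repr_bracket]

theorem sum_brCoeff_antisymm {N : ℕ} {ι : Type*} [Fintype ι] [DecidableEq ι]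
    {b : Module.Basis ι ℂ (sl N)} {V : Type*} [AddCommGroup V]
    [Module ℂ V] (M : Mat N) (Z : ι → ι → V) :
    ∑ p, ∑ s, brCoeff b M p s • Z p s + ∑ p, ∑ s, brCoeff b M p s • Z s p = 0 := by
  rw [Finset.sum_comm, ← Finset.sum_add_distrib]
  refine Finset.sum_eq_zero fun p _ => ?_
  rw [← Finset.sum_add_distrib]
  refine Finset.sum_eq_zero fun s _ => ?_
  rw [brCoeff_swap]; module

theorem sum_smul_eq_zero_of_antisymm {ι V : Type*} [Fintype ι] [AddCommGroup V] [Module ℂ V]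
    (c : ι → ι → ℂ) (Z : ι → ι → V) (hc : ∀ p s, c s p = -c p s) (hZ : ∀ p s, Z s p = Z p s) :
    ∑ p, ∑ s, c p s • Z p s = 0 := by
  have h : ∑ p, ∑ s, c p s • Z p s = -∑ p, ∑ s, c p s • Z p s := by
    conv_lhs => rw [Finset.sum_comm]
    simp only [← Finset.sum_neg_distrib, ← neg_smul, ← hc, hZ]
  have h2 : (2 : ℂ) • ∑ p, ∑ s, c p s • Z p s = 0 := by
    rw [two_smul]
    nth_rewrite 1 [h]
    exact neg_add_cancel _
  simpa using h2

/-- Cyclicity of the trace makes the structure constants tr(b_p [b_r, b_s]) totally antisymmetric.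
-/
theorem brCoeff_swap_first_second {N : ℕ} {ι : Type*} [Fintype ι] [DecidableEq ι]
    {b : Module.Basis ι ℂ (sl N)} (p r s : ι) :
    brCoeff b (b r) p s = -brCoeff b (b p) r s := by
  simp only [brCoeff, mul_sub, Matrix.trace_sub, neg_sub]
  rw [Matrix.trace_mul_comm (b r : Mat N), Matrix.trace_mul_comm (b r : Mat N), mul_assoc,
    mul_assoc, Matrix.trace_mul_comm (b s : Mat N), mul_assoc]

theorem brCoeff_swap_first_third {N : ℕ} {ι : Type*} [Fintype ι] [DecidableEq ι]
    {b : Module.Basis ι ℂ (sl N)} (p r s : ι) :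
    brCoeff b (b s) r p = -brCoeff b (b p) r s := by
  rw [brCoeff_swap, brCoeff_swap_first_second, brCoeff_swap, neg_neg]

theorem brCoeff_self {N : ℕ} {ι : Type*} [Fintype ι] [DecidableEq ι]
    {b : Module.Basis ι ℂ (sl N)} (p r : ι) : brCoeff b (b p) r p = 0 := by
  have := brCoeff_swap_first_third (b := b) p r p
  exact self_eq_neg.mp this

namespace WeylSystem

variable {n N : ℕ} {ι : Type*} [Fintype ι] [DecidableEq ι] {b : Module.Basis ι ℂ (sl N)}
  {R : Type*} [Ring R] [Algebra ℂ R] (W : WeylSystem b n R)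

/-- The diagonal action of matrices. -/
def t : Mat N →ₗ[ℂ] R := ∑ i, (W.a i).toLinearMap

theorem t_apply (M : Mat N) : W.t M = ∑ i, W.a i M := by simp [t, LinearMap.sum_apply]

/-- The operator `f ↦ (A ↦ A_i f(A))`. -/
def x (i : Fin n) : R := ∑ p, W.X p * W.a i (b p : Mat N)

/-- The operator `f ↦ ∑ (b_p)_i ∂f/∂b_p`. -/
def y₀ (i : Fin n) : R := ∑ p, W.D p * W.a i (b p : Mat N)

/-- The operator `f ↦ (N / n) ∑ (b_p)_i ∂f/∂b_p`. -/
def y (i : Fin n) : R := ((N : ℂ) / n) • W.y₀ i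

/-- The Casimir element acting on tensors. -/
def cas : R := ∑ p, W.t (b p : Mat N) * W.t (b p : Mat N)

/-- The Euler operator. -/
def euler : R := ∑ p, W.X p * W.D p

/-- The operator `∑ tr(M[b_r, b_s]) x_s ∂_r`, which is the adjoint action of `M`. -/
def ad (M : Mat N) : R := ∑ r, ∑ s, brCoeff b M r s • (W.X s * W.D r)

theorem t_one : W.t 1 = (n : ℂ) • 1 := by
  simp [t_apply, Algebra.smul_def]

theorem t_X (M : Mat N) (p : ι) : W.t M * W.X p = W.X p * W.t M := by
  simp only [t_apply, Finset.sum_mul, Finset.mul_sum, W.a_X]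

theorem t_D (M : Mat N) (p : ι) : W.t M * W.D p = W.D p * W.t M := by
  simp only [t_apply, Finset.sum_mul, Finset.mul_sum, W.a_D]

theorem s_t (σ : Equiv.Perm (Fin n)) (M : Mat N) : W.s σ * W.t M = W.t M * W.s σ := by
  rw [t_apply, Finset.mul_sum, Finset.sum_mul, ← Equiv.sum_comp σ (fun i => W.a i M * W.s σ)]
  exact Finset.sum_congr rfl fun i _ => W.s_a σ i M

theorem t_a (M M' : Mat N) (i : Fin n) :
    W.t M * W.a i M' = W.a i M' * W.t M + W.a i (M * M' - M' * M) := by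
  rw [← sub_eq_iff_eq_add', t_apply, Finset.sum_mul, Finset.mul_sum, ← Finset.sum_sub_distrib,
    Finset.sum_eq_single i]
  · simp
  · intro j _ hj
    rw [W.a_comm j i hj, sub_self]
  · simp

theorem ad_comm_of_commute {z : R} (hX : ∀ p, z * W.X p = W.X p * z)
    (hD : ∀ p, z * W.D p = W.D p * z) (M : Mat N) : z * W.ad M = W.ad M * z := by
  simp only [ad, Finset.mul_sum, Finset.sum_mul, mul_smul_comm, smul_mul_assoc, ← mul_assoc, hX]
  simp only [mul_assoc, hD]

theorem ad_X (M : Mat N) (p : ι) :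
    W.ad M * W.X p = W.X p * W.ad M + ∑ s, brCoeff b M p s • W.X s := by
  have h : ∀ r s, W.X s * W.D r * W.X p =
      W.X p * (W.X s * W.D r) + if r = p then W.X s else 0 := by
    intro r s
    rw [mul_assoc, W.D_X, mul_add, ← mul_assoc, W.X_comm, mul_assoc]
    split_ifs <;> simp
  simp only [ad, Finset.sum_mul, Finset.mul_sum, smul_mul_assoc, mul_smul_comm, h, smul_add,
    Finset.sum_add_distrib]
  congr 1
  rw [Finset.sum_eq_single p]
  · simp
  · intro r _ hr; simp [hr]
  · simp

theorem D_ad (M : Mat N) (p : ι) :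
    W.D p * W.ad M = W.ad M * W.D p + ∑ r, brCoeff b M r p • W.D r := by
  have h : ∀ r s, W.D p * (W.X s * W.D r) =
      W.X s * W.D r * W.D p + if p = s then W.D r else 0 := by
    intro r s
    rw [← mul_assoc, W.D_X, add_mul, mul_assoc, W.D_comm, mul_assoc]
    split_ifs <;> simp
  simp only [ad, Finset.sum_mul, Finset.mul_sum, smul_mul_assoc, mul_smul_comm, h, smul_add,
    Finset.sum_add_distrib]
  congr 1
  simp

theorem ad_D (M : Mat N) (p : ι) :
    W.ad M * W.D p = W.D p * W.ad M + ∑ s, brCoeff b M p s • W.D s := by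
  rw [D_ad, add_assoc, left_eq_add, ← Finset.sum_add_distrib]
  refine Finset.sum_eq_zero fun s _ => ?_
  rw [brCoeff_swap]; module

/-- The action of `𝔰𝔩_N`. -/
def act (ξ : sl N) : R := W.ad ξ + W.t ξ

/-- A family Z_p that transforms under ad ξ as the basis does pairs with the (b_p)_i to an invariant
operator: the bracket terms from Z_p and from (b_p)_i cancel by antisymmetry of the structure
constants. It serves for both coordinates and derivatives. -/
theorem act_comm_sum (hb : TraceOrthonormal b) (ξ : sl N) (i : Fin n) (Z : ι → R)
    (hadZ : ∀ p, W.ad ξ * Z p = Z p * W.ad ξ + ∑ s, brCoeff b ξ p s • Z s)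
    (htZ : ∀ p, W.t ξ * Z p = Z p * W.t ξ) :
    W.act ξ * ∑ p, Z p * W.a i (b p : Mat N) = (∑ p, Z p * W.a i (b p : Mat N)) * W.act ξ := by
  have h1 : W.ad ξ * ∑ p, Z p * W.a i (b p : Mat N) = (∑ p, Z p * W.a i (b p : Mat N)) * W.ad ξ +
      ∑ p, ∑ s, brCoeff b ξ p s • (Z s * W.a i (b p : Mat N)) := by
    rw [Finset.mul_sum, Finset.sum_mul, ← Finset.sum_add_distrib]
    refine Finset.sum_congr rfl fun p _ => ?_
    rw [mul_assoc, W.ad_comm_of_commute (W.a_X i _) (W.a_D i _), ← mul_assoc, ← mul_assoc, hadZ,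
      add_mul, Finset.sum_mul]
    simp only [smul_mul_assoc]
  have h2 : W.t ξ * ∑ p, Z p * W.a i (b p : Mat N) = (∑ p, Z p * W.a i (b p : Mat N)) * W.t ξ +
      ∑ p, ∑ s, brCoeff b ξ p s • (Z p * W.a i (b s : Mat N)) := by
    rw [Finset.mul_sum, Finset.sum_mul, ← Finset.sum_add_distrib]
    refine Finset.sum_congr rfl fun p _ => ?_
    rw [← mul_assoc, htZ, mul_assoc, W.t_a, mul_add, ← mul_assoc, ← hb.sum_brCoeff_smul, map_sum,
      Finset.mul_sum]
    simp only [map_smul, mul_smul_comm]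
  rw [act, add_mul, h1, h2, mul_add, add_add_add_comm, add_comm (∑ p, ∑ s, _),
    sum_brCoeff_antisymm _ (fun p s => Z p * W.a i (b s : Mat N)), add_zero]

theorem act_x (hb : TraceOrthonormal b) (ξ : sl N) (i : Fin n) :
    W.act ξ * W.x i = W.x i * W.act ξ :=
  W.act_comm_sum hb ξ i W.X (W.ad_X ξ) (W.t_X ξ)

theorem act_y (hb : TraceOrthonormal b) (ξ : sl N) (i : Fin n) :
    W.act ξ * W.y i = W.y i * W.act ξ := by
  rw [y, mul_smul_comm, smul_mul_assoc, y₀, W.act_comm_sum hb ξ i W.D (W.ad_D ξ) (W.t_D ξ)]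

theorem act_s (ξ : sl N) (σ : Equiv.Perm (Fin n)) : W.act ξ * W.s σ = W.s σ * W.act ξ := by
  rw [act, add_mul, mul_add, W.ad_comm_of_commute (W.s_X σ) (W.s_D σ), W.s_t]

theorem s_x (σ : Equiv.Perm (Fin n)) (i : Fin n) : W.s σ * W.x i = W.x (σ i) * W.s σ := by
  simp only [x, Finset.mul_sum, Finset.sum_mul, ← mul_assoc, W.s_X]
  simp only [mul_assoc, W.s_a]

theorem s_y (σ : Equiv.Perm (Fin n)) (i : Fin n) : W.s σ * W.y i = W.y (σ i) * W.s σ := by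
  simp only [y, y₀, mul_smul_comm, smul_mul_assoc, Finset.mul_sum, Finset.sum_mul, ← mul_assoc,
    W.s_D]
  simp only [mul_assoc, W.s_a]

theorem sum_mul_sum_comm (Z : ι → R) (hZ : ∀ p q, Z p * Z q = Z q * Z p)
    (ha : ∀ i M p, W.a i M * Z p = Z p * W.a i M) (i j : Fin n) :
    (∑ p, Z p * W.a i (b p : Mat N)) * (∑ p, Z p * W.a j (b p : Mat N)) =
      (∑ p, Z p * W.a j (b p : Mat N)) * (∑ p, Z p * W.a i (b p : Mat N)) := by
  rcases eq_or_ne i j with rfl | hij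
  · rfl
  rw [Finset.sum_mul_sum, Finset.sum_mul_sum, Finset.sum_comm]
  refine Finset.sum_congr rfl fun p _ => Finset.sum_congr rfl fun q _ => ?_
  rw [mul_assoc, ← mul_assoc (W.a i _), ha, mul_assoc (Z _), mul_assoc (Z p),
    ← mul_assoc (W.a j _), ha, mul_assoc (Z q), ← mul_assoc, ← mul_assoc (Z p), hZ,
    W.a_comm i j hij]

theorem x_comm (i j : Fin n) : W.x i * W.x j = W.x j * W.x i :=
  W.sum_mul_sum_comm W.X W.X_comm W.a_X i j

theorem y_comm (i j : Fin n) : W.y i * W.y j = W.y j * W.y i := by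
  rw [y, y, smul_mul_smul_comm, smul_mul_smul_comm, y₀, y₀,
    W.sum_mul_sum_comm W.D W.D_comm W.a_D i j]

theorem x_mul_y₀ (i j : Fin n) : W.x i * W.y₀ j = ∑ q, ∑ p,
    W.X q * W.D p * (W.a i (b q : Mat N) * W.a j (b p : Mat N)) := by
  simp only [x, y₀, Finset.sum_mul_sum]
  refine Finset.sum_congr rfl fun p _ => Finset.sum_congr rfl fun q _ => ?_
  rw [mul_assoc, ← mul_assoc (W.a i _), W.a_D]
  simp only [mul_assoc]

theorem sum_a_mul (hb : TraceOrthonormal b) {i j : Fin n} (hij : i ≠ j) :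
    ∑ p, W.a i (b p : Mat N) * W.a j (b p : Mat N) =
      W.s (Equiv.swap i j) - (1 / (N : ℂ)) • 1 := by
  have h := hb.sum_bilin (LinearMap.mk₂ ℂ (fun A B => W.a i A * W.a j B)
    (by intros; simp [add_mul]) (by intros; simp) (by intros; simp [mul_add]) (by intros; simp))
  simp only [LinearMap.mk₂_apply, map_one, mul_one] at h
  rw [h, W.sum_a i j hij]

theorem sum_a_mul_self (hb : TraceOrthonormal b) (i : Fin n) :
    ∑ p, W.a i (b p : Mat N) * W.a i (b p : Mat N) = ((N : ℂ) - 1 / N) • 1 := by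
  simp only [← map_mul, ← map_sum, hb.sum_mul_self, map_smul, map_one]

/-- The matrices in slots i and j commute, so only the contraction of D with X survives. It gives ∑
(b_p)_i (b_p)_j = s_ij - 1/N, and the factor N/n turns 1/N into 1/n. -/
theorem x_y (hb : TraceOrthonormal b) {i j : Fin n} (hij : i ≠ j) (hN : 0 < N) :
    W.x i * W.y j - W.y j * W.x i =
      algebraMap ℂ R (1 / (n : ℂ)) - ((N : ℂ) / n) • W.s (Equiv.swap i j) := by
  have h : ∀ p q, W.D p * W.a j (b p : Mat N) * (W.X q * W.a i (b q : Mat N)) =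
      W.X q * W.D p * (W.a i (b q : Mat N) * W.a j (b p : Mat N)) +
      if p = q then W.a i (b q : Mat N) * W.a j (b p : Mat N) else 0 := by
    intro p q
    rw [mul_assoc, ← mul_assoc (W.a j _), W.a_X, mul_assoc (W.X q), ← mul_assoc, W.D_X, add_mul,
      W.a_comm j i hij.symm]
    split_ifs <;> simp
  have h' : W.y₀ j * W.x i = W.x i * W.y₀ j + (W.s (Equiv.swap i j) - (1 / (N : ℂ)) • 1) := by
    rw [x_mul_y₀, ← W.sum_a_mul hb hij]
    simp only [x, y₀, Finset.sum_mul_sum, h, Finset.sum_add_distrib,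
      Finset.sum_ite_eq, Finset.mem_univ, if_true]
    rw [Finset.sum_comm]
  have hN' : (N : ℂ) ≠ 0 := by exact_mod_cast hN.ne'
  rw [y, mul_smul_comm, smul_mul_assoc, h', Algebra.algebraMap_eq_smul_one]
  have : (1 / (n : ℂ)) = (N : ℂ) / n * (1 / N) := by field_simp
  rw [this]
  module

/-- Each of the n² ordered pairs contributes s_ij - 1/N. On the diagonal s_ii = 1, while the true
value is N - 1/N, whence the n corrections N - 1. -/
theorem cas_eq (hb : TraceOrthonormal b) :
    W.cas = ∑ i, ∑ j, W.s (Equiv.swap i j) + ((n : ℂ) * (N - 1) - n * n / N) • 1 := by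
  have h : ∀ i j : Fin n, ∑ p, W.a i (b p : Mat N) * W.a j (b p : Mat N) =
      W.s (Equiv.swap i j) - (1 / (N : ℂ)) • 1 + (if i = j then ((N : ℂ) - 1) • 1 else 0) := by
    intro i j
    split_ifs with hij
    · subst hij
      rw [W.sum_a_mul_self hb, Equiv.swap_self, ← Equiv.Perm.one_def, map_one]
      module
    · rw [W.sum_a_mul hb hij, add_zero]
  have h' : ∀ i : Fin n, ∑ p, ∑ j, W.a i (b p : Mat N) * W.a j (b p : Mat N) =
      ∑ j, W.s (Equiv.swap i j) - ((n : ℂ) / N) • 1 + ((N : ℂ) - 1) • 1 := by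
    intro i
    rw [Finset.sum_comm, Finset.sum_congr rfl fun j _ => h i j, Finset.sum_add_distrib,
      Finset.sum_sub_distrib]
    simp only [Finset.sum_const, Finset.sum_ite_eq, Finset.mem_univ, if_true, Finset.card_univ,
      Fintype.card_fin, ← Nat.cast_smul_eq_nsmul ℂ, smul_smul]
    congr 3
    ring
  simp only [cas, t_apply, Finset.sum_mul_sum]
  rw [Finset.sum_comm, Finset.sum_congr rfl fun i _ => h' i, Finset.sum_add_distrib,
    Finset.sum_sub_distrib]
  simp only [Finset.sum_const, Finset.card_univ,
      Fintype.card_fin, ← Nat.cast_smul_eq_nsmul ℂ, smul_smul]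
  module

/-! ### Operators evaluated on invariant vectors -/

section Invariant

variable {V : Type*} [AddCommGroup V] [Module ℂ V] [Module R V] [IsScalarTower ℂ R V]

/-- The vectors killed by the action of `𝔰𝔩_N`. -/
def IsInvariant (f : V) : Prop := ∀ ξ : sl N, W.act ξ • f = 0

variable {W} {f : V}

theorem IsInvariant.t_smul (hf : W.IsInvariant f) (ξ : sl N) : W.t ξ • f = -(W.ad ξ • f) := by
  have := hf ξ
  rw [act, add_smul] at this
  exact eq_neg_of_add_eq_zero_right this

theorem brCoeff_one (r s : ι) : brCoeff b 1 r s = 0 := by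
  rw [brCoeff, one_mul, Matrix.trace_sub, Matrix.trace_mul_comm, sub_self]

/-- Extends invariance to matrices with trace, such as the products b_q b_p: the identity matrix
acts on the tensors by n, and its adjoint action vanishes. -/
theorem IsInvariant.t_smul_eq (hf : W.IsInvariant f) (M : Mat N) :
    W.t M • f = ((n : ℂ) / N * Matrix.trace M) • f - W.ad M • f := by
  obtain ⟨A, hA⟩ := exists_sl_add_smul_one M
  have had : W.ad M = W.ad A := by
    have : ∀ r s, brCoeff b M r s = brCoeff b A r s := by
      intro r s
      conv_lhs => rw [hA]
      have h1 := brCoeff_one (b := b) r s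
      rw [brCoeff, one_mul] at h1
      rw [brCoeff, add_mul, Matrix.trace_add, smul_mul_assoc, one_mul, Matrix.trace_smul, h1,
        smul_zero, add_zero, brCoeff]
    simp only [ad, this]
  have ht : W.t M = W.t A + (Matrix.trace M / N * n) • 1 := by
    conv_lhs => rw [hA]
    rw [map_add, map_smul, t_one, smul_smul]
  rw [had, ht, add_smul, hf.t_smul, smul_assoc, one_smul, add_comm, ← sub_eq_add_neg]
  congr 2
  ring

/-- The sum is the diagonal action of the point A itself. On invariants this is minus the derivative
along [A, A] = 0; in coordinates, a symmetric product of coordinates meets an antisymmetric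
coefficient. -/
theorem IsInvariant.sum_x_smul (hf : W.IsInvariant f) : ∑ i, W.x i • f = 0 := by
  have h : ∑ i, W.x i = ∑ p, W.X p * W.t (b p : Mat N) := by
    simp only [x, t_apply, Finset.mul_sum]
    exact Finset.sum_comm
  rw [← Finset.sum_smul, h, Finset.sum_smul]
  simp only [mul_smul, hf.t_smul, smul_neg, Finset.sum_neg_distrib]
  simp only [← mul_smul, ← Finset.sum_smul]
  have h0 : ∑ p, W.X p * W.ad (b p : Mat N) = 0 := by
    simp only [ad, Finset.mul_sum, mul_smul_comm]
    rw [Finset.sum_comm]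
    refine Finset.sum_eq_zero fun r _ => ?_
    exact sum_smul_eq_zero_of_antisymm (fun p s => brCoeff b (b p) r s)
      (fun p s => W.X p * (W.X s * W.D r)) (fun p s => brCoeff_swap_first_third p r s)
      (fun p s => by rw [← mul_assoc, W.X_comm, mul_assoc])
  rw [h0, zero_smul, neg_zero]

theorem IsInvariant.sum_y_smul (hf : W.IsInvariant f) : ∑ i, W.y i • f = 0 := by
  have h : ∑ i, W.y₀ i = ∑ p, W.D p * W.t (b p : Mat N) := by
    simp only [y₀, t_apply, Finset.mul_sum]
    exact Finset.sum_comm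
  rw [← Finset.sum_smul]
  simp only [y]
  rw [← Finset.smul_sum, h, smul_assoc, Finset.sum_smul]
  simp only [mul_smul, hf.t_smul, smul_neg, Finset.sum_neg_distrib]
  simp only [← mul_smul, ← Finset.sum_smul]
  have h0 : ∑ p, W.D p * W.ad (b p : Mat N) = 0 := by
    -- The contraction term occurs only for p = s, where the structure constant has a repeated index
    -- and vanishes.
    have e : ∀ p r s, W.D p * (W.X s * W.D r) =
        W.X s * (W.D p * W.D r) + if p = s then W.D r else 0 := by
      intro p r s
      rw [← mul_assoc, W.D_X, add_mul, mul_assoc]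
      split_ifs <;> simp
    simp only [ad, Finset.mul_sum, mul_smul_comm, e, smul_add, Finset.sum_add_distrib, smul_ite,
      smul_zero, Finset.sum_ite_eq, Finset.mem_univ, if_true, brCoeff_self, zero_smul,
      Finset.sum_const_zero, add_zero]
    rw [Finset.sum_congr rfl fun p _ => Finset.sum_comm, Finset.sum_comm]
    refine Finset.sum_eq_zero fun s _ => ?_
    exact sum_smul_eq_zero_of_antisymm (fun p r => brCoeff b (b p) r s)
      (fun p r => W.X s * (W.D p * W.D r)) (fun p r => brCoeff_swap_first_second p r s)
      (fun p r => by rw [W.D_comm])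
  rw [h0, zero_smul, smul_zero, neg_zero]

/-- Completeness of the basis merges the two structure constants into tr([b_p, b_q][b_r, b_s]).
Write [P, Q] = (PQ + QP) - 2QP: the anticommutator contributes zero by the Weyl identity, and the
rest is the right side. -/
theorem sum_ad_mul_ad (hb : TraceOrthonormal b) :
    ∑ p, W.ad (b p : Mat N) * W.ad (b p : Mat N) =
      (-2 : ℂ) • ∑ p, ∑ q, W.X q * W.D p * W.ad ((b q : Mat N) * (b p : Mat N)) := by
  have h1 : ∀ p q r s, ∑ u, brCoeff b (b u) p q * brCoeff b (b u) r s = Matrix.trace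
      (((b p : Mat N) * (b q : Mat N) - (b q : Mat N) * (b p : Mat N)) *
        ((b r : Mat N) * (b s : Mat N) - (b s : Mat N) * (b r : Mat N))) := by
    intro p q r s
    rw [← sl_bracket_coe (b p)]
    conv_rhs => rw [← hb.sum_smul ⁅b p, b q⁆, Finset.sum_mul, Matrix.trace_sum]
    refine Finset.sum_congr rfl fun u _ => ?_
    rw [smul_mul_assoc, Matrix.trace_smul, smul_eq_mul, brCoeff, brCoeff, sl_bracket_coe]
  have h2 : ∑ p, W.ad (b p : Mat N) * W.ad (b p : Mat N) = ∑ p, ∑ q, ∑ r, ∑ s,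
      (∑ u, brCoeff b (b u) p q * brCoeff b (b u) r s) • (W.X q * W.D p * (W.X s * W.D r)) := by
    simp only [Finset.sum_smul]
    have : ∀ u, W.ad (b u : Mat N) * W.ad (b u : Mat N) = ∑ p, ∑ q, ∑ r, ∑ s,
        (brCoeff b (b u) p q * brCoeff b (b u) r s) • (W.X q * W.D p * (W.X s * W.D r)) := by
      intro u
      simp only [ad, Finset.sum_mul]
      refine Finset.sum_congr rfl fun p _ => Finset.sum_congr rfl fun q _ => ?_
      simp only [Finset.mul_sum, smul_mul_smul_comm]
    simp only [this]
    rw [Finset.sum_comm]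
    refine Finset.sum_congr rfl fun p _ => ?_
    rw [Finset.sum_comm]
    refine Finset.sum_congr rfl fun q _ => ?_
    rw [Finset.sum_comm]
    refine Finset.sum_congr rfl fun r _ => ?_
    rw [Finset.sum_comm]
  have h3 : ∑ p, ∑ q, W.X q * W.D p * W.ad ((b q : Mat N) * (b p : Mat N)) =
      ∑ p, ∑ q, ∑ r, ∑ s, brCoeff b ((b q : Mat N) * (b p : Mat N)) r s •
        (W.X q * W.D p * (W.X s * W.D r)) := by
    simp only [ad, Finset.mul_sum, mul_smul_comm]
  rw [h2, h3, ← sub_eq_zero, Finset.smul_sum, ← Finset.sum_sub_distrib,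
    ← hb.weyl_identity W.X W.D W.X_comm W.D_comm W.D_X]
  refine Finset.sum_congr rfl fun p _ => ?_
  simp only [Finset.smul_sum, ← Finset.sum_sub_distrib]
  refine Finset.sum_congr rfl fun q _ => Finset.sum_congr rfl fun r _ =>
    Finset.sum_congr rfl fun s _ => ?_
  rw [h1, smul_smul, ← sub_smul, brCoeff]
  congr 1
  simp only [sub_mul, add_mul, Matrix.trace_sub, Matrix.trace_add]
  ring

/-- The key identity: on invariants, `∑ x_i y_i` is the Euler operator plus a multiple of the
Casimir element. -/
theorem IsInvariant.sum_x_y_smul (hb : TraceOrthonormal b) (hf : W.IsInvariant f) (hn : 0 < n)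
    (hN : 0 < N) :
    ∑ i, W.x i • W.y i • f = W.euler • f + ((N : ℂ) / n / 2) • W.cas • f := by
  have hn' : (n : ℂ) ≠ 0 := by exact_mod_cast hn.ne'
  have hN' : (N : ℂ) ≠ 0 := by exact_mod_cast hN.ne'
  have h1 : ∑ i, W.x i * W.y₀ i =
      ∑ p, ∑ q, W.X q * W.D p * W.t ((b q : Mat N) * (b p : Mat N)) := by
    simp only [x_mul_y₀, t_apply, Finset.mul_sum, ← map_mul]
    rw [Finset.sum_comm, Finset.sum_congr rfl fun q _ => Finset.sum_comm, Finset.sum_comm]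
  -- Orthonormality reduces the trace part of t(b_q b_p) to p = q, which is the Euler operator with
  -- factor n/N.
  have h2 : (∑ i, W.x i * W.y₀ i) • f = ((n : ℂ) / N) • W.euler • f -
      (∑ p, ∑ q, W.X q * W.D p * W.ad ((b q : Mat N) * (b p : Mat N))) • f := by
    rw [h1, euler]
    simp only [Finset.sum_smul, Finset.smul_sum, mul_smul, hf.t_smul_eq, smul_sub,
      Finset.sum_sub_distrib]
    congr 1
    refine Finset.sum_congr rfl fun p _ => ?_
    rw [Finset.sum_eq_single p]
    · rw [hb p p, if_pos rfl, one_smul, smul_comm (W.D p), smul_comm (W.X p)]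
    · intro q _ hq
      rw [hb q p, if_neg hq]
      simp
    · simp
  have h3 : W.cas • f = (∑ p, W.ad (b p : Mat N) * W.ad (b p : Mat N)) • f := by
    rw [cas, Finset.sum_smul, Finset.sum_smul]
    refine Finset.sum_congr rfl fun p _ => ?_
    rw [mul_smul, hf.t_smul, smul_neg, ← mul_smul,
      W.ad_comm_of_commute (W.t_X _) (W.t_D _), mul_smul, hf.t_smul, smul_neg, neg_neg, mul_smul]
  have h4 : ∑ i, W.x i • W.y i • f = ((N : ℂ) / n) • (∑ i, W.x i * W.y₀ i) • f := by
    rw [Finset.sum_smul, Finset.smul_sum]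
    refine Finset.sum_congr rfl fun i _ => ?_
    rw [y, smul_assoc, smul_comm (W.x i), mul_smul]
  -- The remaining term -∑ X_q D_p ad(b_q b_p) is half of ∑ ad(b_p)², that is, half of the Casimir
  -- element on f; with the factor N/n this gives N/(2n).
  rw [h4, h2, h3, sum_ad_mul_ad hb, smul_assoc, smul_sub, smul_smul, smul_smul]
  have h5 : (N : ℂ) / n * (n / N) = 1 := by field_simp
  rw [h5]
  generalize (∑ p, ∑ q, W.X q * W.D p * W.ad ((b q : Mat N) * (b p : Mat N))) • f = v
  generalize W.euler • f = e
  module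

end Invariant

end WeylSystem

end KZB
end

noncomputable section

namespace KZB

/-! ### The representation of the Cherednik algebra on `V_N` -/

attribute [local instance 100] LieRing.ofAssociativeRing

variable {n N : ℕ} {ι : Type*} [Fintype ι] [DecidableEq ι] {b : Module.Basis ι ℂ (sl N)}

/-- The permutation operators on tensor-valued functions. -/
def permOp (n N : ℕ) : Equiv.Perm (Fin n) →* Module.End ℂ (TensorFun n N) :=
  (tensOp n N : Module.End ℂ (TensorPow n N) →* Module.End ℂ (TensorFun n N)).comp (permRep n N)

variable (b) in
/-- The system of operators on tensor-valued polynomial functions. -/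
def tensorWeyl (n : ℕ) : WeylSystem b n (Module.End ℂ (TensorFun n N)) where
  X := mulCoord b n
  D := partialDer b n
  a i := (tensOp n N).comp (atFactorHom n N i)
  s := permOp n N
  X_comm := mulCoord_comm b
  D_comm := partialDer_comm b
  D_X := partialDer_mul_mulCoord b
  a_X _ _ p := tensOp_mul_mulCoord b _ p
  a_D _ _ p := tensOp_mul_partialDer b _ p
  s_X _ p := tensOp_mul_mulCoord b _ p
  s_D _ p := tensOp_mul_partialDer b _ p
  s_a σ i M := by
    change tensOp n N (permFactors σ) * tensOp n N (atFactor i M) =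
      tensOp n N (atFactor (σ i) M) * tensOp n N (permFactors σ)
    rw [← map_mul, permFactors_mul_atFactor, map_mul]
  a_comm i j hij M M' := by
    change tensOp n N (atFactor i M) * tensOp n N (atFactor j M') =
      tensOp n N (atFactor j M') * tensOp n N (atFactor i M)
    rw [← map_mul, atFactor_commute hij, map_mul]
  sum_a i j hij := by
    change ∑ c, ∑ d, tensOp n N (atFactor i (Matrix.single c d 1)) *
      tensOp n N (atFactor j (Matrix.single d c 1)) = tensOp n N (permFactors (Equiv.swap i j))
    rw [← sum_atFactor_single_mul hij]
    simp only [map_sum, map_mul]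

theorem tensorWeyl_t (M : Mat N) : (tensorWeyl b n).t M = tensOp n N (diagAction n N M) := by
  rw [WeylSystem.t_apply, diagAction_apply, map_sum]
  rfl

theorem tensorWeyl_act (hb : TraceOrthonormal b) (ξ : sl N) :
    (tensorWeyl b n).act ξ = slAction ξ := by
  rw [hb.slAction_eq, WeylSystem.act, tensorWeyl_t]
  rfl

theorem isInvariant_iff (hb : TraceOrthonormal b) {f : TensorFun n N} :
    (tensorWeyl b n).IsInvariant f ↔ f ∈ invariants n N := by
  rw [mem_invariants]
  refine forall_congr' fun ξ => ?_
  rw [tensorWeyl_act hb]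
  rfl

/-- An operator that commutes with `𝔰𝔩_N`, restricted to `V_N`. -/
def restrictInvariants (hb : TraceOrthonormal b) (g : Module.End ℂ (TensorFun n N))
    (hg : ∀ ξ, (tensorWeyl b n).act ξ * g = g * (tensorWeyl b n).act ξ) :
    Module.End ℂ (invariants n N) :=
  LinearMap.restrict g fun f hf => by
    rw [mem_invariants] at hf ⊢
    intro ξ
    rw [← tensorWeyl_act hb]
    refine (LinearMap.congr_fun (hg ξ) f).trans ?_
    rw [tensorWeyl_act hb]
    exact (congrArg g (hf ξ)).trans (map_zero g)

/-- The generators of the Cherednik algebra acting on `V_N`. -/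
def cherednikGenAction (hb : TraceOrthonormal b) (n : ℕ) :
    CherednikGen n → Module.End ℂ (invariants n N)
  | .x i => restrictInvariants hb ((tensorWeyl b n).x i) fun ξ => WeylSystem.act_x _ hb ξ i
  | .y i => restrictInvariants hb ((tensorWeyl b n).y i) fun ξ => WeylSystem.act_y _ hb ξ i
  | .s σ => restrictInvariants hb ((tensorWeyl b n).s σ) fun ξ => WeylSystem.act_s _ ξ σ

/-- Only the relations `sum_x` and `sum_y` use invariance; the others are identities between
operators on all tensor-valued functions. -/
theorem cherednikGenAction_rel (hb : TraceOrthonormal b) (hN : 0 < N)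
    ⦃u v : FreeAlgebra ℂ (CherednikGen n)⦄ (h : CherednikRel n ((N : ℂ) / n) u v) :
    FreeAlgebra.lift ℂ (cherednikGenAction hb n) u =
      FreeAlgebra.lift ℂ (cherednikGenAction hb n) v := by
  refine LinearMap.ext fun f => Subtype.ext ?_
  have hf := (isInvariant_iff hb).mpr f.2
  induction h with
  | s_one =>
    simp only [FreeAlgebra.lift_ι_apply, map_one]
    exact LinearMap.congr_fun ((tensorWeyl b n).s.map_one) _
  | s_mul σ τ =>
    simp only [FreeAlgebra.lift_ι_apply, map_mul]
    exact LinearMap.congr_fun ((tensorWeyl b n).s.map_mul σ τ) _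
  | s_x σ i =>
    simp only [FreeAlgebra.lift_ι_apply, map_mul]
    exact LinearMap.congr_fun ((tensorWeyl b n).s_x σ i) _
  | s_y σ i =>
    simp only [FreeAlgebra.lift_ι_apply, map_mul]
    exact LinearMap.congr_fun ((tensorWeyl b n).s_y σ i) _
  | sum_x =>
    simp only [FreeAlgebra.lift_ι_apply, map_sum, map_zero]
    rw [LinearMap.sum_apply, Submodule.coe_sum]
    exact hf.sum_x_smul
  | sum_y =>
    simp only [FreeAlgebra.lift_ι_apply, map_sum, map_zero]
    rw [LinearMap.sum_apply, Submodule.coe_sum]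
    exact hf.sum_y_smul
  | x_comm i j =>
    simp only [FreeAlgebra.lift_ι_apply, map_mul]
    exact LinearMap.congr_fun ((tensorWeyl b n).x_comm i j) _
  | y_comm i j =>
    simp only [FreeAlgebra.lift_ι_apply, map_mul]
    exact LinearMap.congr_fun ((tensorWeyl b n).y_comm i j) _
  | x_y i j hij =>
    simp only [FreeAlgebra.lift_ι_apply, map_mul, map_sub, map_smul, AlgHom.commutes]
    exact LinearMap.congr_fun ((tensorWeyl b n).x_y hb hij hN) _

/-- The homomorphism `ζ_N`. -/
def zeta (hb : TraceOrthonormal b) (hN : 0 < N) (n : ℕ) :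
    Cherednik n ((N : ℂ) / n) →ₐ[ℂ] Module.End ℂ (invariants n N) :=
  RingQuot.liftAlgHom ℂ ⟨FreeAlgebra.lift ℂ (cherednikGenAction hb n),
    cherednikGenAction_rel hb hN⟩

theorem zeta_mk (hb : TraceOrthonormal b) (hN : 0 < N) (g : CherednikGen n) :
    zeta hb hN n (Cherednik.mk (FreeAlgebra.ι ℂ g)) = cherednikGenAction hb n g := by
  refine (RingQuot.liftAlgHom_mkAlgHom_apply ℂ _ _ _).trans ?_
  exact FreeAlgebra.lift_ι_apply _ _

theorem zeta_x (hb : TraceOrthonormal b) (hN : 0 < N) (i : Fin n) (f : invariants n N) :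
    (zeta hb hN n (Cherednik.x i) f : TensorFun n N) = (tensorWeyl b n).x i f := by
  rw [Cherednik.x, zeta_mk]; rfl

theorem zeta_y (hb : TraceOrthonormal b) (hN : 0 < N) (i : Fin n) (f : invariants n N) :
    (zeta hb hN n (Cherednik.y i) f : TensorFun n N) = (tensorWeyl b n).y i f := by
  rw [Cherednik.y, zeta_mk]; rfl

theorem zeta_s (hb : TraceOrthonormal b) (hN : 0 < N) (σ : Equiv.Perm (Fin n))
    (f : invariants n N) :
    (zeta hb hN n (Cherednik.s σ) f : TensorFun n N) = tensOp n N (permFactors σ) f := by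
  rw [Cherednik.s, zeta_mk]; rfl

/-! ### Values of the operators -/

theorem evalAt_tmul (A : sl N) (g : PolyFun N) (u : TensorPow n N) :
    evalAt A (g ⊗ₜ u) = polyEval A g • u := by
  simp [evalAt]

theorem evalAt_tensOp (A : sl N) (g : Module.End ℂ (TensorPow n N)) (f : TensorFun n N) :
    evalAt A (tensOp n N g f) = g (evalAt A f) := by
  have : evalAt A ∘ₗ tensOp n N g = g ∘ₗ evalAt A := TensorProduct.ext' fun x u => by
    simp [evalAt_tmul]
  exact LinearMap.congr_fun this f

theorem evalAt_mulCoord (A : sl N) (p : ι) (f : TensorFun n N) :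
    evalAt A (mulCoord b n p f) = b.repr A p • evalAt A f := by
  have : evalAt A ∘ₗ mulCoord b n p = b.repr A p • evalAt (n := n) A :=
    TensorProduct.ext' fun x u => by
      simp [evalAt_tmul, mulCoord, coordFun, polyEval, mul_smul]
  exact LinearMap.congr_fun this f

theorem evalAt_x (A : sl N) (i : Fin n) (f : TensorFun n N) :
    evalAt A ((tensorWeyl b n).x i f) = atFactor i (A : Mat N) (evalAt A f) := by
  have h : (tensorWeyl b n).x i f = ∑ p, mulCoord b n p (tensOp n N (atFactor i (b p : Mat N)) f) :=
    LinearMap.sum_apply _ _ _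
  rw [h, map_sum]
  simp only [evalAt_mulCoord, evalAt_tensOp]
  have hA : (A : Mat N) = ∑ p, b.repr A p • (b p : Mat N) := by
    conv_lhs => rw [← b.sum_repr A, sl_coe_sum]
    rfl
  rw [hA, ← atFactorHom_apply, map_sum, LinearMap.sum_apply]
  refine Finset.sum_congr rfl fun p _ => ?_
  rw [map_smul]
  rfl

theorem tensorWeyl_y_apply (i : Fin n) (f : TensorFun n N) :
    (tensorWeyl b n).y i f = ((N : ℂ) / n) •
      ∑ p, tensOp n N (atFactor i (b p : Mat N)) (partialDer b n p f) := by
  have h : (tensorWeyl b n).y₀ i f = ∑ p, (partialDer b n p * tensOp n N (atFactor i (b p : Mat N))) f :=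
    LinearMap.sum_apply _ _ _
  rw [WeylSystem.y]
  refine (congrArg (((N : ℂ) / n) • ·) h).trans ?_
  simp only [← tensOp_mul_partialDer]
  rfl

theorem evalAt_y (A : sl N) (i : Fin n) (f : TensorFun n N) :
    evalAt A ((tensorWeyl b n).y i f) = ((N : ℂ) / n) •
      ∑ p, atFactor i (b p : Mat N) (evalAt A (tensorDeriv (b p) f)) := by
  rw [tensorWeyl_y_apply, map_smul, map_sum]
  simp only [evalAt_tensOp]
  rfl

end KZB
end

noncomputable section

namespace KZB

/-! ### Antisymmetrizers -/

section Antisymmetrizer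

variable {n : ℕ} {T : Type*} [AddCommGroup T] [Module ℂ T]
  (ρ : Representation ℂ (Equiv.Perm (Fin n)) T)

/-- The permutations supported in `J`. -/
def supportedPerms (J : Finset (Fin n)) : Finset (Equiv.Perm (Fin n)) :=
  Finset.univ.filter fun σ => ∀ x, x ∉ J → σ x = x

theorem mem_supportedPerms {J : Finset (Fin n)} {σ : Equiv.Perm (Fin n)} :
    σ ∈ supportedPerms J ↔ ∀ x, x ∉ J → σ x = x := by simp [supportedPerms]

/-- The antisymmetrizer over the permutations supported in `J`. -/
def alt (J : Finset (Fin n)) : Module.End ℂ T :=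
  ∑ σ ∈ supportedPerms J, ((Equiv.Perm.sign σ : ℤ) : ℂ) • ρ σ

theorem alt_empty : alt ρ ∅ = 1 := by
  have : supportedPerms (∅ : Finset (Fin n)) = {1} := by
    ext σ
    simp [mem_supportedPerms, Equiv.Perm.ext_iff]
  simp [alt, this]

theorem swap_mem_supportedPerms {J : Finset (Fin n)} {i j : Fin n} (hi : i ∈ J) (hj : j ∈ J) :
    Equiv.swap i j ∈ supportedPerms J := by
  rw [mem_supportedPerms]
  intro x hx
  exact Equiv.swap_apply_of_ne_of_ne (by rintro rfl; exact hx hi) (by rintro rfl; exact hx hj)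

theorem mul_mem_supportedPerms {J : Finset (Fin n)} {σ τ : Equiv.Perm (Fin n)}
    (hσ : σ ∈ supportedPerms J) (hτ : τ ∈ supportedPerms J) : σ * τ ∈ supportedPerms J := by
  rw [mem_supportedPerms] at *
  intro x hx
  rw [Equiv.Perm.mul_apply, hτ x hx, hσ x hx]

theorem alt_mul_swap {J : Finset (Fin n)} {i j : Fin n} (hi : i ∈ J) (hj : j ∈ J) (hij : i ≠ j) :
    alt ρ J * ρ (Equiv.swap i j) = -alt ρ J := by
  rw [alt, Finset.sum_mul, ← Finset.sum_neg_distrib]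
  refine Finset.sum_bij' (fun σ _ => σ * Equiv.swap i j) (fun σ _ => σ * Equiv.swap i j)
    (fun σ h => mul_mem_supportedPerms h (swap_mem_supportedPerms hi hj))
    (fun σ h => mul_mem_supportedPerms h (swap_mem_supportedPerms hi hj))
    (fun σ _ => by simp [mul_assoc]) (fun σ _ => by simp [mul_assoc]) fun σ _ => ?_
  simp [Equiv.Perm.sign_mul, Equiv.Perm.sign_swap hij]

theorem swap_mul_alt {J : Finset (Fin n)} {i j : Fin n} (hi : i ∈ J) (hj : j ∈ J) (hij : i ≠ j) :
    ρ (Equiv.swap i j) * alt ρ J = -alt ρ J := by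
  rw [alt, Finset.mul_sum, ← Finset.sum_neg_distrib]
  refine Finset.sum_bij' (fun σ _ => Equiv.swap i j * σ) (fun σ _ => Equiv.swap i j * σ)
    (fun σ h => mul_mem_supportedPerms (swap_mem_supportedPerms hi hj) h)
    (fun σ h => mul_mem_supportedPerms (swap_mem_supportedPerms hi hj) h)
    (fun σ _ => by simp) (fun σ _ => by simp) fun σ _ => ?_
  simp [Equiv.Perm.sign_mul, Equiv.Perm.sign_swap hij]

theorem swap_mul_alt_of_notMem {J : Finset (Fin n)} {i j : Fin n} (hi : i ∉ J) (hj : j ∉ J) :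
    ρ (Equiv.swap i j) * alt ρ J = alt ρ J * ρ (Equiv.swap i j) := by
  rw [alt, Finset.mul_sum, Finset.sum_mul]
  refine Finset.sum_congr rfl fun σ hσ => ?_
  rw [mem_supportedPerms] at hσ
  rw [mul_smul_comm, smul_mul_assoc, ← map_mul, ← map_mul]
  congr 2
  rw [Equiv.mul_swap_eq_swap_mul, hσ i hi, hσ j hj]

/-- Coset decomposition: a permutation σ supported in J ∪ {j} is uniquely τ (i j) with i = σ⁻¹ j and
τ supported in J. The coset i = j gives the term 1, and the others carry the sign -1. -/
theorem alt_insert {J : Finset (Fin n)} {j : Fin n} (hj : j ∉ J) :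
    alt ρ (insert j J) = alt ρ J * (1 - ∑ i ∈ J, ρ (Equiv.swap i j)) := by
  have h1 : alt ρ (insert j J) = ∑ x ∈ insert j J ×ˢ supportedPerms J,
      ((Equiv.Perm.sign (x.2 * Equiv.swap x.1 j) : ℤ) : ℂ) • ρ (x.2 * Equiv.swap x.1 j) := by
    refine Finset.sum_bij' (fun σ _ => (σ⁻¹ j, σ * Equiv.swap (σ⁻¹ j) j))
      (fun x _ => x.2 * Equiv.swap x.1 j) ?_ ?_ ?_ ?_ ?_
    · intro σ hσ
      rw [mem_supportedPerms] at hσ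
      have h1 : σ⁻¹ j ∈ insert j J := by
        by_contra h
        have := hσ _ h
        rw [show σ (σ⁻¹ j) = j from σ.apply_symm_apply j] at this
        rw [← this] at h
        exact h (Finset.mem_insert_self _ _)
      refine Finset.mem_product.mpr ⟨h1, ?_⟩
      rw [mem_supportedPerms]
      intro x hx
      rw [Equiv.Perm.mul_apply]
      by_cases hxj : x = j
      · subst hxj; simp
      · have hx' : x ∉ insert j J := by simp [hxj, hx]
        rw [Equiv.swap_apply_of_ne_of_ne (fun h => hx' (by rw [h]; exact h1)) hxj]
        exact hσ x hx'
    · intro x hx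
      obtain ⟨h1, h2⟩ := Finset.mem_product.mp hx
      refine mul_mem_supportedPerms ?_ (swap_mem_supportedPerms h1 (Finset.mem_insert_self _ _))
      rw [mem_supportedPerms] at h2 ⊢
      exact fun y hy => h2 y fun h => hy (Finset.mem_insert_of_mem h)
    · intro σ _
      simp [mul_assoc]
    · intro x hx
      obtain ⟨h1, h2⟩ := Finset.mem_product.mp hx
      rw [mem_supportedPerms] at h2
      have h3 : x.2⁻¹ j = j := by rw [Equiv.Perm.inv_eq_iff_eq, h2 j hj]
      have h4 : (x.2 * Equiv.swap x.1 j)⁻¹ j = x.1 := by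
        rw [mul_inv_rev, Equiv.Perm.mul_apply, h3, Equiv.swap_inv, Equiv.swap_apply_right]
      ext1
      · exact h4
      · simp only [h4]; simp [mul_assoc]
    · intro σ _
      simp [mul_assoc]
  rw [h1, Finset.sum_product, Finset.sum_insert hj]
  simp only [Equiv.swap_self, ← Equiv.Perm.one_def, mul_one]
  rw [mul_sub, mul_one, sub_eq_add_neg, Finset.mul_sum, ← Finset.sum_neg_distrib]
  congr 1
  refine Finset.sum_congr rfl fun i hi => ?_
  have hij : i ≠ j := by rintro rfl; exact hj hi
  rw [alt, Finset.sum_mul, ← Finset.sum_neg_distrib]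
  refine Finset.sum_congr rfl fun σ _ => ?_
  simp [Equiv.Perm.sign_mul, Equiv.Perm.sign_swap hij]

/-- The sums of transpositions `∑_{i ∈ S, i ≠ j} s_{ij}` act on `u` by the scalar `m - N`. -/
def JucysMurphy (N m : ℕ) (S : Finset (Fin n)) (u : T) : Prop :=
  ∀ j ∈ S, ∑ i ∈ S.erase j, ρ (Equiv.swap i j) u = ((m : ℂ) - N) • u

variable {ρ} {N m : ℕ} {S : Finset (Fin n)} {u : T}

/-- Let r be the size of J and expand by `alt_insert`. For fixed j in J, the swaps with S \ J are
all swaps of the hypothesis, worth m - N, minus those inside J, each worth -1 after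
antisymmetrization. The scalar is Nm - r - r(m - N + r - 1) = (N - r)(m + r). -/
theorem JucysMurphy.sum_alt_insert (h : JucysMurphy ρ N m S u) (hS : S.card = N * m)
    {J : Finset (Fin n)} (hJ : J ⊆ S) :
    ∑ i ∈ S \ J, alt ρ (insert i J) u =
      (((N : ℂ) - J.card) * (m + J.card)) • alt ρ J u := by
  have h1 : ∀ i ∈ S \ J, alt ρ (insert i J) u =
      alt ρ J u - ∑ j ∈ J, alt ρ J (ρ (Equiv.swap i j) u) := by
    intro i hi
    rw [alt_insert ρ (Finset.mem_sdiff.mp hi).2]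
    simp [LinearMap.sum_apply, Equiv.swap_comm i]
  have h2 : ∀ j ∈ J, ∑ i ∈ S \ J, alt ρ J (ρ (Equiv.swap i j) u) =
      ((m : ℂ) - N + (J.card - 1)) • alt ρ J u := by
    intro j hj
    have e1 : S.erase j = (S \ J) ∪ J.erase j := by
      ext x
      simp only [Finset.mem_erase, Finset.mem_union, Finset.mem_sdiff]
      constructor
      · rintro ⟨hx, hxS⟩
        by_cases hxJ : x ∈ J
        · exact Or.inr ⟨hx, hxJ⟩
        · exact Or.inl ⟨hxS, hxJ⟩
      · rintro (⟨hxS, hxJ⟩ | ⟨hx, hxJ⟩)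
        · exact ⟨fun h => hxJ (h ▸ hj), hxS⟩
        · exact ⟨hx, hJ hxJ⟩
    have e2 : Disjoint (S \ J) (J.erase j) :=
      Finset.disjoint_left.mpr fun x hx hx' =>
        (Finset.mem_sdiff.mp hx).2 (Finset.mem_of_mem_erase hx')
    have e3 := congrArg (alt ρ J) (h j (hJ hj))
    rw [e1, Finset.sum_union e2, map_add, map_sum, map_sum, map_smul] at e3
    have e4 : ∑ i ∈ J.erase j, alt ρ J (ρ (Equiv.swap i j) u) =
        -((J.card : ℂ) - 1) • alt ρ J u := by
      have : ∀ i ∈ J.erase j, alt ρ J (ρ (Equiv.swap i j) u) = -alt ρ J u := by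
        intro i hi
        exact LinearMap.congr_fun (alt_mul_swap ρ (Finset.mem_of_mem_erase hi) hj
          (Finset.ne_of_mem_erase hi)) u
      rw [Finset.sum_congr rfl this, Finset.sum_const, Finset.card_erase_of_mem hj,
        ← Nat.cast_smul_eq_nsmul ℂ, Nat.cast_sub (Finset.card_pos.mpr ⟨j, hj⟩)]
      push_cast
      module
    rw [e4] at e3
    rw [eq_sub_of_add_eq e3]
    module
  rw [Finset.sum_congr rfl h1, Finset.sum_sub_distrib, Finset.sum_comm, Finset.sum_congr rfl h2,
    Finset.sum_const, Finset.sum_const, Finset.card_sdiff_of_subset hJ, hS,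
    ← Nat.cast_smul_eq_nsmul ℂ, ← Nat.cast_smul_eq_nsmul ℂ,
    Nat.cast_sub (hS ▸ Finset.card_le_card hJ), smul_smul, ← sub_smul]
  congr 1
  push_cast
  ring

/-- Grow J one position at a time: while r < N the scalar (N - r)(m + r) is nonzero, so some
enlargement does not kill u. -/
theorem JucysMurphy.exists_alt_ne_zero (h : JucysMurphy ρ N m S u) (hS : S.card = N * m)
    (hm : 0 < m) (hu : u ≠ 0) (r : ℕ) (hr : r ≤ N) :
    ∃ J ⊆ S, J.card = r ∧ alt ρ J u ≠ 0 := by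
  induction r with
  | zero => exact ⟨∅, Finset.empty_subset _, rfl, by simpa [alt_empty] using hu⟩
  | succ r ih =>
    obtain ⟨J, hJ, hJr, hne⟩ := ih (by omega)
    by_contra! hcon
    have h0 := h.sum_alt_insert hS hJ
    rw [Finset.sum_eq_zero] at h0
    · have hc : (((N : ℂ) - J.card) * (m + J.card)) ≠ 0 := by
        rw [hJr]
        refine mul_ne_zero (sub_ne_zero.mpr ?_) ?_
        · exact_mod_cast (by omega : N ≠ r)
        · exact_mod_cast (by omega : m + r ≠ 0)
      exact (smul_ne_zero hc hne) h0.symm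
    · intro i hi
      obtain ⟨hiS, hiJ⟩ := Finset.mem_sdiff.mp hi
      exact hcon _ (Finset.insert_subset hiS hJ) (by rw [Finset.card_insert_of_notMem hiJ, hJr])

/-- Removing a full column I lowers m by one. For j outside I, swaps away from I commute with the
antisymmetrizer. The swaps of j with I contribute exactly 1, because antisymmetrizing over the N + 1
positions I ∪ {j} gives zero. -/
theorem JucysMurphy.alt (h : JucysMurphy ρ N (m + 1) S u)
    (hvan : ∀ J : Finset (Fin n), N < J.card → alt ρ J = 0) {I : Finset (Fin n)} (hI : I ⊆ S)
    (hIN : I.card = N) : JucysMurphy ρ N m (S \ I) (alt ρ I u) := by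
  intro j hj
  obtain ⟨hjS, hjI⟩ := Finset.mem_sdiff.mp hj
  have e1 : ∑ i ∈ (S \ I).erase j, ρ (Equiv.swap i j) (KZB.alt ρ I u) =
      ∑ i ∈ (S \ I).erase j, KZB.alt ρ I (ρ (Equiv.swap i j) u) := by
    refine Finset.sum_congr rfl fun i hi => ?_
    exact LinearMap.congr_fun (swap_mul_alt_of_notMem ρ
      (Finset.mem_sdiff.mp (Finset.mem_of_mem_erase hi)).2 hjI) u
  have e2 : S.erase j = (S \ I).erase j ∪ I := by
    ext x
    simp only [Finset.mem_erase, Finset.mem_union, Finset.mem_sdiff]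
    constructor
    · rintro ⟨hx, hxS⟩
      by_cases hxI : x ∈ I
      · exact Or.inr hxI
      · exact Or.inl ⟨hx, hxS, hxI⟩
    · rintro (⟨hx, hxS, _⟩ | hxI)
      · exact ⟨hx, hxS⟩
      · exact ⟨fun h => hjI (h ▸ hxI), hI hxI⟩
  have e3 : Disjoint ((S \ I).erase j) I :=
    Finset.disjoint_left.mpr fun x hx hx' =>
      (Finset.mem_sdiff.mp (Finset.mem_of_mem_erase hx)).2 hx'
  have e4 := congrArg (KZB.alt ρ I) (h j hjS)
  rw [e2, Finset.sum_union e3, map_add, map_sum, map_sum, map_smul] at e4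
  have e5 : ∑ i ∈ I, KZB.alt ρ I (ρ (Equiv.swap i j) u) = KZB.alt ρ I u := by
    have := hvan (insert j I) (by rw [Finset.card_insert_of_notMem hjI]; omega)
    rw [alt_insert ρ hjI] at this
    have := LinearMap.congr_fun this u
    simp only [Module.End.mul_apply, LinearMap.sub_apply, Module.End.one_apply,
      LinearMap.sum_apply, map_sub, map_sum, LinearMap.zero_apply] at this
    exact (sub_eq_zero.mp this).symm
  rw [e5] at e4
  rw [e1, eq_sub_of_add_eq e4]
  push_cast
  module

theorem alt_apply_mem {U : Submodule ℂ T} (hU : ∀ σ, ∀ v ∈ U, ρ σ v ∈ U) (J : Finset (Fin n))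
    {v : T} (hv : v ∈ U) : alt ρ J v ∈ U := by
  rw [alt, LinearMap.sum_apply]
  exact Submodule.sum_mem _ fun σ _ => Submodule.smul_mem _ _ (hU σ v hv)

/-- Columns are split off one by one, χ recording the column of each position. The last clause, that
antisymmetry outside S persists, protects columns already antisymmetrized during later steps. -/
theorem JucysMurphy.exists_antisymmetric
    (hvan : ∀ J : Finset (Fin n), N < J.card → KZB.alt ρ J = 0) {U : Submodule ℂ T}
    (hU : ∀ σ, ∀ v ∈ U, ρ σ v ∈ U) (m : ℕ) :
    ∀ (S : Finset (Fin n)) (u : T), S.card = N * m → u ∈ U → u ≠ 0 → JucysMurphy ρ N m S u →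
      ∃ (χ : Fin n → ℕ) (y : T), y ∈ U ∧ y ≠ 0 ∧ (∀ i ∈ S, χ i < m) ∧
        (∀ c < m, (S.filter (χ · = c)).card = N) ∧
        (∀ i ∈ S, ∀ j ∈ S, i ≠ j → χ i = χ j → ρ (Equiv.swap i j) y = -y) ∧
        (∀ i ∉ S, ∀ j ∉ S, ρ (Equiv.swap i j) u = -u → ρ (Equiv.swap i j) y = -y) := by
  induction m with
  | zero =>
    intro S u hS huU hu _
    have hS : S = ∅ := by simpa using hS
    subst hS
    exact ⟨fun _ => 0, u, huU, hu, by simp, by simp, by simp, fun _ _ _ _ h => h⟩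
  | succ m ih =>
    intro S u hS huU hu hJM
    obtain ⟨I, hIS, hIN, hne⟩ := hJM.exists_alt_ne_zero hS (Nat.succ_pos m) hu N le_rfl
    obtain ⟨χ, y, hyU, hy, hχ, hcard, h1, h2⟩ := ih (S \ I) (KZB.alt ρ I u)
      (by rw [Finset.card_sdiff_of_subset hIS, hS, hIN]; rw [Nat.mul_succ]; omega)
      (alt_apply_mem hU I huU) hne (hJM.alt hvan hIS hIN)
    have hlt : ∀ i ∈ S, i ∉ I → χ i < m := fun i hi hiI => hχ i (Finset.mem_sdiff.mpr ⟨hi, hiI⟩)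
    refine ⟨fun i => if i ∈ I then m else χ i, y, hyU, hy, ?_, ?_, ?_, ?_⟩
    · intro i hi
      beta_reduce
      split_ifs with h
      · omega
      · have := hlt i hi h; omega
    · intro c hc
      rcases Nat.lt_succ_iff_lt_or_eq.mp hc with hc | rfl
      · rw [← hcard c hc]
        congr 1
        ext i
        simp only [Finset.mem_filter, Finset.mem_sdiff]
        constructor
        · rintro ⟨hi, h⟩
          split_ifs at h with hiI
          · omega
          · exact ⟨⟨hi, hiI⟩, h⟩
        · rintro ⟨⟨hi, hiI⟩, h⟩
          exact ⟨hi, by rw [if_neg hiI]; exact h⟩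
      · rw [← hIN]
        congr 1
        ext i
        simp only [Finset.mem_filter]
        constructor
        · rintro ⟨hi, h⟩
          by_contra hiI
          rw [if_neg hiI] at h
          have := hlt i hi hiI
          omega
        · intro hi
          exact ⟨hIS hi, if_pos hi⟩
    · intro i hi j hj hij h
      by_cases hiI : i ∈ I <;> by_cases hjI : j ∈ I
      · refine h2 i (fun h => (Finset.mem_sdiff.mp h).2 hiI) j
          (fun h => (Finset.mem_sdiff.mp h).2 hjI) ?_
        exact LinearMap.congr_fun (swap_mul_alt ρ hiI hjI hij) u
      · have := hlt j hj hjI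
        simp only [if_pos hiI, if_neg hjI] at h; omega
      · have := hlt i hi hiI
        simp only [if_neg hiI, if_pos hjI] at h; omega
      · simp only [if_neg hiI, if_neg hjI] at h
        exact h1 i (Finset.mem_sdiff.mpr ⟨hi, hiI⟩) j (Finset.mem_sdiff.mpr ⟨hj, hjI⟩) hij h
    · intro i hi j hj h
      refine h2 i (fun h => hi (Finset.mem_sdiff.mp h).1) j
        (fun h => hj (Finset.mem_sdiff.mp h).1) ?_
      have := LinearMap.congr_fun (swap_mul_alt_of_notMem ρ (fun h => hi (hIS h))
        (fun h => hj (hIS h)) : ρ (Equiv.swap i j) * KZB.alt ρ I = _) u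
      rw [Module.End.mul_apply, Module.End.mul_apply, h, map_neg] at this
      exact this

end Antisymmetrizer

end KZB
end

noncomputable section

namespace KZB

/-! ### Invariant tensors -/

section Generic

variable {V : Type*} [AddCommGroup V] [Module ℂ V]

theorem eq_zero_of_eq_neg {v : V} (h : v = -v) : v = 0 := by
  have : (2 : ℂ) • v = 0 := by
    rw [two_smul]
    nth_rewrite 1 [h]
    exact neg_add_cancel v
  simpa using this

theorem smul_eq_neg_neg_smul (c : ℂ) (v : V) : c • v = -(-c • v) := by module

theorem neg_sub_smul_neg (c : ℂ) (v w : V) : -v - c • -w = -(v - c • w) := by module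

/-- Maschke: average an arbitrary linear projection over the group. -/
theorem exists_equivariant_projection {G : Type*} [Group G] [Fintype G] (ρ : Representation ℂ G V)
    (U : Submodule ℂ V) (hU : ∀ σ, ∀ u ∈ U, ρ σ u ∈ U) :
    ∃ P : V →ₗ[ℂ] V, (∀ u, P u ∈ U) ∧ (∀ u ∈ U, P u = u) ∧ ∀ σ u, P (ρ σ u) = ρ σ (P u) := by
  obtain ⟨p, hp⟩ := LinearMap.exists_leftInverse_of_injective U.subtype (Submodule.ker_subtype U)
  let Q : V →ₗ[ℂ] V := U.subtype ∘ₗ p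
  have hQ : ∀ u, Q u ∈ U := fun u => (p u).2
  have hQ' : ∀ u ∈ U, Q u = u := fun u hu => congrArg Subtype.val (LinearMap.congr_fun hp ⟨u, hu⟩)
  let S : V →ₗ[ℂ] V := ∑ σ : G, ρ σ ∘ₗ Q ∘ₗ ρ σ⁻¹
  have hS : ∀ u, S u = ∑ σ : G, ρ σ (Q (ρ σ⁻¹ u)) :=
    fun u => by simp only [S, LinearMap.sum_apply]; rfl
  have hcancel : ∀ σ u, ρ σ (ρ σ⁻¹ u) = u := fun σ u => by
    rw [← Module.End.mul_apply, ← map_mul, mul_inv_cancel, map_one, Module.End.one_apply]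
  refine ⟨((Fintype.card G : ℂ)⁻¹) • S, fun u => ?_, fun u hu => ?_, fun τ u => ?_⟩
  · rw [LinearMap.smul_apply, hS]
    exact Submodule.smul_mem _ _ (Submodule.sum_mem _ fun σ _ => hU _ _ (hQ _))
  · rw [LinearMap.smul_apply, hS, Finset.sum_congr rfl fun σ _ => by
      rw [hQ' _ (hU _ _ hu), hcancel], Finset.sum_const, Finset.card_univ,
      ← Nat.cast_smul_eq_nsmul ℂ, smul_smul, inv_mul_cancel₀, one_smul]
    exact_mod_cast Fintype.card_ne_zero
  · rw [LinearMap.smul_apply, LinearMap.smul_apply, map_smul, hS, hS, map_sum,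
      ← Equiv.sum_comp (Equiv.mulLeft τ)]
    congr 1
    refine Finset.sum_congr rfl fun σ _ => ?_
    simp only [Equiv.coe_mulLeft, map_mul, mul_inv_rev, Module.End.mul_apply]
    congr 3
    have := hcancel τ⁻¹ u
    rw [inv_inv] at this
    rw [this]

end Generic

section InvariantTensors

variable {n N m : ℕ}

theorem wordBasis_repr_permFactors (σ : Equiv.Perm (Fin n)) (u : TensorPow n N)
    (w : Fin n → Fin N) :
    (wordBasis n N).repr (permFactors σ u) w = (wordBasis n N).repr u (w ∘ σ) := by
  have : (Finsupp.lapply w ∘ₗ (wordBasis n N).repr.toLinearMap) ∘ₗ permFactors σ =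
      Finsupp.lapply (w ∘ σ) ∘ₗ (wordBasis n N).repr.toLinearMap :=
    tensorPow_hom_ext fun v => by
      simp only [LinearMap.comp_apply, permFactors_tprod, LinearEquiv.coe_coe,
        Finsupp.lapply_apply, wordBasis_repr_tprod, Function.comp_apply]
      rw [← Equiv.prod_comp σ]
      simp
  exact LinearMap.congr_fun this u

theorem wordBasis_repr_atFactor (i : Fin n) (M : Mat N) (u : TensorPow n N) (w : Fin n → Fin N) :
    (wordBasis n N).repr (atFactor i M u) w =
      ∑ c, M (w i) c * (wordBasis n N).repr u (Function.update w i c) := by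
  have : (Finsupp.lapply w ∘ₗ (wordBasis n N).repr.toLinearMap) ∘ₗ atFactor i M =
      ∑ c, M (w i) c • (Finsupp.lapply (Function.update w i c) ∘ₗ
        (wordBasis n N).repr.toLinearMap) :=
    tensorPow_hom_ext fun v => by
      simp only [LinearMap.comp_apply, atFactor_tprod, LinearEquiv.coe_coe, LinearMap.sum_apply,
        LinearMap.smul_apply, Finsupp.lapply_apply, wordBasis_repr_tprod, smul_eq_mul]
      have h : ∀ (g : Fin n → ℂ), ∏ j, g j = g i * ∏ j ∈ Finset.univ.erase i, g j :=
        fun g => (Finset.mul_prod_erase _ _ (Finset.mem_univ i)).symm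
      rw [h, Function.update_self, Matrix.mulVec, dotProduct, Finset.sum_mul]
      refine Finset.sum_congr rfl fun c _ => ?_
      rw [h, Function.update_self, mul_assoc]
      congr 2
      refine Finset.prod_congr rfl fun j hj => ?_
      rw [Function.update_of_ne (Finset.ne_of_mem_erase hj),
        Function.update_of_ne (Finset.ne_of_mem_erase hj)]
  have h := LinearMap.congr_fun this u
  simpa [LinearMap.sum_apply] using h

variable (n N) in
/-- The `𝔰𝔩_N`-invariant tensors. -/
def tensorInv : Submodule ℂ (TensorPow n N) := ⨅ ξ : sl N, LinearMap.ker (diagAction n N ξ)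

theorem mem_tensorInv {u : TensorPow n N} :
    u ∈ tensorInv n N ↔ ∀ ξ : sl N, diagAction n N ξ u = 0 := by
  simp [tensorInv]

theorem permFactors_mem_tensorInv (σ : Equiv.Perm (Fin n)) {u : TensorPow n N}
    (hu : u ∈ tensorInv n N) : permFactors σ u ∈ tensorInv n N := by
  rw [mem_tensorInv] at *
  intro ξ
  rw [permFactors_commute_diagAction_apply, hu, map_zero]

theorem diagAction_tensorInv (hN : 0 < N) (hn : n = N * m) {u : TensorPow n N}
    (hu : u ∈ tensorInv n N) (M : Mat N) :
    diagAction n N M u = ((m : ℂ) * Matrix.trace M) • u := by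
  obtain ⟨A, hA⟩ := exists_sl_add_smul_one M
  have hN' : (N : ℂ) ≠ 0 := by exact_mod_cast hN.ne'
  conv_lhs => rw [hA]
  rw [map_add, map_smul, diagAction_one, LinearMap.add_apply, mem_tensorInv.mp hu A, zero_add,
    LinearMap.smul_apply, LinearMap.smul_apply, Module.End.one_apply, smul_smul]
  have hn' : (n : ℂ) = N * m := by exact_mod_cast hn
  have hc : Matrix.trace M / N * n = m * Matrix.trace M := by
    rw [hn']
    field_simp
  rw [hc]

/-- Write s_ij as ∑ (E_cd)_j (E_dc)_i and sum over i ≠ j. The sum of the (E_dc)_i is the diagonal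
action, equal to m tr(E_dc) on u, minus (E_dc)_j. The first part gives m, and the second gives N
since ∑ E_cd E_dc = N. -/
theorem jucysMurphy_tensorInv (hN : 0 < N) (hn : n = N * m) {u : TensorPow n N}
    (hu : u ∈ tensorInv n N) : JucysMurphy (permRep n N) N m Finset.univ u := by
  intro j _
  have h1 : ∀ i ∈ Finset.univ.erase j, permRep n N (Equiv.swap i j) u =
      ∑ c, ∑ d, atFactor j (Matrix.single c d 1) (atFactor i (Matrix.single d c 1) u) := by
    intro i hi
    rw [Equiv.swap_comm, permRep_apply,
      ← sum_atFactor_single_mul (Finset.ne_of_mem_erase hi).symm]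
    simp only [LinearMap.sum_apply]
    rfl
  have h2 : ∀ M : Mat N, ∑ i ∈ Finset.univ.erase j, atFactor i M u =
      ((m : ℂ) * Matrix.trace M) • u - atFactor j M u := by
    intro M
    rw [← diagAction_tensorInv hN hn hu, diagAction_apply, LinearMap.sum_apply,
      ← Finset.add_sum_erase _ _ (Finset.mem_univ j), add_sub_cancel_left]
  rw [Finset.sum_congr rfl h1, Finset.sum_comm]
  have h3 : ∀ c, ∑ i ∈ Finset.univ.erase j, ∑ d,
      atFactor j (Matrix.single c d 1) (atFactor i (Matrix.single d c 1) u) =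
      (m : ℂ) • atFactor j (Matrix.single c c 1) u -
        (N : ℂ) • atFactor j (Matrix.single c c 1) u := by
    intro c
    rw [Finset.sum_comm]
    simp only [← map_sum, h2, map_sub]
    rw [Finset.sum_sub_distrib, Finset.sum_eq_single c]
    · congr 1
      · simp
      · have : ∀ d, atFactor j (Matrix.single c d 1) (atFactor j (Matrix.single d c 1) u) =
            atFactor j (Matrix.single c c 1) u := by
          intro d
          rw [← Module.End.mul_apply, ← atFactor_mul]
          simp
        simp only [this, Finset.sum_const, Finset.card_univ, Fintype.card_fin,
          ← Nat.cast_smul_eq_nsmul ℂ]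
    · intro d _ hd
      rw [Matrix.trace_single_eq_of_ne _ _ _ hd]
      simp
    · simp
  have h4 : ∑ c, atFactor j (Matrix.single c c (1 : ℂ)) u = u := by
    rw [← LinearMap.sum_apply]
    simp only [← atFactorHom_apply]
    rw [← map_sum, Matrix.sum_single_one, map_one]
    rfl
  rw [Finset.sum_congr rfl fun c _ => h3 c, Finset.sum_sub_distrib, ← Finset.smul_sum,
    ← Finset.smul_sum, h4, sub_smul]

/-- Pigeonhole: every word repeats a letter within J, and swapping the two positions fixes the word
but reverses the sign. -/
theorem alt_permRep_eq_zero (J : Finset (Fin n)) (hJ : N < J.card) : alt (permRep n N) J = 0 := by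
  refine (wordBasis n N).ext fun w => ?_
  obtain ⟨i, hi, j, hj, hij, hw⟩ := Finset.exists_ne_map_eq_of_card_lt_of_maps_to
    (s := J) (t := (Finset.univ : Finset (Fin N))) (f := w) (by simpa using hJ) (by simp)
  have h1 : permFactors (Equiv.swap i j) (wordBasis n N w) = wordBasis n N w := by
    rw [permFactors_wordBasis]
    congr 1
    ext k : 1
    rw [Equiv.swap_inv]
    by_cases hki : k = i
    · subst hki; simp [hw]
    · by_cases hkj : k = j
      · subst hkj; simp [hw]
      · rw [Equiv.swap_apply_of_ne_of_ne hki hkj]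
  have h2 := LinearMap.congr_fun (alt_mul_swap (permRep n N) hi hj hij) (wordBasis n N w)
  rw [Module.End.mul_apply, permRep_apply, h1] at h2
  exact eq_zero_of_eq_neg h2

/-! The positions are arranged in a rectangle with `N` rows and `m` columns. -/

variable (e : Fin N × Fin m ≃ Fin n)

/-- The word whose letters are the row indices. -/
def rowWord (i : Fin n) : Fin N := (e.symm i).1

/-- Antisymmetry in each column. -/
def ColAntisymm (y : TensorPow n N) : Prop :=
  ∀ i j, i ≠ j → (e.symm i).2 = (e.symm j).2 → permFactors (Equiv.swap i j) y = -y

variable {e}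

theorem ColAntisymm.repr_swap {y : TensorPow n N} (hy : ColAntisymm e y) {i j : Fin n}
    (hij : i ≠ j) (h : (e.symm i).2 = (e.symm j).2) (w : Fin n → Fin N) :
    (wordBasis n N).repr y (w ∘ Equiv.swap i j) = -(wordBasis n N).repr y w := by
  rw [← wordBasis_repr_permFactors, hy i j hij h, map_neg]
  rfl

theorem ColAntisymm.repr_eq_zero {y : TensorPow n N} (hy : ColAntisymm e y) {i j : Fin n}
    (hij : i ≠ j) (h : (e.symm i).2 = (e.symm j).2) {w : Fin n → Fin N} (hw : w i = w j) :
    (wordBasis n N).repr y w = 0 := by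
  have h1 := hy.repr_swap hij h w
  have h2 : w ∘ Equiv.swap i j = w := by
    ext k : 1
    rw [Function.comp_apply]
    by_cases hki : k = i
    · subst hki; simp [hw]
    · by_cases hkj : k = j
      · subst hkj; simp [hw]
      · rw [Equiv.swap_apply_of_ne_of_ne hki hkj]
  rw [h2] at h1
  exact self_eq_neg.mp h1

/-- Induction on the number of misplaced letters. If a letter repeats in the column of a misplaced
position i, the coefficient is zero. Otherwise the letter wanted at i sits elsewhere in that column,
and a swap puts it in place at the cost of a sign. -/
theorem ColAntisymm.eq_zero {y : TensorPow n N} (hy : ColAntisymm e y)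
    (h0 : (wordBasis n N).repr y (rowWord e) = 0) : y = 0 := by
  have key : ∀ (d : ℕ) (w : Fin n → Fin N),
      (Finset.univ.filter fun i => w i ≠ rowWord e i).card = d →
        (wordBasis n N).repr y w = 0 := by
    intro d
    induction d using Nat.strong_induction_on with
    | _ d ih =>
      intro w hd
      by_cases hw : w = rowWord e
      · rw [hw, h0]
      obtain ⟨i, hi⟩ := Function.ne_iff.mp hw
      by_cases hinj : Function.Injective fun r => w (e (r, (e.symm i).2))
      · obtain ⟨r, hr⟩ := (Finite.injective_iff_surjective.mp hinj) (rowWord e i)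
        set j := e (r, (e.symm i).2) with hj
        have hr' : w j = rowWord e i := hr
        have hij : i ≠ j := by
          intro h
          rw [← h] at hr'
          exact hi hr'
        have hcol : (e.symm i).2 = (e.symm j).2 := by simp [hj]
        have hrow : rowWord e i ≠ rowWord e j := by
          intro h
          exact hij (e.symm.injective (Prod.ext h hcol))
        have h1 := hy.repr_swap hij hcol w
        rw [ih _ _ (w ∘ Equiv.swap i j) rfl] at h1
        · exact neg_eq_zero.mp h1.symm
        · rw [← hd]
          refine Finset.card_lt_card ?_
          rw [Finset.ssubset_iff_of_subset]
          · refine ⟨i, by simpa using hi, ?_⟩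
            simp [hr']
          · intro k hk
            simp only [Finset.mem_filter, Finset.mem_univ, true_and, Function.comp_apply] at hk ⊢
            by_cases hki : k = i
            · rw [hki]; exact hi
            · by_cases hkj : k = j
              · rw [hkj, hr']; exact hrow
              · rwa [Equiv.swap_apply_of_ne_of_ne hki hkj] at hk
      · rw [Function.not_injective_iff] at hinj
        obtain ⟨r, s, hrs, hne⟩ := hinj
        exact hy.repr_eq_zero (i := e (r, (e.symm i).2)) (j := e (s, (e.symm i).2))
          (by simpa using hne) (by simp) hrs
  refine (wordBasis n N).ext_elem fun w => ?_
  rw [key _ w rfl, map_zero]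
  rfl

/-! ### The product of column determinants and irreducibility of the invariant tensors -/

variable (e)

/-- The permutations preserving the columns. -/
def colPerms : Finset (Equiv.Perm (Fin n)) :=
  Finset.univ.filter fun σ => ∀ i, (e.symm (σ i)).2 = (e.symm i).2

/-- The product of the determinants over the columns. -/
def colVector : TensorPow n N :=
  ∑ σ ∈ colPerms e, ((Equiv.Perm.sign σ : ℤ) : ℂ) • permFactors σ (wordBasis n N (rowWord e))

theorem colAntisymm_colVector : ColAntisymm e (colVector e) := by
  intro i j hij h
  have hs : ∀ σ ∈ colPerms e, Equiv.swap i j * σ ∈ colPerms e := by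
    intro σ hσ
    simp only [colPerms, Finset.mem_filter, Finset.mem_univ, true_and] at hσ ⊢
    intro k
    rw [Equiv.Perm.mul_apply, ← hσ k]
    generalize σ k = l
    by_cases hli : l = i
    · subst hli; simp [h]
    · by_cases hlj : l = j
      · subst hlj; simp [h]
      · rw [Equiv.swap_apply_of_ne_of_ne hli hlj]
  rw [colVector, map_sum, ← Finset.sum_neg_distrib]
  refine Finset.sum_bij' (fun σ _ => Equiv.swap i j * σ) (fun σ _ => Equiv.swap i j * σ)
    hs hs (fun σ _ => by simp) (fun σ _ => by simp) fun σ _ => ?_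
  have hs : ((Equiv.Perm.sign (Equiv.swap i j * σ) : ℤ) : ℂ) = -((Equiv.Perm.sign σ : ℤ) : ℂ) := by
    simp [Equiv.Perm.sign_mul, Equiv.Perm.sign_swap hij]
  rw [map_smul, permFactors_mul, hs]
  exact smul_eq_neg_neg_smul (V := TensorPow n N) _ _

theorem eq_one_of_mem_colPerms {σ : Equiv.Perm (Fin n)} (hσ : σ ∈ colPerms e)
    (h : ∀ i, rowWord e (σ i) = rowWord e i) : σ = 1 := by
  simp only [colPerms, Finset.mem_filter, Finset.mem_univ, true_and] at hσ
  ext1 i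
  exact e.symm.injective (Prod.ext (h i) (hσ i))

theorem colVector_repr_rowWord : (wordBasis n N).repr (colVector e) (rowWord e) = 1 := by
  rw [colVector, map_sum, Finsupp.finsetSum_apply, Finset.sum_eq_single 1]
  · simp [permFactors_one]
  · intro σ hσ hne
    rw [map_smul, Finsupp.smul_apply, wordBasis_repr_permFactors, Module.Basis.repr_self,
      Finsupp.single_eq_of_ne, smul_zero]
    intro h
    exact hne (eq_one_of_mem_colPerms e hσ fun i => congrFun h i)
  · intro h
    exact absurd (by simp [colPerms]) h

theorem colVector_ne_zero : colVector e ≠ 0 := by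
  intro h
  have := colVector_repr_rowWord e
  rw [h, map_zero] at this
  exact zero_ne_one this

theorem ColAntisymm.eq_smul {y : TensorPow n N} (hy : ColAntisymm e y) :
    y = (wordBasis n N).repr y (rowWord e) • colVector e := by
  rw [← sub_eq_zero]
  refine ColAntisymm.eq_zero (e := e) (fun i j hij h => ?_) ?_
  · rw [map_sub, map_smul, hy i j hij h, colAntisymm_colVector e i j hij h]
    exact neg_sub_smul_neg (V := TensorPow n N) _ _ _
  · rw [map_sub, map_smul, Finsupp.sub_apply, Finsupp.smul_apply, colVector_repr_rowWord]
    simp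

/-- The image under ξ is still column antisymmetric, so one coefficient decides. An off-diagonal
entry of ξ would need a word with a repeated letter in a column; the diagonal entries add up to m tr
ξ = 0. -/
theorem colVector_mem_tensorInv : colVector e ∈ tensorInv n N := by
  rw [mem_tensorInv]
  intro ξ
  refine ColAntisymm.eq_zero (e := e) (fun i j hij h => ?_) ?_
  · rw [← permFactors_commute_diagAction_apply, colAntisymm_colVector e i j hij h, map_neg]
  · rw [diagAction_apply, LinearMap.sum_apply, map_sum, Finsupp.finsetSum_apply]
    have h : ∀ i, (wordBasis n N).repr (atFactor i (ξ : Mat N) (colVector e)) (rowWord e) =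
        (ξ : Mat N) (rowWord e i) (rowWord e i) := by
      intro i
      rw [wordBasis_repr_atFactor, Finset.sum_eq_single (rowWord e i)]
      · rw [Function.update_eq_self, colVector_repr_rowWord, mul_one]
      · intro c _ hc
        rw [(colAntisymm_colVector e).repr_eq_zero (i := i) (j := e (c, (e.symm i).2)), mul_zero]
        · intro h
          refine hc ?_
          rw [h]
          simp [rowWord]
        · simp
        · rw [Function.update_self, Function.update_of_ne]
          · simp [rowWord]
          · intro h
            refine hc ?_
            rw [← h]
            simp [rowWord]
      · simp
    rw [Finset.sum_congr rfl fun i _ => h i, ← Equiv.sum_comp e, Fintype.sum_prod_type]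
    have ht : ∑ c, (ξ : Mat N) c c = 0 := sl_trace_eq_zero ξ
    simp only [rowWord, Equiv.symm_apply_apply, Finset.sum_const, ← Finset.smul_sum, ht, smul_zero]

theorem colVector_mem_of_ne_bot (hN : 0 < N) {U : Submodule ℂ (TensorPow n N)}
    (hU : ∀ σ, ∀ u ∈ U, permFactors σ u ∈ U) (hUT : U ≤ tensorInv n N) (hne : U ≠ ⊥) :
    colVector e ∈ U := by
  have hn : n = N * m := by simpa using (Fintype.card_congr e).symm
  obtain ⟨u, huU, hu⟩ := Submodule.exists_mem_ne_zero_of_ne_bot hne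
  obtain ⟨χ, y, hyU, hy, hχ, hcard, h1, -⟩ := JucysMurphy.exists_antisymmetric
    (ρ := permRep n N) alt_permRep_eq_zero hU m Finset.univ u (by simp [hn]) huU hu
    (jucysMurphy_tensorInv hN hn (hUT huU))
  let χ' : Fin n → Fin m := fun i => ⟨χ i, hχ i (Finset.mem_univ i)⟩
  have hfib : ∀ c : Fin m, Nonempty (Fin N ≃ {i // χ' i = c}) := by
    intro c
    refine ⟨(Fintype.equivFinOfCardEq ?_).symm⟩
    rw [Fintype.card_subtype, ← hcard c c.2]
    congr 1
    ext i
    simp [χ', Fin.ext_iff]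
  let F := fun c => Classical.choice (hfib c)
  -- A permutation carrying column c of the tableau onto the fibre of χ over c; both have N
  -- elements.
  let σ : Equiv.Perm (Fin n) := e.symm.trans ((Equiv.prodComm _ _).trans
    ((Equiv.sigmaEquivProd _ _).symm.trans ((Equiv.sigmaCongrRight F).trans
      (Equiv.sigmaFiberEquiv χ'))))
  have hσ : ∀ i, χ' (σ i) = (e.symm i).2 := fun i => (F (e.symm i).2 (e.symm i).1).2
  have hy' : ColAntisymm e (permFactors σ⁻¹ y) := by
    intro i j hij h
    have h2 : χ (σ i) = χ (σ j) := by
      have := (hσ i).trans (h.trans (hσ j).symm)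
      exact congrArg Fin.val this
    have h3 := h1 (σ i) (Finset.mem_univ _) (σ j) (Finset.mem_univ _) (σ.injective.ne hij) h2
    rw [← map_neg, ← h3, permRep_apply, ← Module.End.mul_apply, ← Module.End.mul_apply,
      ← permFactors_mul, ← permFactors_mul]
    congr 2
    rw [Equiv.mul_swap_eq_swap_mul]
    simp
  have hy'U : permFactors σ⁻¹ y ∈ U := hU _ _ hyU
  have hc : (wordBasis n N).repr (permFactors σ⁻¹ y) (rowWord e) ≠ 0 := by
    intro h
    have h0 := hy'.eq_zero h
    have : permFactors σ (permFactors σ⁻¹ y) = y := by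
      rw [← Module.End.mul_apply, ← permFactors_mul, mul_inv_cancel, permFactors_one]
      rfl
    rw [h0, map_zero] at this
    exact hy this.symm
  rw [hy'.eq_smul] at hy'U
  exact (Submodule.smul_mem_iff _ hc).mp hy'U

/-- The invariant tensors form an irreducible representation of the symmetric group. -/
theorem eq_tensorInv_of_ne_bot (e : Fin N × Fin m ≃ Fin n) (hN : 0 < N)
    {U : Submodule ℂ (TensorPow n N)}
    (hU : ∀ σ, ∀ u ∈ U, permFactors σ u ∈ U) (hUT : U ≤ tensorInv n N) (hne : U ≠ ⊥) :
    U = tensorInv n N := by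
  obtain ⟨P, hPU, hP, hPσ⟩ := exists_equivariant_projection (permRep n N) U hU
  refine le_antisymm hUT fun u hu => ?_
  by_contra huU
  -- If U were proper, its stable complement in the invariants would be nonzero, so it too would
  -- contain `colVector e`. But P fixes that vector, which lies in U.
  have hK : colVector e ∈ LinearMap.ker P ⊓ tensorInv n N := by
    refine colVector_mem_of_ne_bot e hN ?_ inf_le_right ?_
    · rintro σ v ⟨hv1, hv2⟩
      refine ⟨?_, permFactors_mem_tensorInv σ hv2⟩
      exact (hPσ σ v).trans ((congrArg _ hv1).trans (map_zero _))
    · intro h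
      have hmem : u - P u ∈ LinearMap.ker P ⊓ tensorInv n N := by
        refine ⟨?_, Submodule.sub_mem _ hu (hUT (hPU u))⟩
        change P (u - P u) = 0
        rw [map_sub, hP _ (hPU u), sub_self]
      rw [h, Submodule.mem_bot, sub_eq_zero] at hmem
      exact huU (hmem ▸ hPU u)
  have h1 : P (colVector e) = 0 := hK.1
  rw [hP _ (colVector_mem_of_ne_bot e hN hU hUT hne)] at h1
  exact colVector_ne_zero e h1

end InvariantTensors

end KZB
end

noncomputable section

namespace KZB

/-! ### Positivity of the Casimir operator -/

attribute [local instance 100] LieRing.ofAssociativeRing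

open scoped ComplexOrder ComplexConjugate

variable {n N : ℕ}

/-- The Hermitian form on tensors for which the standard basis is orthonormal. -/
def wordForm (u v : TensorPow n N) : ℂ :=
  ∑ w, conj ((wordBasis n N).repr u w) * (wordBasis n N).repr v w

/-- The Hermitian form as a linear map in the second argument. -/
def wordFormHom (u : TensorPow n N) : TensorPow n N →ₗ[ℂ] ℂ :=
  ∑ w, conj ((wordBasis n N).repr u w) •
    (Finsupp.lapply w ∘ₗ (wordBasis n N).repr.toLinearMap)

theorem wordFormHom_apply (u v : TensorPow n N) : wordFormHom u v = wordForm u v := by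
  simp [wordFormHom, wordForm, LinearMap.sum_apply]

theorem wordForm_self_nonneg (u : TensorPow n N) : 0 ≤ wordForm u u :=
  Finset.sum_nonneg fun _ _ => star_mul_self_nonneg _

theorem wordForm_self_eq_zero {u : TensorPow n N} (h : wordForm u u = 0) : u = 0 := by
  replace h := (Finset.sum_eq_zero_iff_of_nonneg
    fun w _ => star_mul_self_nonneg ((wordBasis n N).repr u w)).mp h
  refine (wordBasis n N).repr.injective (Finsupp.ext fun w => ?_)
  have := h w (Finset.mem_univ w)
  rw [map_zero, Finsupp.zero_apply]
  simpa using this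

theorem wordForm_atFactor (i : Fin n) (M : Mat N) (u v : TensorPow n N) :
    wordForm (atFactor i M u) v = wordForm u (atFactor i M.conjTranspose v) := by
  simp only [wordForm, wordBasis_repr_atFactor, map_sum, map_mul, Finset.sum_mul, Finset.mul_sum,
    Matrix.conjTranspose_apply]
  rw [← Finset.sum_product', ← Finset.sum_product']
  -- The involution exchanges the letter at position i of the word with the free summation index.
  refine Finset.sum_bij' (fun p _ => (Function.update p.1 i p.2, p.1 i))
    (fun p _ => (Function.update p.1 i p.2, p.1 i)) (fun _ _ => by simp) (fun _ _ => by simp)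
    (fun p _ => by simp) (fun p _ => by simp) fun p _ => ?_
  simp only [Function.update_self, Function.update_idem, Function.update_eq_self]
  rw [starRingEnd_apply, starRingEnd_apply]
  ring

theorem wordForm_diagAction (M : Mat N) (u v : TensorPow n N) :
    wordForm u (diagAction n N M v) = wordForm (diagAction n N M.conjTranspose u) v := by
  have h : ∀ u v : TensorPow n N, wordForm v u = conj (wordForm u v) := fun u v => by
    simp only [wordForm, map_sum, map_mul, Complex.conj_conj]
    exact Finset.sum_congr rfl fun w _ => mul_comm _ _
  rw [← wordFormHom_apply, diagAction_apply, LinearMap.sum_apply, map_sum, diagAction_apply,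
    LinearMap.sum_apply, h v, ← wordFormHom_apply, map_sum, map_sum]
  refine Finset.sum_congr rfl fun i _ => ?_
  rw [wordFormHom_apply, wordFormHom_apply, ← h, wordForm_atFactor,
    Matrix.conjTranspose_conjTranspose]

variable {ι : Type*} [Fintype ι] [DecidableEq ι] {b : Module.Basis ι ℂ (sl N)}

variable (b) in
/-- The Casimir operator on tensors. -/
def casimirOp (n : ℕ) : Module.End ℂ (TensorPow n N) :=
  ∑ p, diagAction n N (b p : Mat N) * diagAction n N (b p : Mat N)

omit [DecidableEq ι] in
theorem casimirOp_apply (u : TensorPow n N) :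
    casimirOp b n u = ∑ p, diagAction n N (b p : Mat N) (diagAction n N (b p : Mat N) u) :=
  LinearMap.sum_apply _ _ _

/-- The projection of matrices onto traceless matrices. -/
def tracelessPart (N : ℕ) : Mat N →ₗ[ℂ] Mat N :=
  LinearMap.id - (1 / (N : ℂ)) • (Matrix.traceLinearMap (Fin N) ℂ ℂ).smulRight 1

theorem tracelessPart_apply (M : Mat N) :
    tracelessPart N M = M - (1 / (N : ℂ)) • Matrix.trace M • 1 := by
  simp [tracelessPart]

theorem tracelessPart_conjTranspose (M : Mat N) :
    (tracelessPart N M).conjTranspose = tracelessPart N M.conjTranspose := by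
  simp [tracelessPart_apply, Matrix.conjTranspose_sub, Matrix.conjTranspose_smul,
    Matrix.trace_conjTranspose]

/-- Orthonormality is for a complex bilinear form, so the b_p need not be Hermitian. Rewriting the
Casimir operator through the traceless parts of matrix units, where E_ac and E_ca are adjoint to
each other, exhibits it as a sum of T* T. -/
theorem wordForm_casimirOp_nonneg (hb : TraceOrthonormal b) (hN : 0 < N) (u : TensorPow n N) :
    0 ≤ wordForm u (casimirOp b n u) := by
  have hN' : (N : ℂ) ≠ 0 := by exact_mod_cast hN.ne'
  let Φ : Mat N →ₗ[ℂ] Mat N →ₗ[ℂ] ℂ := LinearMap.mk₂ ℂ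
    (fun A B => wordFormHom u (diagAction n N (tracelessPart N A)
      (diagAction n N (tracelessPart N B) u)))
    (fun A A' B => by rw [map_add, map_add, LinearMap.add_apply, map_add])
    (fun c A B => by rw [map_smul, map_smul, LinearMap.smul_apply, map_smul])
    (fun A B B' => by rw [map_add, map_add, LinearMap.add_apply, map_add, map_add])
    (fun c A B => by rw [map_smul, map_smul, LinearMap.smul_apply, map_smul, map_smul])
  have hΦ : ∀ A B, Φ A B = wordFormHom u (diagAction n N (tracelessPart N A)
      (diagAction n N (tracelessPart N B) u)) := fun A B => rfl
  have h1 : ∀ B : sl N, tracelessPart N (B : Mat N) = B := fun B => by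
    rw [tracelessPart_apply, sl_trace_eq_zero, zero_smul, smul_zero, sub_zero]
  have h2 : tracelessPart N (1 : Mat N) = 0 := by
    rw [tracelessPart_apply, Matrix.trace_one, Fintype.card_fin, smul_smul,
      one_div_mul_cancel hN', one_smul, sub_self]
  have h3 : wordForm u (casimirOp b n u) = ∑ p, Φ (b p) (b p) := by
    rw [← wordFormHom_apply, casimirOp_apply, map_sum]
    refine Finset.sum_congr rfl fun p _ => ?_
    rw [hΦ, h1]
  -- The form Φ was built from traceless parts so that the correction term Φ 1 1 vanishes.
  rw [h3, hb.sum_bilin, hΦ, h2, map_zero, LinearMap.zero_apply, map_zero, smul_zero, sub_zero]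
  refine Finset.sum_nonneg fun a _ => Finset.sum_nonneg fun c _ => ?_
  rw [hΦ, wordFormHom_apply, wordForm_diagAction, tracelessPart_conjTranspose,
    Matrix.conjTranspose_single, star_one]
  exact wordForm_self_nonneg _

theorem eq_zero_of_add_casimirOp (hb : TraceOrthonormal b) (hN : 0 < N) {d c : ℂ} (hd : 0 < d)
    (hc : 0 ≤ c) {u : TensorPow n N} (hu : d • u + c • casimirOp b n u = 0) : u = 0 := by
  have h := congrArg (wordFormHom u) hu
  rw [map_add, map_smul, map_smul, map_zero, wordFormHom_apply, wordFormHom_apply, smul_eq_mul,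
    smul_eq_mul] at h
  have h1 := mul_nonneg hd.le (wordForm_self_nonneg u)
  have h2 := mul_nonneg hc (wordForm_casimirOp_nonneg hb hN u)
  have h3 := (add_eq_zero_iff_of_nonneg h1 h2).mp h
  exact wordForm_self_eq_zero ((mul_eq_zero.mp h3.1).resolve_left hd.ne')

/-! ### The Casimir operator on tensor-valued functions -/

variable (b) in
/-- The operator `d + c C` on tensors. -/
def shiftedCasimir (n : ℕ) (d c : ℂ) : Module.End ℂ (TensorPow n N) :=
  algebraMap ℂ _ d + c • casimirOp b n

theorem shiftedCasimir_injective (hb : TraceOrthonormal b) (hN : 0 < N) {d c : ℂ} (hd : 0 < d)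
    (hc : 0 ≤ c) : Function.Injective (shiftedCasimir b n d c) :=
  (injective_iff_map_eq_zero _).mpr fun _ hu => eq_zero_of_add_casimirOp hb hN hd hc hu

theorem tensOp_bijective {g : Module.End ℂ (TensorPow n N)} (hg : Function.Injective g) :
    Function.Bijective (tensOp n N g) := by
  have : Module.Finite ℂ (TensorPow n N) := Module.Finite.of_basis (wordBasis n N)
  exact ⟨Module.Flat.lTensor_preserves_injective_linearMap (M := PolyFun N) g hg,
    LinearMap.lTensor_surjective (PolyFun N) (LinearMap.surjective_of_injective hg)⟩

theorem tensOp_casimirOp : tensOp n N (casimirOp b n) = (tensorWeyl b n).cas := by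
  rw [casimirOp, map_sum, WeylSystem.cas]
  refine Finset.sum_congr rfl fun p _ => ?_
  rw [map_mul, tensorWeyl_t]

theorem tensOp_shiftedCasimir_apply (d c : ℂ) (f : TensorFun n N) :
    tensOp n N (shiftedCasimir b n d c) f = d • f + c • (tensorWeyl b n).cas f := by
  rw [shiftedCasimir, map_add, map_smul, AlgHom.commutes, tensOp_casimirOp]
  rfl

end KZB
end

noncomputable section

namespace KZB

/-! ### The grading by degree -/

attribute [local instance 100] LieRing.ofAssociativeRing

namespace WeylSystem

variable {n N : ℕ} {ι : Type*} [Fintype ι] [DecidableEq ι] {b : Module.Basis ι ℂ (sl N)}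
  {R : Type*} [Ring R] [Algebra ℂ R] (W : WeylSystem b n R)

theorem euler_X (p : ι) : W.euler * W.X p = W.X p * W.euler + W.X p := by
  have h : ∀ q, W.X q * W.D q * W.X p = W.X p * (W.X q * W.D q) +
      (if q = p then W.X q else 0) := by
    intro q
    rw [mul_assoc, W.D_X, mul_add, ← mul_assoc, W.X_comm, mul_assoc, mul_ite, mul_one, mul_zero]
  rw [euler, Finset.sum_mul, Finset.sum_congr rfl fun q _ => h q, Finset.sum_add_distrib,
    Finset.mul_sum]
  simp

theorem euler_D (p : ι) : W.euler * W.D p + W.D p = W.D p * W.euler := by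
  have h : ∀ q, W.D p * (W.X q * W.D q) = W.X q * W.D q * W.D p +
      (if p = q then W.D q else 0) := by
    intro q
    rw [← mul_assoc, W.D_X, add_mul, mul_assoc, W.D_comm, mul_assoc, ite_mul, one_mul, zero_mul]
  rw [euler, Finset.mul_sum, Finset.sum_congr rfl fun q _ => h q, Finset.sum_add_distrib,
    Finset.sum_mul]
  simp

theorem euler_commute_of_commute {z : R} (hX : ∀ p, z * W.X p = W.X p * z)
    (hD : ∀ p, z * W.D p = W.D p * z) : z * W.euler = W.euler * z := by
  simp only [euler, Finset.mul_sum, Finset.sum_mul]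
  refine Finset.sum_congr rfl fun p _ => ?_
  rw [← mul_assoc, hX, mul_assoc, hD, mul_assoc]

theorem euler_y (i : Fin n) : W.euler * W.y i + W.y i = W.y i * W.euler := by
  rw [y, mul_smul_comm, ← smul_add, smul_mul_assoc]
  congr 1
  simp only [y₀, Finset.mul_sum, Finset.sum_mul, ← Finset.sum_add_distrib]
  refine Finset.sum_congr rfl fun p _ => ?_
  rw [mul_assoc, W.euler_commute_of_commute (W.a_X _ _) (W.a_D _ _), ← mul_assoc, ← add_mul,
    W.euler_D, mul_assoc]

theorem act_euler (ξ : sl N) : W.act ξ * W.euler = W.euler * W.act ξ := by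
  have h : ∀ p q, W.X p * W.D q * W.euler = W.euler * (W.X p * W.D q) := by
    intro p q
    have h1 : W.euler * W.X p * W.D q = W.X p * (W.euler * W.D q + W.D q) := by
      rw [W.euler_X, add_mul, mul_add, mul_assoc]
    rw [← mul_assoc, h1, W.euler_D, mul_assoc]
  rw [act, add_mul, mul_add, W.euler_commute_of_commute (W.t_X _) (W.t_D _)]
  congr 1
  simp only [ad, Finset.mul_sum, Finset.sum_mul, smul_mul_assoc, mul_smul_comm, h]

theorem act_cas (hb : TraceOrthonormal b) (ξ : sl N) : W.act ξ * W.cas = W.cas * W.act ξ := by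
  rw [W.cas_eq hb, mul_add, add_mul, mul_smul_comm, smul_mul_assoc, mul_one, one_mul]
  simp only [Finset.mul_sum, Finset.sum_mul, W.act_s]

theorem euler_cas (hb : TraceOrthonormal b) : W.euler * W.cas = W.cas * W.euler := by
  rw [W.cas_eq hb, mul_add, add_mul, mul_smul_comm, smul_mul_assoc, mul_one, one_mul]
  simp only [Finset.mul_sum, Finset.sum_mul, W.euler_commute_of_commute (W.s_X _) (W.s_D _)]

end WeylSystem

section Grading

open Module.End

variable {n N : ℕ}

theorem derivation_leibniz_eigen {A : Type*} [CommRing A] [Algebra ℂ A] (E : Derivation ℂ A A)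
    {f g : A} {c d : ℂ} (hf : E f = c • f) (hg : E g = d • g) :
    E (f * g) = (c + d) • (f * g) := by
  rw [E.leibniz, hf, hg, smul_eq_mul, smul_eq_mul, mul_smul_comm, mul_smul_comm, mul_comm g f,
    add_smul, add_comm]

/-- Every polynomial function is a constant plus a sum of functions of positive degree. -/
theorem polyFun_grading (N : ℕ) : (Submodule.span ℂ {(1 : PolyFun N)}) ⊔
    ⨆ d : ℕ, eigenspace (eulerDer N : PolyFun N →ₗ[ℂ] PolyFun N) ((d : ℂ) + 1) = ⊤ := by
  set S := (Submodule.span ℂ {(1 : PolyFun N)}) ⊔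
    ⨆ d : ℕ, eigenspace (eulerDer N : PolyFun N →ₗ[ℂ] PolyFun N) ((d : ℂ) + 1) with hS
  have hpos : ∀ (d : ℕ) (f : PolyFun N), eulerDer N f = ((d : ℂ) + 1) • f → f ∈ S :=
    fun d f hf => le_sup_right (a := Submodule.span ℂ {(1 : PolyFun N)})
      (Submodule.mem_iSup_of_mem d (mem_eigenspace_iff.mpr hf))
  have h1 : (1 : PolyFun N) ∈ S := le_sup_left (a := Submodule.span ℂ {(1 : PolyFun N)})
    (Submodule.mem_span_singleton_self 1)
  have hind : ∀ (p : PolyFun N → Prop), p 1 → (∀ (d : ℕ) f, eulerDer N f = ((d : ℂ) + 1) • f → p f) →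
      (∀ f g, p f → p g → p (f + g)) → (∀ (c : ℂ) f, p f → p (c • f)) → ∀ f ∈ S, p f := by
    intro p hp1 hpd hadd hsmul f hf
    let Q : Submodule ℂ (PolyFun N) := 
      { carrier := {f | p f}
        add_mem' := fun {a b} ha hb => hadd a b ha hb
        zero_mem' := by simpa using hsmul 0 1 hp1
        smul_mem' := fun c a ha => hsmul c a ha }
    have : S ≤ Q := by
      refine sup_le ?_ (iSup_le fun d f hf => hpd d f (mem_eigenspace_iff.mp hf))
      rw [Submodule.span_singleton_le_iff_mem]
      exact hp1
    exact this hf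
  have hmul : ∀ f ∈ S, ∀ g ∈ S, f * g ∈ S := by
    intro f hf
    refine hind _ ?_ ?_ ?_ ?_
    · rwa [mul_one]
    · intro d g hg
      refine hind (fun f => f * g ∈ S) ?_ ?_ ?_ ?_ f hf
      · rw [one_mul]
        exact hpos d g hg
      · intro e f hf
        refine hpos (e + 1 + d) _ ?_
        rw [derivation_leibniz_eigen _ hf hg]
        push_cast
        congr 1
        ring
      · intro f f' hf hf'
        rw [add_mul]
        exact S.add_mem hf hf'
      · intro c f hf
        rw [smul_mul_assoc]
        exact S.smul_mem c hf
    · intro g g' hg hg'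
      rw [mul_add]
      exact S.add_mem hg hg'
    · intro c g hg
      rw [mul_smul_comm]
      exact S.smul_mem c hg
  refine eq_top_iff.mpr fun f _ => ?_
  induction f using SymmetricAlgebra.induction with
  | algebraMap r =>
    rw [Algebra.algebraMap_eq_smul_one]
    exact S.smul_mem r h1
  | ι φ => 
    refine hpos 0 _ ?_
    rw [eulerDer_ι]
    simp
  | mul f g hf hg => exact hmul f (hf trivial) g (hg trivial)
  | add f g hf hg => exact S.add_mem (hf trivial) (hg trivial)

/-- The constant functions. -/
def constFun (n N : ℕ) : TensorPow n N →ₗ[ℂ] TensorFun n N := TensorProduct.mk ℂ _ _ 1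

theorem constFun_apply (u : TensorPow n N) : constFun n N u = 1 ⊗ₜ u := rfl

theorem evalAt_constFun (A : sl N) (u : TensorPow n N) : evalAt A (constFun n N u) = u := by
  rw [constFun_apply, evalAt_tmul, map_one, one_smul]

theorem eulerOp_constFun (u : TensorPow n N) : eulerOp n N (constFun n N u) = 0 := by
  rw [constFun_apply, eulerOp, polyOp_tmul]
  simp

/-- Degree zero is entered as the constants, not as the kernel of the Euler operator;
`mem_range_of_grading` then deduces that the kernel consists of constants. -/
theorem tensorFun_grading (n N : ℕ) : LinearMap.range (constFun n N) ⊔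
    ⨆ d : ℕ, eigenspace (eulerOp n N) ((d : ℂ) + 1) = ⊤ := by
  refine eq_top_iff.mpr fun f _ => ?_
  induction f using TensorProduct.induction_on with
  | zero => exact zero_mem _
  | add f g hf hg => exact add_mem (hf trivial) (hg trivial)
  | tmul g u => 
    let T : PolyFun N →ₗ[ℂ] TensorFun n N := (TensorProduct.mk ℂ _ _).flip u
    have hle : ⊤ ≤ Submodule.comap T (LinearMap.range (constFun n N) ⊔
        ⨆ d : ℕ, eigenspace (eulerOp n N) ((d : ℂ) + 1)) := by
      rw [← polyFun_grading N]
      refine sup_le ?_ (iSup_le fun d f hf => ?_)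
      · rw [Submodule.span_singleton_le_iff_mem]
        exact Submodule.mem_sup_left ⟨u, rfl⟩
      · refine Submodule.mem_sup_right (Submodule.mem_iSup_of_mem d (mem_eigenspace_iff.mpr ?_))
        have : eulerDer N f = ((d : ℂ) + 1) • f := mem_eigenspace_iff.mp hf
        refine (polyOp_tmul _ f u).trans ?_
        change eulerDer N f ⊗ₜ u = _
        rw [this]
        rfl
    exact hle (x := g) trivial

/-! ### Eigencomponents of an operator with eigenvalues in ℕ -/

section Abstract

variable {V : Type*} [AddCommGroup V] [Module ℂ V] {E : V →ₗ[ℂ] V}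

/-- A submodule stable under an endomorphism contains the eigencomponents of its elements. -/
theorem eigencomponent_mem (P : Submodule ℂ V) (hP : ∀ f ∈ P, E f ∈ P) (s : Finset ℕ) :
    ∀ g : ℕ → V, (∀ d, E (g d) = (d : ℂ) • g d) → ∑ d ∈ s, g d ∈ P → ∀ d ∈ s, g d ∈ P := by
  induction s using Finset.induction_on with
  | empty => simp
  | insert a s ha ih =>
    intro g hg hs
    rw [Finset.sum_insert ha] at hs
    -- Applying E - a removes the component of degree a and multiplies the others by nonzero
    -- scalars.
    have h1 : ∑ d ∈ s, ((d : ℂ) - a) • g d ∈ P := by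
      have := P.sub_mem (hP _ hs) (P.smul_mem (a : ℂ) hs)
      rw [map_add, map_sum, Finset.sum_congr rfl fun d _ => hg d, hg a, smul_add,
        add_sub_add_left_eq_sub, Finset.smul_sum, ← Finset.sum_sub_distrib] at this
      simpa only [sub_smul] using this
    have h2 : ∀ d ∈ s, g d ∈ P := by
      intro d hd
      have hne : (d : ℂ) - a ≠ 0 := by
        rw [sub_ne_zero]
        exact_mod_cast ne_of_mem_of_not_mem hd ha
      refine (Submodule.smul_mem_iff P hne).mp
        (ih (fun d => ((d : ℂ) - a) • g d) (fun d => ?_) h1 d hd)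
      rw [map_smul, hg, smul_comm]
    have h3 : g a ∈ P := (P.add_mem_iff_left (P.sum_mem h2)).mp hs
    intro d hd
    rcases Finset.mem_insert.mp hd with rfl | hd
    · exact h3
    · exact h2 d hd

theorem exists_sum_of_grading {T : Type*} [AddCommGroup T] [Module ℂ T] {c : T →ₗ[ℂ] V}
    (hc : ∀ u, E (c u) = 0)
    (h : LinearMap.range c ⊔ ⨆ d : ℕ, eigenspace E ((d : ℂ) + 1) = ⊤) (f : V) :
    ∃ (s : Finset ℕ) (g : ℕ → V), f = ∑ d ∈ s, g d ∧ (∀ d, E (g d) = (d : ℂ) • g d) ∧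
      0 ∈ s ∧ g 0 ∈ LinearMap.range c := by
  have hf : f ∈ LinearMap.range c ⊔ ⨆ d : ℕ, eigenspace E ((d : ℂ) + 1) := by
    rw [h]; trivial
  obtain ⟨_, ⟨u, rfl⟩, v, hv, rfl⟩ := Submodule.mem_sup.mp hf
  obtain ⟨p, hp, rfl⟩ := (Submodule.mem_iSup_iff_exists_finsupp _ _).mp hv
  let g : ℕ → V := fun d => Nat.casesOn d (c u) p
  refine ⟨insert 0 (p.support.image Nat.succ), g, ?_, fun d => ?_, by simp, ⟨u, rfl⟩⟩
  · rw [Finset.sum_insert (by simp), Finset.sum_image (fun _ _ _ _ h => Nat.succ_injective h)]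
    rfl
  · cases d with
    | zero => simp [g, hc]
    | succ d =>
      have := mem_eigenspace_iff.mp (hp d)
      simpa [g] using this

theorem mem_range_of_grading {T : Type*} [AddCommGroup T] [Module ℂ T] {c : T →ₗ[ℂ] V}
    (hc : ∀ u, E (c u) = 0)
    (h : LinearMap.range c ⊔ ⨆ d : ℕ, eigenspace E ((d : ℂ) + 1) = ⊤) {f : V} (hf : E f = 0) :
    f ∈ LinearMap.range c := by
  obtain ⟨s, g, rfl, hg, -, h0⟩ := exists_sum_of_grading hc h f
  have hker := eigencomponent_mem (LinearMap.ker E)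
    (fun f hf => by rw [LinearMap.mem_ker.mp hf]; exact zero_mem _) s g hg hf
  refine Submodule.sum_mem _ fun d hd => ?_
  rcases Nat.eq_zero_or_pos d with rfl | hpos
  · exact h0
  · have h1 : (d : ℂ) • g d = 0 := (hg d).symm.trans (hker d hd)
    have h2 : (d : ℂ) ≠ 0 := by exact_mod_cast hpos.ne'
    rw [(smul_eq_zero.mp h1).resolve_left h2]
    exact zero_mem _

end Abstract

end Grading

end KZB
end

noncomputable section

namespace KZB

/-! ### Graded modules over the Cherednik algebra -/

namespace Cherednik

variable {n : ℕ} {k : ℂ}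

theorem mk_eq {u v : FreeAlgebra ℂ (CherednikGen n)} (h : CherednikRel n k u v) :
    (mk u : Cherednik n k) = mk v := RingQuot.mkAlgHom_rel ℂ h

theorem s_mul_x (σ : Equiv.Perm (Fin n)) (i : Fin n) :
    (s σ * x i : Cherednik n k) = x (σ i) * s σ := by
  simpa only [x, y, s, map_mul] using mk_eq (k := k) (.s_x σ i)

theorem sum_x : ∑ i, (x i : Cherednik n k) = 0 := by
  simpa only [x, y, s, map_sum, map_zero] using mk_eq (k := k) (.sum_x (n := n))

theorem sum_y : ∑ i, (y i : Cherednik n k) = 0 := by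
  simpa only [x, y, s, map_sum, map_zero] using mk_eq (k := k) (.sum_y (n := n))

theorem x_comm (i j : Fin n) : (x i * x j : Cherednik n k) = x j * x i := by
  simpa only [x, y, s, map_mul] using mk_eq (k := k) (.x_comm i j)

theorem x_y {i j : Fin n} (hij : i ≠ j) : (x i * y j - y j * x i : Cherednik n k) =
    algebraMap ℂ _ (1 / (n : ℂ)) - k • s (Equiv.swap i j) := by
  simpa only [x, y, s, map_mul, map_sub, map_smul, AlgHom.commutes] using mk_eq (k := k) (.x_y i j hij)

/-- The commutator of `x i` with `y j` lies in the group algebra. -/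
theorem x_y_self (j : Fin n) : (x j * y j - y j * x j : Cherednik n k) =
    -∑ i ∈ Finset.univ.erase j, (algebraMap ℂ _ (1 / (n : ℂ)) - k • s (Equiv.swap i j)) := by
  have h : ∑ i, (x i * y j - y j * x i : Cherednik n k) = 0 := by
    rw [Finset.sum_sub_distrib, ← Finset.sum_mul, ← Finset.mul_sum, sum_x, zero_mul, mul_zero,
      sub_zero]
  rw [← Finset.add_sum_erase _ _ (Finset.mem_univ j)] at h
  rw [eq_neg_of_add_eq_zero_left h]
  congr 1
  exact Finset.sum_congr rfl fun i hi => x_y (Finset.ne_of_mem_erase hi)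

theorem induction_on {p : Cherednik n k → Prop} (h : Cherednik n k)
    (hc : ∀ c : ℂ, p (algebraMap ℂ _ c)) (hx : ∀ i, p (x i)) (hy : ∀ i, p (y i))
    (hs : ∀ σ, p (s σ)) (hmul : ∀ a b, p a → p b → p (a * b))
    (hadd : ∀ a b, p a → p b → p (a + b)) : p h := by
  obtain ⟨u, rfl⟩ := RingQuot.mkAlgHom_surjective ℂ (CherednikRel n k) h
  change p (mk u)
  induction u using FreeAlgebra.induction with
  | grade0 c => rw [AlgHom.commutes]; exact hc c
  | grade1 g =>
    cases g with
    | x i => exact hx i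
    | y i => exact hy i
    | s σ => exact hs σ
  | mul a b ha hb => rw [map_mul]; exact hmul _ _ ha hb
  | add a b ha hb => rw [map_add]; exact hadd _ _ ha hb

variable (n k) in
/-- The grading element. -/
def eu : Cherednik n k := ∑ i, x i * y i - (k / 2) • ∑ i, ∑ j, s (Equiv.swap i j)

/-- Only transpositions moving j fail to commute with x_j, and each occurs for two ordered pairs,
whence the factor 2. -/
theorem sum_swap_mul_x (j : Fin n) :
    (∑ a, ∑ c, s (Equiv.swap a c)) * x j - x j * ∑ a, ∑ c, s (Equiv.swap a c) =
      (2 : ℂ) • ∑ i, (x i - x j) * (s (Equiv.swap i j) : Cherednik n k) := by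
  have h : ∀ a c : Fin n, (s (Equiv.swap a c) * x j - x j * s (Equiv.swap a c) : Cherednik n k) =
      (if a = j then (x c - x j) * s (Equiv.swap c j) else 0) +
      (if c = j then (x a - x j) * s (Equiv.swap a j) else 0) := by
    intro a c
    rw [s_mul_x, ← sub_mul]
    by_cases ha : a = j
    · subst ha
      rw [Equiv.swap_apply_left, if_pos rfl, Equiv.swap_comm a c]
      split_ifs with hc
      · subst hc; simp
      · rw [add_zero]
    · rw [if_neg ha, zero_add]
      split_ifs with hc
      · subst hc; rw [Equiv.swap_apply_right]
      · rw [Equiv.swap_apply_of_ne_of_ne (Ne.symm ha) (Ne.symm hc), sub_self, zero_mul]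
  simp only [Finset.sum_mul, Finset.mul_sum, ← Finset.sum_sub_distrib]
  rw [Finset.sum_congr rfl fun a _ => Finset.sum_congr rfl fun c _ => h a c]
  simp only [Finset.sum_add_distrib, Finset.sum_ite_eq', Finset.mem_univ, if_true]
  rw [Finset.sum_comm]
  simp only [Finset.sum_ite_eq', Finset.mem_univ, if_true]
  rw [two_smul]

theorem eu_mul_x (hn : 0 < n) (j : Fin n) : (eu n k * x j : Cherednik n k) = x j * eu n k + x j := by
  have hn' : (n : ℂ) ≠ 0 := by exact_mod_cast hn.ne'
  let C : Fin n → Cherednik n k := fun i => x j * y i - y i * x j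
  have hC0 : ∑ i, C i = 0 := by
    rw [Finset.sum_sub_distrib, ← Finset.sum_mul, ← Finset.mul_sum, sum_y, zero_mul, mul_zero,
      sub_zero]
  have h1 : (∑ i, x i * y i) * x j - x j * ∑ i, x i * y i =
      -∑ i, (x i - x j) * (algebraMap ℂ _ (1 / (n : ℂ)) - k • s (Equiv.swap i j) :
        Cherednik n k) := by
    -- As the C_i sum to zero, x_i may be replaced by x_i - x_j. This removes the term i = j, so
    -- only commutators of distinct indices remain.
    have h2 : (∑ i, x i * y i) * x j - x j * ∑ i, x i * y i = -∑ i, (x i - x j) * C i := by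
      have h : ∀ i, x i * y i * x j - x j * (x i * y i) = -(x i * C i) := fun i => by
        rw [← mul_assoc, x_comm j i, mul_assoc, mul_assoc, ← mul_sub, ← mul_neg, neg_sub]
      simp only [sub_mul, Finset.sum_sub_distrib, ← Finset.mul_sum, hC0, mul_zero, sub_zero]
      rw [Finset.sum_mul, Finset.mul_sum, ← Finset.sum_sub_distrib, ← Finset.sum_neg_distrib]
      exact Finset.sum_congr rfl fun i _ => h i
    rw [h2]
    congr 1
    refine Finset.sum_congr rfl fun i _ => ?_
    by_cases hij : i = j
    · subst hij; simp
    · rw [Equiv.swap_comm i j, ← x_y (Ne.symm hij)]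
  have h3 : ∑ i, (x i - x j : Cherednik n k) * algebraMap ℂ _ (1 / (n : ℂ)) = - x j := by
    rw [← Finset.sum_mul, Finset.sum_sub_distrib, sum_x, zero_sub, ← Algebra.commutes,
      ← Algebra.smul_def, Finset.sum_const, Finset.card_univ, Fintype.card_fin,
      ← Nat.cast_smul_eq_nsmul ℂ, smul_neg, smul_smul, one_div_mul_cancel hn', one_smul]
  have h4 : ∑ i, (x i - x j) * (algebraMap ℂ _ (1 / (n : ℂ)) - k • s (Equiv.swap i j)) =
      -x j - k • ∑ i, (x i - x j) * (s (Equiv.swap i j) : Cherednik n k) := by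
    simp only [mul_sub, Finset.sum_sub_distrib, h3, mul_smul_comm, ← Finset.smul_sum]
  have h5 := sum_swap_mul_x (k := k) j
  rw [h4] at h1
  rw [sub_eq_iff_eq_add] at h1 h5
  rw [eu, sub_mul, h1, smul_mul_assoc, h5, mul_sub, mul_smul_comm]
  module

end Cherednik

variable {n : ℕ} {k : ℂ} {V : Type*} [AddCommGroup V] [Module ℂ V] [Module (Cherednik n k) V]
  [IsScalarTower ℂ (Cherednik n k) V]

open Cherednik

variable (n k) in
/-- A module over the Cherednik algebra, graded by an Euler operator, without singular vectors
of positive degree, and generated by an irreducible representation of the symmetric group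
in degree zero. -/
structure IsLowestWeight (E : V →ₗ[ℂ] V) (κ : ℂ) : Prop where
  eu_smul : ∀ f : V, (eu n k) • f = E f + κ • f
  grading : ∀ f : V, ∃ (s : Finset ℕ) (g : ℕ → V),
    f = ∑ d ∈ s, g d ∧ ∀ d, E (g d) = (d : ℂ) • g d
  y_smul : ∀ (d : ℕ) (f : V), E f = ((d : ℂ) + 1) • f →
    ∀ i, E ((y i : Cherednik n k) • f) = (d : ℂ) • (y i : Cherednik n k) • f
  y_smul_zero : ∀ f : V, E f = 0 → ∀ i, (y i : Cherednik n k) • f = 0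
  singular : ∀ (d : ℕ) (f : V), E f = ((d : ℂ) + 1) • f →
    (∀ i, (y i : Cherednik n k) • f = 0) → f = 0
  generated : ∀ (d : ℕ) (f : V), E f = ((d : ℂ) + 1) • f →
    ∃ g : Fin n → V, (∀ i, E (g i) = (d : ℂ) • g i) ∧ f = ∑ i, (x i : Cherednik n k) • g i
  irreducible : ∀ U : Submodule ℂ V, (∀ σ, ∀ u ∈ U, (s σ : Cherednik n k) • u ∈ U) →
    U ≤ LinearMap.ker E → U ≠ ⊥ → U = LinearMap.ker E
  s_smul_ker : ∀ f : V, E f = 0 → ∀ σ, E ((s σ : Cherednik n k) • f) = 0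
  ker_ne_bot : LinearMap.ker E ≠ ⊥

namespace IsLowestWeight

variable {E : V →ₗ[ℂ] V} {κ : ℂ}

/-- A submodule is stable under E, hence graded. Since each y_i lowers degree, a nonzero homogeneous
vector of minimal degree is singular, so that degree is zero. Irreducibility then puts all of degree
zero in P, and degree zero generates V. -/
theorem eq_top_of_ne_bot (hE : IsLowestWeight n k E κ) {P : Submodule (Cherednik n k) V}
    (hP : P ≠ ⊥) : P = ⊤ := by
  let P' : Submodule ℂ V := P.restrictScalars ℂ
  have hPE : ∀ f ∈ P', E f ∈ P' := by
    intro f hf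
    have h := P'.sub_mem (P.smul_mem (eu n k) hf) (P'.smul_mem κ hf)
    rwa [hE.eu_smul, add_sub_cancel_right] at h
  have hex : ∃ d : ℕ, ∃ f ∈ P, f ≠ 0 ∧ E f = (d : ℂ) • f := by
    obtain ⟨f, hfP, hf⟩ := Submodule.exists_mem_ne_zero_of_ne_bot hP
    obtain ⟨s, g, rfl, hg⟩ := hE.grading f
    obtain ⟨d, hd, hd'⟩ := Finset.exists_ne_zero_of_sum_ne_zero hf
    exact ⟨d, g d, eigencomponent_mem P' hPE s g hg hfP d hd, hd', hg d⟩
  classical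
  obtain ⟨f, hfP, hf, hfd⟩ := Nat.find_spec hex
  have hzero : Nat.find hex = 0 := by
    by_contra hne
    obtain ⟨d, hd⟩ := Nat.exists_eq_succ_of_ne_zero hne
    rw [hd, Nat.cast_succ] at hfd
    refine hf (hE.singular d f hfd fun i => ?_)
    by_contra hyi
    exact Nat.find_min hex (m := d) (by omega)
      ⟨_, P.smul_mem _ hfP, hyi, hE.y_smul d f hfd i⟩
  rw [hzero, Nat.cast_zero, zero_smul] at hfd
  have h0 : P' ⊓ LinearMap.ker E = LinearMap.ker E := by
    refine hE.irreducible _ ?_ inf_le_right ?_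
    · rintro σ u ⟨hu1, hu2⟩
      exact ⟨P.smul_mem _ hu1, hE.s_smul_ker u hu2 σ⟩
    · intro h
      exact hf ((Submodule.mem_bot ℂ).mp (h ▸ (⟨hfP, hfd⟩ : f ∈ P' ⊓ LinearMap.ker E)))
  have hall : ∀ (d : ℕ) (f : V), E f = (d : ℂ) • f → f ∈ P := by
    intro d
    induction d with
    | zero =>
      intro f hf
      rw [Nat.cast_zero, zero_smul] at hf
      exact (h0.ge hf).1
    | succ d ih =>
      intro f hf
      rw [Nat.cast_succ] at hf
      obtain ⟨g, hg, rfl⟩ := hE.generated d f hf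
      exact Submodule.sum_mem _ fun i _ => P.smul_mem _ (ih _ (hg i))
  refine eq_top_iff.mpr fun f _ => ?_
  obtain ⟨s, g, rfl, hg⟩ := hE.grading f
  exact Submodule.sum_mem _ fun d _ => hall d _ (hg d)

theorem isSimpleModule (hE : IsLowestWeight n k E κ) : IsSimpleModule (Cherednik n k) V := by
  have : Nontrivial V := by
    obtain ⟨u, -, hu⟩ := Submodule.exists_mem_ne_zero_of_ne_bot hE.ker_ne_bot
    exact ⟨⟨u, 0, hu⟩⟩
  exact { eq_bot_or_eq_top := fun P => or_iff_not_imp_left.mpr hE.eq_top_of_ne_bot }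

end IsLowestWeight

end KZB
end

noncomputable section

namespace KZB

/-! ### The standard module -/

open Cherednik

section StandardModule

variable {n : ℕ} {k : ℂ} {W : Type} [AddCommGroup W] [Module ℂ W]
  {π : Representation ℂ (Equiv.Perm (Fin n)) W}

variable (k π) in
/-- The lowest weight vectors of the standard module. -/
def lowestVector : W →ₗ[ℂ] StandardModule k π :=
  ((standardRel k π).mkQ.restrictScalars ℂ) ∘ₗ TensorProduct.mk ℂ (Cherednik n k) W 1

theorem smul_lowestVector (h : Cherednik n k) (w : W) :
    h • lowestVector k π w = (standardRel k π).mkQ (h ⊗ₜ w) := by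
  change h • (standardRel k π).mkQ (1 ⊗ₜ w) = _
  rw [← map_smul, TensorProduct.smul_tmul', smul_eq_mul, mul_one]

theorem s_smul_lowestVector (σ : Equiv.Perm (Fin n)) (w : W) :
    (s σ : Cherednik n k) • lowestVector k π w = lowestVector k π (π σ w) := by
  rw [smul_lowestVector, ← one_smul (Cherednik n k) (lowestVector k π (π σ w)),
    smul_lowestVector, ← sub_eq_zero, ← map_sub, Submodule.mkQ_apply,
    Submodule.Quotient.mk_eq_zero]
  refine Submodule.subset_span (Or.inl ⟨1, σ, w, ?_⟩)
  rw [one_mul]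

theorem y_smul_lowestVector (i : Fin n) (w : W) :
    (y i : Cherednik n k) • lowestVector k π w = 0 := by
  rw [smul_lowestVector, Submodule.mkQ_apply, Submodule.Quotient.mk_eq_zero]
  refine Submodule.subset_span (Or.inr ⟨1, i, w, ?_⟩)
  rw [one_mul]

theorem eq_top_of_lowestVector_mem {P : Submodule (Cherednik n k) (StandardModule k π)}
    (h : ∀ w, lowestVector k π w ∈ P) : P = ⊤ := by
  refine eq_top_iff.mpr fun z _ => ?_
  obtain ⟨z, rfl⟩ := (standardRel k π).mkQ_surjective z
  induction z using TensorProduct.induction_on with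
  | zero => rw [map_zero]; exact zero_mem _
  | add a b ha hb => rw [map_add]; exact P.add_mem (ha trivial) (hb trivial)
  | tmul a w =>
    rw [← smul_lowestVector]
    exact P.smul_mem _ (h w)

variable (k π) in
/-- The part of the standard module of degree `d` in the `x i`. -/
def standardPart : ℕ → Submodule ℂ (StandardModule k π)
  | 0 => LinearMap.range (lowestVector k π)
  | d + 1 => ⨆ i : Fin n, (standardPart d).map
      (Module.toModuleEnd ℂ (S := Cherednik n k) (StandardModule k π) (x i))

theorem x_smul_mem_standardPart {d : ℕ} {z : StandardModule k π} (hz : z ∈ standardPart k π d)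
    (i : Fin n) : (x i : Cherednik n k) • z ∈ standardPart k π (d + 1) :=
  Submodule.mem_iSup_of_mem i ⟨z, hz, rfl⟩

theorem standardPart_succ_induction {d : ℕ} {p : StandardModule k π → Prop}
    (hx : ∀ z ∈ standardPart k π d, ∀ i, p ((x i : Cherednik n k) • z)) (h0 : p 0)
    (hadd : ∀ a b, p a → p b → p (a + b)) {z : StandardModule k π}
    (hz : z ∈ standardPart k π (d + 1)) : p z := by
  refine Submodule.iSup_induction _ (motive := p) hz ?_ h0 hadd
  rintro i _ ⟨z, hz, rfl⟩
  exact hx z hz i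

theorem s_smul_mem_standardPart (σ : Equiv.Perm (Fin n)) (d : ℕ) :
    ∀ z ∈ standardPart k π d, (s σ : Cherednik n k) • z ∈ standardPart k π d := by
  induction d with
  | zero =>
    rintro _ ⟨w, rfl⟩
    rw [s_smul_lowestVector]
    exact ⟨_, rfl⟩
  | succ d ih =>
    intro z hz
    refine standardPart_succ_induction
      (p := fun z => (s σ : Cherednik n k) • z ∈ standardPart k π (d + 1)) ?_ ?_ ?_ hz
    · intro z hz i
      rw [← mul_smul, s_mul_x, mul_smul]
      exact x_smul_mem_standardPart (ih z hz) _
    · rw [smul_zero]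
      exact zero_mem _
    · intro a b ha hb
      rw [smul_add]
      exact add_mem ha hb

theorem x_y_smul_mem (i j : Fin n) (d : ℕ) {z : StandardModule k π}
    (hz : z ∈ standardPart k π d) :
    (x i * y j - y j * x i : Cherednik n k) • z ∈ standardPart k π d := by
  have h : ∀ i : Fin n, (algebraMap ℂ _ (1 / (n : ℂ)) - k • s (Equiv.swap i j) : Cherednik n k) • z ∈
      standardPart k π d := by
    intro i
    rw [sub_smul, algebraMap_smul, smul_assoc]
    exact Submodule.sub_mem _ (Submodule.smul_mem _ _ hz)
      (Submodule.smul_mem _ _ (s_smul_mem_standardPart _ _ _ hz))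
  by_cases hij : i = j
  · subst hij
    rw [x_y_self, neg_smul, Finset.sum_smul]
    exact Submodule.neg_mem _ (Submodule.sum_mem _ fun l _ => h l)
  · rw [x_y hij]
    exact h i

theorem y_smul_mem_standardPart (j : Fin n) (d : ℕ) :
    ∀ z ∈ standardPart k π d, (y j : Cherednik n k) • z ∈ standardPart k π (d - 1) := by
  induction d with
  | zero =>
    rintro _ ⟨w, rfl⟩
    rw [y_smul_lowestVector]
    exact zero_mem _
  | succ d ih =>
    intro z hz
    refine standardPart_succ_induction
      (p := fun z => (y j : Cherednik n k) • z ∈ standardPart k π d) ?_ ?_ ?_ hz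
    · intro z hz i
      have h1 := x_y_smul_mem i j d hz
      -- Degree zero is separate: the truncated `d - 1` would let the product with x_i rise to
      -- degree one, but there the y_j act by zero.
      have h2 : (x i : Cherednik n k) • (y j : Cherednik n k) • z ∈ standardPart k π d := by
        cases d with
        | zero =>
          obtain ⟨w, rfl⟩ := hz
          rw [y_smul_lowestVector, smul_zero]
          exact zero_mem _
        | succ d => exact x_smul_mem_standardPart (ih z hz) i
      rw [sub_smul, mul_smul, mul_smul] at h1
      exact (Submodule.sub_mem_iff_right _ h2).mp h1
    · rw [smul_zero]
      exact zero_mem _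
    · intro a b ha hb
      rw [smul_add]
      exact add_mem ha hb

theorem iSup_standardPart : ⨆ d, standardPart k π d = ⊤ := by
  set S := ⨆ d, standardPart k π d with hS
  have hmem : ∀ d, ∀ z ∈ standardPart k π d, z ∈ S := fun d z hz => Submodule.mem_iSup_of_mem d hz
  have hstep : ∀ h : Cherednik n k, (∀ d, ∀ z ∈ standardPart k π d, h • z ∈ S) →
      ∀ z ∈ S, h • z ∈ S := by
    intro h hh z hz
    refine Submodule.iSup_induction _ (motive := fun z => h • z ∈ S) hz hh ?_ ?_
    · rw [smul_zero]; exact zero_mem _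
    · intro a b ha hb
      rw [smul_add]
      exact add_mem ha hb
  have hstable : ∀ (h : Cherednik n k), ∀ z ∈ S, h • z ∈ S := by
    intro h
    induction h using Cherednik.induction_on with
    | hc c => intro z hz; rw [algebraMap_smul]; exact S.smul_mem c hz
    | hx i => exact hstep _ fun d z hz => hmem _ _ (x_smul_mem_standardPart hz i)
    | hy i => exact hstep _ fun d z hz => hmem _ _ (y_smul_mem_standardPart i d z hz)
    | hs σ => exact hstep _ fun d z hz => hmem _ _ (s_smul_mem_standardPart σ d z hz)
    | hmul a b ha hb => intro z hz; rw [mul_smul]; exact ha _ (hb z hz)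
    | hadd a b ha hb => intro z hz; rw [add_smul]; exact add_mem (ha z hz) (hb z hz)
  let P : Submodule (Cherednik n k) (StandardModule k π) :=
    { S.toAddSubmonoid with smul_mem' := fun h z hz => hstable h z hz }
  have hP : P = ⊤ := eq_top_of_lowestVector_mem fun w => hmem 0 _ ⟨w, rfl⟩
  exact eq_top_iff.mpr fun z _ => (hP.ge trivial : z ∈ P)

theorem eu_smul_standardPart (hn : 0 < n) {κ : ℂ}
    (h0 : ∀ w, (eu n k) • lowestVector k π w = κ • lowestVector k π w) (d : ℕ) :
    ∀ z ∈ standardPart k π d, (eu n k) • z = (κ + d) • z := by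
  induction d with
  | zero =>
    rintro _ ⟨w, rfl⟩
    rw [h0, Nat.cast_zero, add_zero]
  | succ d ih =>
    intro z hz
    refine standardPart_succ_induction
      (p := fun z => (eu n k) • z = (κ + (d + 1 : ℕ)) • z) ?_ ?_ ?_ hz
    · intro z hz i
      rw [← mul_smul, eu_mul_x hn, add_smul, mul_smul, ih z hz, smul_comm, Nat.cast_succ]
      generalize (x i : Cherednik n k) • z = v
      module
    · rw [smul_zero, smul_zero]
    · intro a b ha hb
      rw [smul_add, smul_add, ha, hb]

end StandardModule

/-! ### Comparison with the standard module -/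

namespace IsLowestWeight

variable {n : ℕ} {k : ℂ} {W : Type} [AddCommGroup W] [Module ℂ W]
  {π : Representation ℂ (Equiv.Perm (Fin n)) W}
  {V : Type*} [AddCommGroup V] [Module ℂ V] [Module (Cherednik n k) V]
  [IsScalarTower ℂ (Cherednik n k) V] {E : V →ₗ[ℂ] V} {κ : ℂ}

theorem exists_standardHom (hE : IsLowestWeight n k E κ) (φ : W →ₗ[ℂ] V)
    (hφs : ∀ σ w, φ (π σ w) = (s σ : Cherednik n k) • φ w) (hφ0 : ∀ w, E (φ w) = 0) :
    ∃ Ψ : StandardModule k π →ₗ[Cherednik n k] V, ∀ w, Ψ (lowestVector k π w) = φ w := by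
  have : SMulCommClass ℂ (Cherednik n k) V := IsScalarTower.to_smulCommClass
  have : SMulCommClass (Cherednik n k) ℂ V := SMulCommClass.symm _ _ _
  let Ψ₀ : Cherednik n k ⊗[ℂ] W →ₗ[Cherednik n k] V :=
    TensorProduct.AlgebraTensorModule.lift (LinearMap.toSpanSingleton (Cherednik n k) (W →ₗ[ℂ] V) φ)
  have hΨ₀ : ∀ h w, Ψ₀ (h ⊗ₜ w) = h • φ w := fun h w => rfl
  have hle : standardRel k π ≤ LinearMap.ker Ψ₀ := by
    refine Submodule.span_le.mpr ?_
    rintro _ (⟨h, σ, w, rfl⟩ | ⟨h, i, w, rfl⟩)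
    · change Ψ₀ _ = 0
      rw [map_sub, hΨ₀, hΨ₀, hφs, mul_smul, sub_self]
    · change Ψ₀ _ = 0
      rw [hΨ₀, mul_smul, hE.y_smul_zero _ (hφ0 w), smul_zero]
  refine ⟨(standardRel k π).liftQ Ψ₀ hle, fun w => ?_⟩
  exact (hΨ₀ 1 w).trans (one_smul _ _)

/-- On vectors killed by every y_i, `eu` is a sum of transpositions. Its scalar is read off in V and
transported back along the injection φ. -/
theorem eu_smul_lowestVector (hE : IsLowestWeight n k E κ) (φ : W →ₗ[ℂ] V)
    (hφ : Function.Injective φ)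
    (hφs : ∀ σ w, φ (π σ w) = (s σ : Cherednik n k) • φ w) (hφ0 : ∀ w, E (φ w) = 0) (w : W) :
    (eu n k) • lowestVector k π w = κ • lowestVector k π w := by
  have h : -((k / 2) • ∑ i, ∑ j, π (Equiv.swap i j) w) = κ • w := by
    apply hφ
    have h1 := hE.eu_smul (φ w)
    rw [hφ0, zero_add, eu, sub_smul, Finset.sum_smul,
      Finset.sum_eq_zero (fun i _ => by rw [mul_smul, hE.y_smul_zero _ (hφ0 w), smul_zero]),
      zero_sub, smul_assoc] at h1
    rw [map_neg, map_smul, map_smul, ← h1]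
    simp only [map_sum, hφs, Finset.sum_smul]
  rw [← map_smul (lowestVector k π) κ w, ← h, eu, sub_smul, Finset.sum_smul,
    Finset.sum_eq_zero (fun i _ => by rw [mul_smul, y_smul_lowestVector, smul_zero]),
    zero_sub, smul_assoc, map_neg, map_smul]
  simp only [map_sum, Finset.sum_smul, s_smul_lowestVector]

/-- A proper submodule of the standard module is killed by the map to `V`. -/
theorem le_ker_of_ne_top (hn : 0 < n) (hE : IsLowestWeight n k E κ) (φ : W →ₗ[ℂ] V)
    (hφ : Function.Injective φ)
    (hφs : ∀ σ w, φ (π σ w) = (s σ : Cherednik n k) • φ w) (hφ0 : ∀ w, E (φ w) = 0)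
    (Ψ : StandardModule k π →ₗ[Cherednik n k] V) (hΨ : ∀ w, Ψ (lowestVector k π w) = φ w)
    {P : Submodule (Cherednik n k) (StandardModule k π)} (hP : P ≠ ⊤) : P ≤ LinearMap.ker Ψ := by
  by_contra hker
  refine hP (eq_top_of_lowestVector_mem fun w => ?_)
  -- Since P maps onto V, some p in P maps to φ w; its degree-zero component will turn out to be the
  -- lowest vector of w.
  have hmap : P.map Ψ = ⊤ := hE.eq_top_of_ne_bot fun h => hker (LinearMap.le_ker_iff_map.mpr h)
  obtain ⟨p, hpP, hp⟩ : φ w ∈ P.map Ψ := by rw [hmap]; trivial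
  let E' : StandardModule k π →ₗ[ℂ] StandardModule k π :=
    Module.toModuleEnd ℂ (S := Cherednik n k) (StandardModule k π) (eu n k) - κ • LinearMap.id
  have hE' : ∀ z, E' z = (eu n k) • z - κ • z := fun z => rfl
  have hpart := eu_smul_standardPart hn (hE.eu_smul_lowestVector φ hφ hφs hφ0)
  have hpt : p ∈ ⨆ d, standardPart k π d := by rw [iSup_standardPart]; trivial
  obtain ⟨g, hg, hgp⟩ := (Submodule.mem_iSup_iff_exists_finsupp _ _).mp hpt
  have hgE : ∀ d, E' (g d) = (d : ℂ) • g d := fun d => by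
    rw [hE', hpart d _ (hg d), add_smul, add_sub_cancel_left]
  -- Index 0 is inserted so that the degree-zero component is always a term of the sum, even if it
  -- vanishes.
  have hsum : ∑ d ∈ insert 0 g.support, g d = p := by
    rw [← hgp, Finsupp.sum]
    refine (Finset.sum_subset (Finset.subset_insert _ _) fun d _ hd => ?_).symm
    simpa using hd
  have h0P : g 0 ∈ P := by
    refine eigencomponent_mem (E := E') (P.restrictScalars ℂ) ?_ (insert 0 g.support) g hgE ?_ 0
      (Finset.mem_insert_self _ _)
    · intro f hf
      exact Submodule.sub_mem (P.restrictScalars ℂ) (P.smul_mem (eu n k) hf)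
        (Submodule.smul_mem (P.restrictScalars ℂ) κ hf)
    · rw [hsum]
      exact hpP
  have hΨsmul : ∀ (c : ℂ) (z : StandardModule k π), Ψ (c • z) = c • Ψ z := fun c z =>
    (Ψ.restrictScalars ℂ).map_smul c z
  have hΨE : ∀ d, E (Ψ (g d)) = (d : ℂ) • Ψ (g d) := fun d => by
    have h := hE.eu_smul (Ψ (g d))
    rw [← map_smul, hpart d _ (hg d), hΨsmul, add_smul, add_comm] at h
    exact (add_right_cancel h).symm
  -- These are the homogeneous components of Ψ p - φ w = 0, so each of them vanishes.
  let g' : ℕ → V := fun d => Ψ (g d) - if d = 0 then φ w else 0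
  have hg' : g' 0 = 0 := by
    rw [← Submodule.mem_bot ℂ]
    refine eigencomponent_mem (E := E) ⊥ (fun f hf => ?_) (insert 0 g.support) g' (fun d => ?_) ?_ 0
      (Finset.mem_insert_self _ _)
    · rw [(Submodule.mem_bot ℂ).mp hf, map_zero]
      exact zero_mem _
    · simp only [g']
      split_ifs with hd
      · subst hd
        rw [map_sub, hΨE, hφ0, Nat.cast_zero, zero_smul, zero_smul, sub_zero]
      · rw [sub_zero, hΨE]
    · rw [Submodule.mem_bot, Finset.sum_sub_distrib, ← map_sum, hsum, hp, Finset.sum_ite_eq',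
        if_pos (Finset.mem_insert_self _ _), sub_self]
  obtain ⟨w', hw'⟩ : g 0 ∈ LinearMap.range (lowestVector k π) := hg 0
  have hww : w' = w := by
    apply hφ
    rw [← hΨ, hw']
    simpa [g', sub_eq_zero] using hg'
  rw [← hww, hw']
  exact h0P

/-- A module of lowest weight type is the irreducible quotient of the standard module. -/
theorem nonempty_linearEquiv (hn : 0 < n) (hE : IsLowestWeight n k E κ) (φ : W →ₗ[ℂ] V)
    (hφ : Function.Injective φ)
    (hφs : ∀ σ w, φ (π σ w) = (s σ : Cherednik n k) • φ w)
    (hφ0 : LinearMap.range φ = LinearMap.ker E) :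
    Nonempty (V ≃ₗ[Cherednik n k] LowestWeightModule k π) := by
  have hφE : ∀ w, E (φ w) = 0 := fun w => hφ0.le ⟨w, rfl⟩
  obtain ⟨Ψ, hΨ⟩ := hE.exists_standardHom φ hφs hφE
  obtain ⟨w, hw⟩ : ∃ w, φ w ≠ 0 := by
    obtain ⟨_, hu, hu0⟩ := Submodule.exists_mem_ne_zero_of_ne_bot hE.ker_ne_bot
    obtain ⟨w, rfl⟩ := hφ0.ge hu
    exact ⟨w, hu0⟩
  have hsurj : LinearMap.range Ψ = ⊤ := hE.eq_top_of_ne_bot fun h =>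
    hw ((Submodule.mem_bot (Cherednik n k)).mp (h ▸ (⟨_, hΨ w⟩ : φ w ∈ LinearMap.range Ψ)))
  have hrad : standardRadical k π = LinearMap.ker Ψ := by
    refine le_antisymm (sSup_le fun P hP => hE.le_ker_of_ne_top hn φ hφ hφs hφE Ψ hΨ hP)
      (le_sSup fun h => hw ?_)
    rw [← hΨ w]
    exact (h.ge trivial : lowestVector k π w ∈ LinearMap.ker Ψ)
  exact ⟨((Submodule.quotEquivOfEq _ _ hrad).trans
    (Ψ.quotKerEquivOfSurjective (LinearMap.range_eq_top.mp hsurj))).symm⟩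

end IsLowestWeight

end KZB
end

noncomputable section

namespace KZB

/-! ### The rectangular representation inside the tensor power -/

/-! ### Signed sums and the Hermitian form on a group algebra -/

section GroupAlgebra

open scoped ComplexOrder ComplexConjugate

variable {G : Type*} [Group G]

/-- The sum of the elements of `S`, weighted by a sign character. -/
def signedSum (χ : G →* ℤˣ) (S : Finset G) : MonoidAlgebra ℂ G :=
  ∑ g ∈ S, MonoidAlgebra.single g ((χ g : ℤ) : ℂ)

theorem signedSum_mul_self (χ : G →* ℤˣ) {S : Finset G} (hmul : ∀ g ∈ S, ∀ h ∈ S, g * h ∈ S)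
    (hinv : ∀ g ∈ S, g⁻¹ ∈ S) :
    signedSum χ S * signedSum χ S = (S.card : ℂ) • signedSum χ S := by
  have h : ∀ g ∈ S, signedSum χ S * MonoidAlgebra.single g ((χ g : ℤ) : ℂ) = signedSum χ S := by
    intro g hg
    rw [signedSum, Finset.sum_mul]
    refine Finset.sum_bij' (fun h _ => h * g) (fun h _ => h * g⁻¹) (fun h hh => hmul h hh g hg)
      (fun h hh => hmul h hh _ (hinv g hg)) (fun h _ => by simp) (fun h _ => by simp)
      fun h _ => ?_
    rw [MonoidAlgebra.single_mul_single, map_mul]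
    push_cast
    rfl
  conv_lhs => enter [2]; rw [signedSum]
  rw [Finset.mul_sum, Finset.sum_congr rfl h, Finset.sum_const, Nat.cast_smul_eq_nsmul]

variable [Fintype G]

/-- The standard Hermitian form on the group algebra. -/
def groupForm (u v : MonoidAlgebra ℂ G) : ℂ := ∑ g, conj (u.coeff g) * v.coeff g

theorem eq_zero_of_groupForm_self {u : MonoidAlgebra ℂ G} (h : groupForm u u = 0) : u = 0 := by
  replace h := (Finset.sum_eq_zero_iff_of_nonneg fun g _ => star_mul_self_nonneg (u.coeff g)).mp h
  ext g
  simpa using h g (Finset.mem_univ g)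

/-- Right multiplication by h has adjoint right multiplication by h⁻¹; S is closed under inverses
and a sign character takes the same value on h and h⁻¹. -/
theorem groupForm_mul_signedSum (χ : G →* ℤˣ) {S : Finset G} (hinv : ∀ g ∈ S, g⁻¹ ∈ S)
    (u v : MonoidAlgebra ℂ G) :
    groupForm u (v * signedSum χ S) = groupForm (u * signedSum χ S) v := by
  have h1 : ∀ (w : MonoidAlgebra ℂ G) g, (w * signedSum χ S).coeff g =
      ∑ h ∈ S, w.coeff (g * h⁻¹) * ((χ h : ℤ) : ℂ) := fun w g => by
    rw [signedSum, Finset.mul_sum, MonoidAlgebra.coeff_sum, Finsupp.finsetSum_apply]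
    exact Finset.sum_congr rfl fun h _ => MonoidAlgebra.coeff_mul_single_apply _ _ _ _
  simp only [groupForm, h1, Finset.mul_sum, map_sum, Finset.sum_mul, map_mul]
  rw [Finset.sum_comm]
  conv_rhs => rw [Finset.sum_comm]
  refine Finset.sum_bij' (fun h _ => h⁻¹) (fun h _ => h⁻¹) hinv hinv (fun h _ => inv_inv h)
    (fun h _ => inv_inv h) fun h _ => ?_
  rw [← Equiv.sum_comp (Equiv.mulRight h)]
  refine Finset.sum_congr rfl fun g _ => ?_
  have h2 : χ h⁻¹ = χ h := by rw [map_inv, Int.units_inv_eq_self]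
  rw [Equiv.coe_mulRight, mul_inv_cancel_right, inv_inv, h2, map_intCast]
  simp only
  ring

/-- An element of the left ideal generated by `a * b` is determined by its product with `a`. -/
theorem eq_zero_of_mul_signedSum_eq_zero {χ ψ : G →* ℤˣ} {S T : Finset G}
    (hS : ∀ g ∈ S, g⁻¹ ∈ S) (hT : ∀ g ∈ T, g⁻¹ ∈ T) (hTT : ∀ g ∈ T, ∀ h ∈ T, g * h ∈ T)
    {z : MonoidAlgebra ℂ G}
    (hz : z ∈ Submodule.span (MonoidAlgebra ℂ G) {signedSum χ S * signedSum ψ T})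
    (h : z * signedSum χ S = 0) : z = 0 := by
  obtain ⟨y, rfl⟩ := Submodule.mem_span_singleton.mp hz
  rw [smul_eq_mul] at *
  set z := y * (signedSum χ S * signedSum ψ T) with hzdef
  have hzb : z * signedSum ψ T = (T.card : ℂ) • z := by
    rw [hzdef, ← mul_assoc, mul_assoc, signedSum_mul_self ψ hTT hT, mul_smul_comm]
  refine eq_zero_of_groupForm_self ?_
  -- For the generator a * b and z = yab, self-adjointness gives ⟨z, yab⟩ = ⟨zb, ya⟩, a multiple of
  -- ⟨z, ya⟩ = ⟨za, y⟩ = 0.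
  conv_lhs => enter [2]; rw [hzdef, ← mul_assoc]
  rw [groupForm_mul_signedSum ψ hT, hzb, groupForm_mul_signedSum χ hS, smul_mul_assoc, h,
    smul_zero]
  simp [groupForm]

end GroupAlgebra

/-! ### The left ideal of the Young symmetrizer and the invariant tensors -/

section Rectangular

variable {n N m : ℕ} (e : Fin N × Fin m ≃ Fin n)

/-- The permutations preserving the rows. -/
def rowPerms : Finset (Equiv.Perm (Fin n)) :=
  Finset.univ.filter fun σ => ∀ i, rowWord e (σ i) = rowWord e i

theorem mem_rowPerms {σ : Equiv.Perm (Fin n)} :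
    σ ∈ rowPerms e ↔ ∀ i, rowWord e (σ i) = rowWord e i := by simp [rowPerms]

theorem mem_colPerms {σ : Equiv.Perm (Fin n)} :
    σ ∈ colPerms e ↔ ∀ i, (e.symm (σ i)).2 = (e.symm i).2 := by simp [colPerms]

theorem inv_mem_rowPerms : ∀ σ ∈ rowPerms e, σ⁻¹ ∈ rowPerms e := by
  intro σ hσ
  rw [mem_rowPerms] at *
  intro i
  rw [← hσ]
  simp

theorem inv_mem_colPerms : ∀ σ ∈ colPerms e, σ⁻¹ ∈ colPerms e := by
  intro σ hσ
  rw [mem_colPerms] at *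
  intro i
  rw [← hσ]
  simp

theorem mul_mem_colPerms : ∀ σ ∈ colPerms e, ∀ τ ∈ colPerms e, σ * τ ∈ colPerms e := by
  intro σ hσ τ hτ
  rw [mem_colPerms] at *
  intro i
  rw [Equiv.Perm.mul_apply, hσ, hτ]

/-- The group algebra acting on the standard tensor of the tableau. -/
def tableauMap : MonoidAlgebra ℂ (Equiv.Perm (Fin n)) →ₗ[ℂ] TensorPow n N :=
  LinearMap.flip (permRep n N).asAlgebraHom.toLinearMap (wordBasis n N (rowWord e))

theorem tableauMap_apply (z : MonoidAlgebra ℂ (Equiv.Perm (Fin n))) :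
    tableauMap e z = (permRep n N).asAlgebraHom z (wordBasis n N (rowWord e)) := rfl

theorem tableauMap_mul (y z : MonoidAlgebra ℂ (Equiv.Perm (Fin n))) :
    tableauMap e (y * z) = (permRep n N).asAlgebraHom y (tableauMap e z) := by
  rw [tableauMap_apply, map_mul]
  rfl

theorem asAlgebraHom_permRep_apply (z : MonoidAlgebra ℂ (Equiv.Perm (Fin n)))
    (u : TensorPow n N) :
    (permRep n N).asAlgebraHom z u = ∑ σ, z.coeff σ • permFactors σ u := by
  rw [Representation.asAlgebraHom_def, MonoidAlgebra.lift_apply,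
    Finsupp.sum_fintype z.coeff _ fun σ => zero_smul ℂ (permRep n N σ), LinearMap.sum_apply]
  rfl

/-- The row permutations are the stabilizer of the row word. So the coefficient at τ of z times the
row symmetrizer is the coefficient of `tableauMap e z` at the row word moved by τ. -/
theorem mul_signedSum_eq_zero_of_tableauMap {z : MonoidAlgebra ℂ (Equiv.Perm (Fin n))}
    (hz : tableauMap e z = 0) : z * signedSum 1 (rowPerms e) = 0 := by
  ext τ
  have h := congrArg (fun u => (wordBasis n N).repr u (rowWord e ∘ ⇑τ⁻¹)) hz
  simp only [tableauMap_apply, asAlgebraHom_permRep_apply, map_sum, map_smul,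
    Finsupp.finsetSum_apply, Finsupp.smul_apply, wordBasis_repr_permFactors,
    Module.Basis.repr_self, map_zero, Finsupp.zero_apply] at h
  rw [signedSum, Finset.mul_sum, MonoidAlgebra.coeff_sum, Finsupp.finsetSum_apply]
  simp only [MonoidAlgebra.coeff_mul_single_apply, MonoidAlgebra.coeff_zero, Finsupp.zero_apply]
  rw [← h, ← Equiv.sum_comp (Equiv.mulLeft τ), ← Equiv.sum_comp (Equiv.inv _), rowPerms,
    Finset.sum_filter]
  refine Finset.sum_congr rfl fun σ _ => ?_
  simp only [Equiv.inv_apply, Equiv.coe_mulLeft, MonoidHom.one_apply, smul_eq_mul]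
  have hw : rowWord e ∘ ⇑τ⁻¹ ∘ ⇑(τ * σ⁻¹) = rowWord e ↔ ∀ i, rowWord e (σ i) = rowWord e i := by
    have : ⇑τ⁻¹ ∘ ⇑(τ * σ⁻¹) = ⇑σ⁻¹ := by ext i; simp
    rw [this, funext_iff, ← σ.forall_congr_right]
    exact forall_congr' fun i => by simp [eq_comm]
  rw [Function.comp_assoc, Finsupp.single_apply]
  split_ifs with h1 h2 h2
  · simp
  · exact absurd (hw.mpr h1).symm h2
  · exact absurd (hw.mp h2.symm) h1
  · simp

theorem tableauMap_signedSum : tableauMap e (signedSum Equiv.Perm.sign (colPerms e)) =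
    colVector e := by
  rw [signedSum, map_sum, colVector]
  refine Finset.sum_congr rfl fun σ _ => ?_
  rw [tableauMap_apply, Representation.asAlgebraHom_single]
  rfl

/-- The Young symmetrizer of the tableau. -/
def youngSymmetrizer : MonoidAlgebra ℂ (Equiv.Perm (Fin n)) :=
  signedSum 1 (rowPerms e) * signedSum Equiv.Perm.sign (colPerms e)

theorem tableauMap_mem_tensorInv {z : MonoidAlgebra ℂ (Equiv.Perm (Fin n))}
    (hz : z ∈ Submodule.span (MonoidAlgebra ℂ (Equiv.Perm (Fin n))) {youngSymmetrizer e}) :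
    tableauMap e z ∈ tensorInv n N := by
  obtain ⟨y, rfl⟩ := Submodule.mem_span_singleton.mp hz
  rw [smul_eq_mul, youngSymmetrizer, ← mul_assoc, tableauMap_mul, tableauMap_signedSum,
    asAlgebraHom_permRep_apply]
  exact Submodule.sum_mem _ fun σ _ => Submodule.smul_mem _ _
    (permFactors_mem_tensorInv σ (colVector_mem_tensorInv e))

/-- Its coefficient at the row word is the number of row permutations, each contributing the
coefficient 1 of `colVector e`. -/
theorem tableauMap_youngSymmetrizer_ne_zero : tableauMap e (youngSymmetrizer e) ≠ 0 := by
  intro h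
  have h1 := congrArg (fun u => (wordBasis n N).repr u (rowWord e)) h
  have h2 : ∀ σ ∈ rowPerms e, rowWord e ∘ σ = rowWord e := fun σ hσ =>
    funext ((mem_rowPerms e).mp hσ)
  simp only [youngSymmetrizer, tableauMap_mul, tableauMap_signedSum] at h1
  rw [signedSum, map_sum, LinearMap.sum_apply, map_sum, Finsupp.finsetSum_apply,
    Finset.sum_congr rfl fun σ hσ => by
      rw [Representation.asAlgebraHom_single, LinearMap.smul_apply, map_smul, Finsupp.smul_apply,
        permRep_apply, wordBasis_repr_permFactors, h2 σ hσ, colVector_repr_rowWord,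
        MonoidHom.one_apply, Units.val_one, Int.cast_one, smul_eq_mul, mul_one],
    Finset.sum_const, nsmul_eq_mul, mul_one, map_zero, Finsupp.zero_apply, Nat.cast_eq_zero,
    Finset.card_eq_zero] at h1
  have : (1 : Equiv.Perm (Fin n)) ∈ rowPerms e := (mem_rowPerms e).mpr fun i => rfl
  rw [h1] at this
  exact absurd this (Finset.notMem_empty _)

/-- The isomorphism of the left ideal of the Young symmetrizer with the invariant tensors. -/
theorem exists_tableauIso (hN : 0 < N)
    (h : rectSymmetrizer n N = youngSymmetrizer e) :
    ∃ φ : RectModule n N →ₗ[ℂ] TensorPow n N, Function.Injective φ ∧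
      (∀ σ z, φ (rectRep n N σ z) = permFactors σ (φ z)) ∧
      LinearMap.range φ = tensorInv n N := by
  let φ : RectModule n N →ₗ[ℂ] TensorPow n N :=
    tableauMap e ∘ₗ (Submodule.subtype _).restrictScalars ℂ
  have hφ : ∀ z, φ z = tableauMap e z := fun z => rfl
  have hmem : ∀ z : RectModule n N, (z : MonoidAlgebra ℂ (Equiv.Perm (Fin n))) ∈
      Submodule.span (MonoidAlgebra ℂ (Equiv.Perm (Fin n))) {youngSymmetrizer e} := fun z => by
    rw [← h]; exact z.2
  have hσ : ∀ σ z, φ (rectRep n N σ z) = permFactors σ (φ z) := by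
    intro σ z
    have h1 : ((rectRep n N σ z : RectModule n N) : MonoidAlgebra ℂ (Equiv.Perm (Fin n))) =
      MonoidAlgebra.single σ 1 * (z : MonoidAlgebra ℂ (Equiv.Perm (Fin n))) := rfl
    rw [hφ, hφ, h1, tableauMap_mul, Representation.asAlgebraHom_single_one, permRep_apply]
  refine ⟨φ, (injective_iff_map_eq_zero φ).mpr fun z hz => Subtype.ext ?_, hσ, ?_⟩
  · exact eq_zero_of_mul_signedSum_eq_zero (inv_mem_rowPerms e) (inv_mem_colPerms e)
      (mul_mem_colPerms e) (hmem z) (mul_signedSum_eq_zero_of_tableauMap e hz)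
  · refine eq_tensorInv_of_ne_bot e hN ?_ ?_ ?_
    · rintro σ _ ⟨z, rfl⟩
      exact ⟨_, hσ σ z⟩
    · rintro _ ⟨z, rfl⟩
      exact tableauMap_mem_tensorInv e (hmem z)
    · intro hbot
      refine tableauMap_youngSymmetrizer_ne_zero e ?_
      rw [← h, ← Submodule.mem_bot ℂ, ← hbot]
      exact ⟨⟨_, Submodule.mem_span_singleton_self _⟩, rfl⟩

/-- The rectangular tableau filled row by row. -/
def rectTableau (h : N * m = n) : Fin N × Fin m ≃ Fin n := finProdFinEquiv.trans (finCongr h)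

/-- The inverse of `finProdFinEquiv` takes quotient and remainder by m = n / N, which are the row
and column of the rectangular tableau. -/
theorem rectSymmetrizer_eq (h : N * m = n) (hN : 0 < N) :
    rectSymmetrizer n N = youngSymmetrizer (rectTableau h) := by
  have hm : n / N = m := by rw [← h, Nat.mul_div_cancel_left _ hN]
  have hr : ∀ i j : Fin n, rectRow n N i = rectRow n N j ↔
      rowWord (rectTableau h) i = rowWord (rectTableau h) j := fun i j => by
    rw [rectRow, rectRow, hm, Fin.ext_iff]
    rfl
  have hc : ∀ i j : Fin n, rectCol n N i = rectCol n N j ↔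
      ((rectTableau h).symm i).2 = ((rectTableau h).symm j).2 := fun i j => by
    rw [rectCol, rectCol, hm, Fin.ext_iff]
    rfl
  rw [rectSymmetrizer, youngSymmetrizer, signedSum, signedSum, rowPerms, colPerms]
  simp only [hr, hc]
  congr 1
  refine Finset.sum_congr (by congr) fun σ _ => ?_
  simp

end Rectangular

end KZB
end

noncomputable section

namespace KZB

/-! ### The module `V_N` -/

attribute [local instance 100] LieRing.ofAssociativeRing

theorem sub_smul_eq_of_eq_add {V : Type*} [AddCommGroup V] [Module ℂ V] {c t : ℂ} {A e S f : V}
    (h : A = e + c • (S + t • f)) : A - c • S = e + (c * t) • f := by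
  rw [h]; module

theorem eq_smul_of_add_eq {V : Type*} [AddCommGroup V] [Module ℂ V] {c : ℂ} {A f : V}
    (h : A + f = (c + 1) • f) : A = c • f := by
  rw [add_smul, one_smul] at h
  exact add_right_cancel h

theorem eq_add_smul_of_coe_eq {V κ : Type*} [Fintype κ] [AddCommMonoid V] [Module ℂ V]
    {P : Submodule ℂ V} {A e f : P} {c t : ℂ} {S : κ → κ → P}
    (h : (A : V) = (e : V) + c • ((∑ i, ∑ j, (S i j : V)) + t • (f : V))) :
    A = e + c • ((∑ i, ∑ j, S i j) + t • f) :=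
  Subtype.ext (by simpa using h)

/-- With its companions below, this carries irreducibility of the invariant tensors over to the
constant functions in V_N. -/
theorem map_subtype_comap_ne_bot {T V : Type*} [AddCommMonoid T] [Module ℂ T] [AddCommMonoid V]
    [Module ℂ V] {P : Submodule ℂ T} {c : P →ₗ[ℂ] V} {U : Submodule ℂ V}
    (hU : U ≤ LinearMap.range c) (hne : U ≠ ⊥) : (U.comap c).map P.subtype ≠ ⊥ := by
  intro h
  have h1 : U.comap c = ⊥ := by
    rw [← Submodule.map_bot P.subtype] at h
    exact Submodule.map_injective_of_injective P.injective_subtype h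
  rw [← Submodule.map_comap_eq_of_le hU, h1, Submodule.map_bot] at hne
  exact hne rfl

theorem eq_range_of_map_subtype_comap {T V : Type*} [AddCommMonoid T] [Module ℂ T]
    [AddCommMonoid V] [Module ℂ V] {P : Submodule ℂ T} {c : P →ₗ[ℂ] V} {U : Submodule ℂ V}
    (hU : U ≤ LinearMap.range c) (h : (U.comap c).map P.subtype = P) : U = LinearMap.range c := by
  refine le_antisymm hU ?_
  rintro _ ⟨u, rfl⟩
  obtain ⟨v, hv, hvu⟩ := h.ge u.2
  rw [← Subtype.ext hvu]
  exact hv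

theorem mem_map_subtype_comap {T V : Type*} [AddCommMonoid T] [Module ℂ T] [AddCommMonoid V]
    [Module ℂ V] {P : Submodule ℂ T} {c : P →ₗ[ℂ] V} {U : Submodule ℂ V} {F : T → T} {G : V → V}
    (hF : ∀ u : P, F u ∈ P) (hG : ∀ u : P, G (c u) = c ⟨F u, hF u⟩) (hU : ∀ u ∈ U, G u ∈ U) :
    ∀ u ∈ (U.comap c).map P.subtype, F u ∈ (U.comap c).map P.subtype := by
  rintro _ ⟨u, hu, rfl⟩
  refine ⟨⟨F u, hF u⟩, ?_, rfl⟩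
  have h := hU _ hu
  rw [hG] at h
  exact h

theorem range_ne_bot_of_injective {T V : Type*} [AddCommMonoid T] [Module ℂ T]
    [AddCommMonoid V] [Module ℂ V] {P : Submodule ℂ T} {c : P →ₗ[ℂ] V}
    (hc : Function.Injective c) (hP : P ≠ ⊥) : LinearMap.range c ≠ ⊥ := by
  intro h
  refine hP ((Submodule.eq_bot_iff _).mpr fun u hu => ?_)
  have h1 : c ⟨u, hu⟩ ∈ LinearMap.range c := ⟨_, rfl⟩
  rw [h, Submodule.mem_bot, ← map_zero c] at h1
  exact congrArg Subtype.val (hc h1)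

variable {n N : ℕ} {ι : Type*} [Fintype ι] [DecidableEq ι] {b : Module.Basis ι ℂ (sl N)}

theorem tensorWeyl_euler : (tensorWeyl b n).euler = eulerOp n N := (eulerOp_eq b).symm

/-- The Euler operator on `V_N`. -/
def invEuler (hb : TraceOrthonormal b) (n : ℕ) : Module.End ℂ (invariants n N) :=
  restrictInvariants hb (tensorWeyl b n).euler ((tensorWeyl b n).act_euler)

theorem invEuler_coe (hb : TraceOrthonormal b) (f : invariants n N) :
    (invEuler hb n f : TensorFun n N) = (tensorWeyl b n).euler f := rfl

theorem invEuler_eq_iff (hb : TraceOrthonormal b) {c : ℂ} {f : invariants n N} :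
    invEuler hb n f = c • f ↔ (tensorWeyl b n).euler (f : TensorFun n N) = c • (f : TensorFun n N) :=
  Subtype.ext_iff

theorem sum_x_y_coe (hb : TraceOrthonormal b) (hN : 0 < N) (hn : 0 < n) (f : invariants n N) :
    ((∑ i, zeta hb hN n (Cherednik.x i) (zeta hb hN n (Cherednik.y i) f) : invariants n N) :
      TensorFun n N) = (tensorWeyl b n).euler (f : TensorFun n N) +
        ((N : ℂ) / n / 2) • (tensorWeyl b n).cas (f : TensorFun n N) := by
  have h := ((isInvariant_iff hb).mpr f.2).sum_x_y_smul hb hn hN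
  simp only [Module.End.smul_def] at h
  rw [← h, Submodule.coe_sum]
  simp only [zeta_x, zeta_y]

/-- The transpositions subtracted in `eu` cancel those of the Casimir element in the key identity,
leaving the Euler operator and a scalar. -/
theorem zeta_eu (hb : TraceOrthonormal b) (hN : 0 < N) (hn : 0 < n) (f : invariants n N) :
    zeta hb hN n (Cherednik.eu n ((N : ℂ) / n)) f = invEuler hb n f +
      ((N : ℂ) / n / 2 * ((n : ℂ) * (N - 1) - n * n / N)) • f := by
  have h1 : (tensorWeyl b n).cas (f : TensorFun n N) =
      (∑ i, ∑ j, tensOp n N (permFactors (Equiv.swap i j)) (f : TensorFun n N)) +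
        ((n : ℂ) * (N - 1) - n * n / N) • (f : TensorFun n N) := by
    rw [(tensorWeyl b n).cas_eq hb, LinearMap.add_apply, LinearMap.sum_apply]
    simp only [LinearMap.sum_apply]
    rfl
  have h2 : ∑ i, zeta hb hN n (Cherednik.x i) (zeta hb hN n (Cherednik.y i) f) =
      invEuler hb n f + ((N : ℂ) / n / 2) •
        ((∑ i, ∑ j, zeta hb hN n (Cherednik.s (Equiv.swap i j)) f) +
          ((n : ℂ) * (N - 1) - n * n / N) • f) := by
    refine eq_add_smul_of_coe_eq ?_
    refine (sum_x_y_coe hb hN hn f).trans ?_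
    rw [h1]
    simp only [zeta_s]
    rfl
  simp only [Cherednik.eu, map_sub, map_sum, map_mul, map_smul, LinearMap.sub_apply,
    LinearMap.sum_apply, LinearMap.smul_apply, Module.End.mul_apply]
  exact sub_smul_eq_of_eq_add h2

theorem invEuler_grading (hb : TraceOrthonormal b) (f : invariants n N) :
    ∃ (s : Finset ℕ) (g : ℕ → invariants n N),
      f = ∑ d ∈ s, g d ∧ ∀ d, invEuler hb n (g d) = (d : ℂ) • g d := by
  classical
  obtain ⟨s, g, hfg, hg, -, -⟩ := exists_sum_of_grading (E := eulerOp n N) eulerOp_constFun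
    (tensorFun_grading n N) (f : TensorFun n N)
  have hmem := eigencomponent_mem (E := eulerOp n N) (invariants n N) (fun u hu => by
      rw [← tensorWeyl_euler (b := b)]
      exact (invEuler hb n ⟨u, hu⟩).2) s g hg (by rw [← hfg]; exact f.2)
  -- Invariance is known only for the components indexed by s, so the others are set to zero.
  refine ⟨s, fun d => if hd : d ∈ s then ⟨g d, hmem d hd⟩ else 0, Subtype.ext ?_, fun d => ?_⟩
  · rw [hfg, Submodule.coe_sum]
    refine Finset.sum_congr rfl fun d hd => ?_
    rw [dif_pos hd]
  · dsimp only
    split_ifs with hd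
    · rw [invEuler_eq_iff, tensorWeyl_euler]
      exact hg d
    · rw [map_zero, smul_zero]

omit [Fintype ι] [DecidableEq ι] in
theorem partialDer_constFun (p : ι) (u : TensorPow n N) :
    partialDer b n p (constFun n N u) = 0 := by
  rw [constFun_apply, partialDer, polyOp_tmul]
  simp

theorem constFun_mem_invariants (hb : TraceOrthonormal b) {u : TensorPow n N} :
    constFun n N u ∈ invariants n N ↔ u ∈ tensorInv n N := by
  have h : ∀ ξ : sl N, slAction ξ (constFun n N u) = constFun n N (diagAction n N ξ u) := by
    intro ξ
    rw [hb.slAction_eq, LinearMap.add_apply, adOp, LinearMap.sum_apply,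
      Finset.sum_eq_zero fun r _ => ?_, zero_add]
    · rfl
    · rw [LinearMap.sum_apply]
      refine Finset.sum_eq_zero fun s _ => ?_
      rw [LinearMap.smul_apply, Module.End.mul_apply, partialDer_constFun, map_zero, smul_zero]
  rw [mem_invariants, mem_tensorInv]
  refine forall_congr' fun ξ => ?_
  rw [h]
  refine ⟨fun h => ?_, fun h => by rw [h, map_zero]⟩
  rw [← evalAt_constFun 0 (diagAction n N (ξ : Mat N) u), h, map_zero]

/-- The invariant tensors as constant functions in `V_N`. -/
def constInv (hb : TraceOrthonormal b) : tensorInv n N →ₗ[ℂ] invariants n N :=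
  (constFun n N).restrict fun _ hu => (constFun_mem_invariants hb).mpr hu

theorem constInv_coe (hb : TraceOrthonormal b) (u : tensorInv n N) :
    (constInv hb u : TensorFun n N) = constFun n N u := rfl

theorem constInv_injective (hb : TraceOrthonormal b) :
    Function.Injective (constInv (n := n) hb) := by
  intro u v h
  have := congrArg (fun f : invariants n N => evalAt 0 (f : TensorFun n N)) h
  simp only [constInv_coe, evalAt_constFun] at this
  exact Subtype.ext this

theorem range_constInv (hb : TraceOrthonormal b) :
    LinearMap.range (constInv (n := n) hb) = LinearMap.ker (invEuler hb n) := by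
  refine le_antisymm ?_ fun f hf => ?_
  · rintro _ ⟨u, rfl⟩
    refine Subtype.ext ?_
    rw [invEuler_coe, tensorWeyl_euler]
    exact eulerOp_constFun _
  · have hf' : eulerOp n N (f : TensorFun n N) = 0 := by
      rw [← tensorWeyl_euler (b := b)]
      exact congrArg Subtype.val (LinearMap.mem_ker.mp hf)
    obtain ⟨u, hu⟩ := mem_range_of_grading eulerOp_constFun (tensorFun_grading n N) hf'
    have huT : u ∈ tensorInv n N := by
      rw [← constFun_mem_invariants hb, hu]
      exact f.2
    exact ⟨⟨u, huT⟩, Subtype.ext hu⟩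

theorem zeta_s_constInv (hb : TraceOrthonormal b) (hN : 0 < N) (σ : Equiv.Perm (Fin n))
    (u : tensorInv n N) : zeta hb hN n (Cherednik.s σ) (constInv hb u) =
      constInv hb ⟨permFactors σ u, permFactors_mem_tensorInv σ u.2⟩ :=
  Subtype.ext (zeta_s hb hN σ _)

theorem zeta_y_constInv (hb : TraceOrthonormal b) (hN : 0 < N) (i : Fin n)
    (u : tensorInv n N) : zeta hb hN n (Cherednik.y i) (constInv hb u) = 0 := by
  refine Subtype.ext ?_
  rw [zeta_y, constInv_coe, tensorWeyl_y_apply, Finset.sum_eq_zero fun p _ => by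
    rw [partialDer_constFun, map_zero], smul_zero]
  rfl

theorem invEuler_y (hb : TraceOrthonormal b) (hN : 0 < N) {d : ℂ} {f : invariants n N}
    (hf : invEuler hb n f = (d + 1) • f) (i : Fin n) :
    invEuler hb n (zeta hb hN n (Cherednik.y i) f) = d • zeta hb hN n (Cherednik.y i) f := by
  rw [invEuler_eq_iff, zeta_y]
  refine eq_smul_of_add_eq ((LinearMap.congr_fun ((tensorWeyl b n).euler_y i) _).trans ?_)
  rw [← map_smul]
  exact congrArg ((tensorWeyl b n).y i) ((invEuler_eq_iff hb).mp hf)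

theorem sum_x_y_eq (hb : TraceOrthonormal b) (hN : 0 < N) (hn : 0 < n) {d : ℂ}
    {f : invariants n N} (hf : invEuler hb n f = d • f) :
    ((∑ i, zeta hb hN n (Cherednik.x i) (zeta hb hN n (Cherednik.y i) f) : invariants n N) :
      TensorFun n N) = tensOp n N (shiftedCasimir b n d ((N : ℂ) / n / 2)) f := by
  refine (sum_x_y_coe hb hN hn f).trans (Eq.trans ?_ (tensOp_shiftedCasimir_apply _ _ _).symm)
  exact congrArg (· + _) ((invEuler_eq_iff hb).mp hf)

open scoped ComplexOrder in
theorem tensOp_shiftedCasimir_bijective (hb : TraceOrthonormal b) (hN : 0 < N) (n d : ℕ) :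
    Function.Bijective (tensOp n N (shiftedCasimir b n ((d : ℂ) + 1) ((N : ℂ) / n / 2))) := by
  refine tensOp_bijective (shiftedCasimir_injective hb hN ?_ ?_)
  · exact_mod_cast d.succ_pos
  · have : (0 : ℝ) ≤ (N : ℝ) / n / 2 := by positivity
    have h : ((N : ℂ) / n / 2) = (((N : ℝ) / n / 2 : ℝ) : ℂ) := by push_cast; rfl
    rw [h]
    exact_mod_cast this

/-- The shifted Casimir operator is bijective and commutes with 𝔰𝔩_N and with the Euler operator, so
the preimage inherits invariance and degree from f. -/
theorem exists_shiftedCasimir_preimage (hb : TraceOrthonormal b) (hN : 0 < N) {d : ℕ}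
    {f : invariants n N} (hf : invEuler hb n f = ((d : ℂ) + 1) • f) :
    ∃ g : invariants n N, invEuler hb n g = ((d : ℂ) + 1) • g ∧
      tensOp n N (shiftedCasimir b n ((d : ℂ) + 1) ((N : ℂ) / n / 2)) g = f := by
  have hbij := tensOp_shiftedCasimir_bijective hb hN n d
  set C := tensOp n N (shiftedCasimir b n ((d : ℂ) + 1) ((N : ℂ) / n / 2)) with hC
  have hcomm : ∀ z : Module.End ℂ (TensorFun n N), z * (tensorWeyl b n).cas =
      (tensorWeyl b n).cas * z → ∀ g, C (z g) = z (C g) := by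
    intro z hz g
    rw [hC, tensOp_shiftedCasimir_apply, tensOp_shiftedCasimir_apply, map_add, map_smul, map_smul]
    congr 2
    exact (LinearMap.congr_fun hz g).symm
  obtain ⟨g, hg⟩ := hbij.2 (f : TensorFun n N)
  have hinv : g ∈ invariants n N := by
    rw [← isInvariant_iff hb]
    intro ξ
    refine hbij.1 ((hcomm _ ((tensorWeyl b n).act_cas hb ξ) g).trans ?_)
    rw [hg, map_zero]
    exact (isInvariant_iff hb).mpr f.2 ξ
  refine ⟨⟨g, hinv⟩, ?_, hg⟩
  rw [invEuler_eq_iff]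
  refine hbij.1 ((hcomm _ ((tensorWeyl b n).euler_cas hb) g).trans ?_)
  rw [map_smul]
  refine (congrArg _ hg).trans ((invEuler_eq_iff hb).mp hf |>.trans ?_)
  rw [hg]

/-- The action of the Cherednik algebra on `V_N`. -/
abbrev zetaModule (hb : TraceOrthonormal b) (hN : 0 < N) (n : ℕ) :
    Module (Cherednik n ((N : ℂ) / n)) (invariants n N) :=
  Module.compHom (invariants n N) (zeta hb hN n).toRingHom

theorem isScalarTower_zetaModule (hb : TraceOrthonormal b) (hN : 0 < N) (n : ℕ) :
    let := zetaModule hb hN n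
    IsScalarTower ℂ (Cherednik n ((N : ℂ) / n)) (invariants n N) := by
  let := zetaModule hb hN n
  exact ⟨fun c h f => LinearMap.congr_fun (map_smul (zeta hb hN n) c h) f⟩

theorem tensorInv_ne_bot {m : ℕ} (e : Fin N × Fin m ≃ Fin n) : tensorInv n N ≠ ⊥ := fun h =>
  colVector_ne_zero e ((Submodule.mem_bot ℂ).mp (h ▸ colVector_mem_tensorInv e))

theorem eq_ker_invEuler_of_ne_bot (hb : TraceOrthonormal b) (hN : 0 < N) {m : ℕ}
    (e : Fin N × Fin m ≃ Fin n) {U : Submodule ℂ (invariants n N)}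
    (hU : ∀ σ, ∀ u ∈ U, zeta hb hN n (Cherednik.s σ) u ∈ U)
    (hUk : U ≤ LinearMap.ker (invEuler hb n)) (hne : U ≠ ⊥) :
    U = LinearMap.ker (invEuler hb n) := by
  have hUr := hUk.trans (range_constInv hb).ge
  refine (eq_range_of_map_subtype_comap hUr (eq_tensorInv_of_ne_bot e hN (fun σ => ?_)
    (Submodule.map_subtype_le _ _) (map_subtype_comap_ne_bot hUr hne))).trans (range_constInv hb)
  exact mem_map_subtype_comap (fun u => permFactors_mem_tensorInv σ u.2)
    (zeta_s_constInv hb hN σ) (hU σ)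

theorem exists_constInv_eq (hb : TraceOrthonormal b) {f : invariants n N}
    (hf : invEuler hb n f = 0) : ∃ u, constInv hb u = f := (range_constInv hb).ge hf

theorem invEuler_constInv (hb : TraceOrthonormal b) (u : tensorInv n N) :
    invEuler hb n (constInv hb u) = 0 := (range_constInv hb).le ⟨u, rfl⟩

theorem zeta_y_eq_zero (hb : TraceOrthonormal b) (hN : 0 < N) {f : invariants n N}
    (hf : invEuler hb n f = 0) (i : Fin n) : zeta hb hN n (Cherednik.y i) f = 0 := by
  obtain ⟨u, rfl⟩ := exists_constInv_eq hb hf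
  exact zeta_y_constInv hb hN i u

theorem invEuler_zeta_s_eq_zero (hb : TraceOrthonormal b) (hN : 0 < N) {f : invariants n N}
    (hf : invEuler hb n f = 0) (σ : Equiv.Perm (Fin n)) :
    invEuler hb n (zeta hb hN n (Cherednik.s σ) f) = 0 := by
  obtain ⟨u, rfl⟩ := exists_constInv_eq hb hf
  rw [zeta_s_constInv]
  exact invEuler_constInv hb _

theorem eq_zero_of_zeta_y_eq_zero (hb : TraceOrthonormal b) (hN : 0 < N) (hn : 0 < n) {d : ℕ}
    {f : invariants n N} (hf : invEuler hb n f = ((d : ℂ) + 1) • f)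
    (hy : ∀ i, zeta hb hN n (Cherednik.y i) f = 0) : f = 0 := by
  have h : ∑ i, zeta hb hN n (Cherednik.x i) (zeta hb hN n (Cherednik.y i) f) = 0 :=
    Finset.sum_eq_zero fun i _ => (congrArg _ (hy i)).trans (map_zero _)
  refine Subtype.ext ((tensOp_shiftedCasimir_bijective hb hN n d).1 ?_)
  exact ((sum_x_y_eq hb hN hn hf).symm.trans (congrArg Subtype.val h)).trans (map_zero _).symm

/-- Invert ∑ x_i y_i in this degree: if g is the preimage of f, then f = ∑ x_i (y_i g). -/
theorem exists_eq_sum_zeta_x (hb : TraceOrthonormal b) (hN : 0 < N) (hn : 0 < n) {d : ℕ}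
    {f : invariants n N} (hf : invEuler hb n f = ((d : ℂ) + 1) • f) :
    ∃ g : Fin n → invariants n N, (∀ i, invEuler hb n (g i) = (d : ℂ) • g i) ∧
      f = ∑ i, zeta hb hN n (Cherednik.x i) (g i) := by
  obtain ⟨g, hg, hgf⟩ := exists_shiftedCasimir_preimage hb hN hf
  exact ⟨fun i => zeta hb hN n (Cherednik.y i) g, fun i => invEuler_y hb hN hg i,
    Subtype.ext (hgf.symm.trans (sum_x_y_eq hb hN hn hg).symm)⟩

theorem isLowestWeight_zeta (hb : TraceOrthonormal b) (hN : 0 < N) (hn : 0 < n) {m : ℕ}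
    (e : Fin N × Fin m ≃ Fin n) :
    let := zetaModule hb hN n
    IsLowestWeight n ((N : ℂ) / n) (invEuler (N := N) hb n)
      ((N : ℂ) / n / 2 * ((n : ℂ) * (N - 1) - n * n / N)) :=
  let := zetaModule hb hN n
  { eu_smul := zeta_eu hb hN hn
    grading := invEuler_grading hb
    y_smul := fun _ _ hf => invEuler_y hb hN hf
    y_smul_zero := fun _ hf => zeta_y_eq_zero hb hN hf
    singular := fun _ _ hf => eq_zero_of_zeta_y_eq_zero hb hN hn hf
    generated := fun _ _ hf => exists_eq_sum_zeta_x hb hN hn hf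
    irreducible := fun _ hU hUk hne => eq_ker_invEuler_of_ne_bot hb hN e hU hUk hne
    s_smul_ker := fun _ hf => invEuler_zeta_s_eq_zero hb hN hf
    ker_ne_bot := fun h => range_ne_bot_of_injective (constInv_injective hb) (tensorInv_ne_bot e)
      ((range_constInv hb).trans h) }

end KZB
end

/-! ### The main theorem -/

theorem mainTheorem9 (n N : ℕ) (hn : 0 < n) (hN : N ∣ n)
    {ι : Type*} [Fintype ι] [DecidableEq ι] (b : Module.Basis ι ℂ (KZB.sl N))
    (hb : ∀ p q, Matrix.trace ((b p : Matrix (Fin N) (Fin N) ℂ) * (b q : Matrix (Fin N) (Fin N) ℂ))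
      = if p = q then 1 else 0) :
    ∃ ζ : KZB.Cherednik n ((N : ℂ) / n) →ₐ[ℂ] Module.End ℂ (KZB.invariants n N),
      (∀ (σ : Equiv.Perm (Fin n)) (f : KZB.invariants n N) (A : KZB.sl N),
        KZB.evalAt A (ζ (KZB.Cherednik.s σ) f : KZB.TensorFun n N) =
          KZB.permFactors σ (KZB.evalAt A (f : KZB.TensorFun n N))) ∧
      (∀ (i : Fin n) (f : KZB.invariants n N) (A : KZB.sl N),
        KZB.evalAt A (ζ (KZB.Cherednik.x i) f : KZB.TensorFun n N) =
          KZB.atFactor i (A : Matrix (Fin N) (Fin N) ℂ)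
            (KZB.evalAt A (f : KZB.TensorFun n N))) ∧
      (∀ (i : Fin n) (f : KZB.invariants n N) (A : KZB.sl N),
        KZB.evalAt A (ζ (KZB.Cherednik.y i) f : KZB.TensorFun n N) =
          ((N : ℂ) / n) • ∑ p, KZB.atFactor i (b p : Matrix (Fin N) (Fin N) ℂ)
            (KZB.evalAt A (KZB.tensorDeriv (b p) (f : KZB.TensorFun n N)))) ∧
      letI : Module (KZB.Cherednik n ((N : ℂ) / n)) (KZB.invariants n N) :=
        Module.compHom (KZB.invariants n N) ζ.toRingHom
      IsSimpleModule (KZB.Cherednik n ((N : ℂ) / n)) (KZB.invariants n N) ∧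
      Nonempty (KZB.invariants n N ≃ₗ[KZB.Cherednik n ((N : ℂ) / n)]
        KZB.LowestWeightModule ((N : ℂ) / n) (KZB.rectRep n N)) := by
  obtain ⟨m, hm⟩ := hN
  have hN0 : 0 < N := Nat.pos_of_ne_zero fun h => by simp [h] at hm; omega
  have hb' : KZB.TraceOrthonormal b := hb
  refine ⟨KZB.zeta hb' hN0 n, fun σ f A => ?_, fun i f A => ?_, fun i f A => ?_, ?_⟩
  · rw [KZB.zeta_s, KZB.evalAt_tensOp]
  · rw [KZB.zeta_x, KZB.evalAt_x]
  · rw [KZB.zeta_y, KZB.evalAt_y]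
  · let := KZB.zetaModule hb' hN0 n
    have := KZB.isScalarTower_zetaModule hb' hN0 n
    have hE := KZB.isLowestWeight_zeta hb' hN0 hn (KZB.rectTableau hm.symm)
    obtain ⟨φ, hφ, hφσ, hφr⟩ := KZB.exists_tableauIso (KZB.rectTableau hm.symm) hN0
      (KZB.rectSymmetrizer_eq hm.symm hN0)
    -- The Young ideal is identified with the invariant tensors, and these with the constant
    -- functions, the degree-zero part of V_N.
    let ψ : KZB.RectModule n N →ₗ[ℂ] KZB.invariants n N :=
      KZB.constInv hb' ∘ₗ φ.codRestrict (KZB.tensorInv n N) fun z => hφr.le ⟨z, rfl⟩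
    refine ⟨hE.isSimpleModule, hE.nonempty_linearEquiv hn ψ ?_ (fun σ z => ?_) ?_⟩
    · exact (KZB.constInv_injective hb').comp
        ((LinearMap.injective_codRestrict_iff _).mpr hφ)
    · refine Eq.trans ?_ (KZB.zeta_s_constInv hb' hN0 σ _).symm
      exact congrArg (KZB.constInv hb') (Subtype.ext (hφσ σ z))
    · rw [LinearMap.range_comp, LinearMap.range_codRestrict, hφr, Submodule.comap_subtype_self,
        Submodule.map_top, KZB.range_constInv]
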